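/- Let $A$ be a polynomial ring over $\mathbb C$ in finitely many variables, and let $D(A)$ be its ring of differential operators (the Weyl algebra), generated by $A$ and the $\mathbb C$-derivations of $A$. For nonzero $f_1,\dots,f_r\in A$ and indeterminates $s_1,\dots,s_r$, the ring $D(A)[s_1,\dots,s_r]$ acts on the free module $A_{f_1\cdots f_r}[s_1,\dots,s_r]\cdot f_1^{s_1}\cdots f_r^{s_r}$ by $$\delta\big(c\, f_1^{s_1}\cdots f_r^{s_r}\big)=\Big(\delta(c)+c\sum_{i} s_i\frac{\delta(f_i)}{f_i}\Big) f_1^{s_1}\cdots f_r^{s_r}$$ for every derivation $\delta$ of $A$ (extended to $A_{f_1\cdots f_r}[s_1,\dots,s_r]$ with $\delta(s_i)=0$). The Bernstein–Sato polynomial $b_g$ of a nonzero $g\in A$ is the monic polynomial $b\in\mathbb C[s]$ of least degree with $b(s)\,g^s\in D(A)[s]\cdot g^{s+1}$. The Bernstein–Sato polynomial $b_{\mathfrak a}$ of a nonzero ideal $\mathfrak a=(f_1,\dots,f_r)$ of $A$, all $f_i\ne 0$, is the monic polynomial $b\in\mathbb C[s]$ of least degree with $$b(s_1+\cdots+s_r)\,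 f_1^{s_1}\cdots f_r^{s_r}\in\sum_{u\in\mathbb Z^r,\ u_1+\cdots+u_r=1} D(A)[s_1,\dots,s_r]\cdot\Big(\prod_{u_i<0}\binom{s_i}{-u_i}\Big) f_1^{s_1+u_1}\cdots f_r^{s_r+u_r}.$$ These polynomials exist, and $b_{\mathfrak a}$ does not depend on the choice of the finite family of nonzero generators of $\mathfrak a$. **Proposition.** Let $\mathfrak a\subseteq\mathbb C[x_1,\dots,x_n]$ be a nonzero ideal and let $g\in\mathbb C[y_1,\dots,y_m]$ be a nonzero polynomial, in a disjoint set of variables. Let $\mathfrak a\cdot(g)$ be the ideal of $\mathbb C[x_1,\dots,x_n,y_1,\dots,y_m]$ that is the product of the ideal generated by $\mathfrak a$ and the principal ideal generated by $g$. Then $$b_{\mathfrak a\cdot(g)}(s)=b_{\mathfrak a}(s)\cdot b_g(s).$$ -/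

import Mathlib

open scoped BigOperators

noncomputable section

namespace BernsteinSato

variable (A : Type*) [CommRing A] [Algebra ℂ A] (ι : Type*)

/-- The carrier of the module in which the formal powers `f₁ ^ (s₁ + u₁) ⋯ f_r ^ (s_r + u_r)` live:
polynomials in the indeterminates `s i = X i` with coefficients in the fraction field of `A`.
An element `c` stands for `c · f₁ ^ s₁ ⋯ f_r ^ s_r`. (The `D(A)[s]`-submodules considered below are
contained in the submodule `A_f[s]`, where `f` is the product of the `f i`, so that it is immaterial
whether one inverts only this product or all nonzero elements of `A`.) -/
abbrev PowerModule : Type _ := MvPolynomial ι (FractionRing A)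

variable {A ι}

/-- `E` is the extension of the derivation `δ` of `A` to `Frac(A)[s]` with `E (s i) = 0`,
that is, `δ` extended by the quotient rule and applied coefficientwise.
It is unique, and it exists by `exists_extendsDerivation`. -/
def ExtendsDerivation (δ : Derivation ℂ A A)
    (E : Derivation ℂ (PowerModule A ι) (PowerModule A ι)) : Prop :=
  (∀ a : A, E (algebraMap A (PowerModule A ι) a) = algebraMap A (PowerModule A ι) (δ a)) ∧
    ∀ i : ι, E (MvPolynomial.X i) = 0

/-- Every derivation of `A` extends to `Frac(A)[s]`. -/
theorem exists_extendsDerivation (δ : Derivation ℂ A A) :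
    ∃ E : Derivation ℂ (PowerModule A ι) (PowerModule A ι), ExtendsDerivation δ E := by
  let M := PowerModule A ι
  let φ₀ : A →+* TrivSqZeroExt M M :=
    { toFun := fun a => (algebraMap A M a, algebraMap A M (δ a))
      map_one' := by
        apply TrivSqZeroExt.ext
        · exact map_one _
        · change algebraMap A M (δ 1) = 0
          rw [Derivation.map_one_eq_zero, map_zero]
      map_zero' := by
        apply TrivSqZeroExt.ext
        · exact map_zero _
        · change algebraMap A M (δ 0) = 0
          rw [map_zero, map_zero]
      map_mul' := fun a b => by
        apply TrivSqZeroExt.ext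
        · exact map_mul _ _ _
        · change algebraMap A M (δ (a * b)) = algebraMap A M a • algebraMap A M (δ b)
            + MulOpposite.op (algebraMap A M b) • algebraMap A M (δ a)
          rw [Derivation.leibniz, map_add, op_smul_eq_smul]
          simp only [smul_eq_mul, map_mul]
      map_add' := fun a b => by
        apply TrivSqZeroExt.ext
        · exact map_add _ _ _
        · change algebraMap A M (δ (a + b)) = algebraMap A M (δ a) + algebraMap A M (δ b)
          rw [map_add, map_add] }
  have hu : ∀ y : nonZeroDivisors A, IsUnit (φ₀ y) := by
    intro y
    rw [TrivSqZeroExt.isUnit_iff_isUnit_fst]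
    change IsUnit (algebraMap A M y)
    rw [IsScalarTower.algebraMap_apply A (FractionRing A) M]
    exact (IsLocalization.map_units (FractionRing A) y).map _
  let φ : M →+* TrivSqZeroExt M M :=
    MvPolynomial.eval₂Hom (IsLocalization.lift hu) (fun i => TrivSqZeroExt.inl (MvPolynomial.X i))
  have hφA : ∀ a : A, φ (algebraMap A M a) = φ₀ a := by
    intro a
    rw [IsScalarTower.algebraMap_apply A (FractionRing A) M, MvPolynomial.algebraMap_eq]
    change MvPolynomial.eval₂Hom _ _ (MvPolynomial.C _) = _
    rw [MvPolynomial.coe_eval₂Hom, MvPolynomial.eval₂_C, IsLocalization.lift_eq]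
  have hφX : ∀ i : ι, φ (MvPolynomial.X i) = TrivSqZeroExt.inl (MvPolynomial.X i) := fun i => by
    change MvPolynomial.eval₂Hom _ _ _ = _
    rw [MvPolynomial.coe_eval₂Hom, MvPolynomial.eval₂_X]
  have hfst : ((TrivSqZeroExt.fstHom M M M : TrivSqZeroExt M M →+* M)).comp φ = RingHom.id M := by
    apply MvPolynomial.ringHom_ext'
    · apply IsLocalization.ringHom_ext (nonZeroDivisors A)
      refine RingHom.ext fun a => ?_
      change (φ (MvPolynomial.C (algebraMap A (FractionRing A) a))).fst
        = MvPolynomial.C (algebraMap A (FractionRing A) a)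
      have := hφA a
      rw [IsScalarTower.algebraMap_apply A (FractionRing A) M, MvPolynomial.algebraMap_eq] at this
      rw [this]
      change algebraMap A M a = _
      rw [IsScalarTower.algebraMap_apply A (FractionRing A) M, MvPolynomial.algebraMap_eq]
    · intro i
      change (φ (MvPolynomial.X i)).fst = MvPolynomial.X i
      rw [hφX, TrivSqZeroExt.fst_inl]
  have hfst' : ∀ x : M, (φ x).fst = x := fun x => RingHom.congr_fun hfst x
  have hleib : ∀ x y : M, (φ (x * y)).snd = x * (φ y).snd + y * (φ x).snd := by
    intro x y
    rw [map_mul, TrivSqZeroExt.snd_mul, hfst', hfst', op_smul_eq_smul, smul_eq_mul, smul_eq_mul]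
  have hsmul : ∀ (c : ℂ) (x : M), (φ (c • x)).snd = c • (φ x).snd := by
    intro c x
    rw [Algebra.smul_def, hleib, Algebra.smul_def, IsScalarTower.algebraMap_apply ℂ A M, hφA]
    change _ + x * algebraMap A M (δ (algebraMap ℂ A c)) = _
    rw [Derivation.map_algebraMap, map_zero, mul_zero, add_zero]
  let L : M →ₗ[ℂ] M :=
    { toFun := fun x => (φ x).snd
      map_add' := fun x y => by rw [map_add, TrivSqZeroExt.snd_add]
      map_smul' := hsmul }
  refine ⟨Derivation.mk' L (fun x y => hleib x y), fun a => ?_, fun i => ?_⟩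
  · change (φ (algebraMap A M a)).snd = _
    rw [hφA]
    rfl
  · change (φ (MvPolynomial.X i)).snd = 0
    rw [hφX, TrivSqZeroExt.snd_inl]

variable [IsDomain A] [Fintype ι]

/-- The factor `∑ i, s i * δ (f i) / f i` by which `δ` acts on the symbol `f₁ ^ s₁ ⋯ f_r ^ s_r`. -/
def logDerivative (f : ι → A) (δ : Derivation ℂ A A) : PowerModule A ι :=
  ∑ i, MvPolynomial.X i *
    MvPolynomial.C (algebraMap A (FractionRing A) (δ (f i)) / algebraMap A (FractionRing A) (f i))

/-- The ring `D(A)[s]` of differential operators, generated by `A`, by the `s i` and by the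
derivations of `A`, as it acts on `Frac(A)[s] · f₁ ^ s₁ ⋯ f_r ^ s_r`. A derivation `δ` acts by
`δ (c · f ^ s) = (δ c + c * ∑ i, s i * δ (f i) / f i) · f ^ s`. -/
def diffOps (f : ι → A) : Subalgebra ℂ (Module.End ℂ (PowerModule A ι)) :=
  Algebra.adjoin ℂ
    ({T | ∃ a : A, T = LinearMap.mulLeft ℂ (algebraMap A (PowerModule A ι) a)} ∪
     {T | ∃ i : ι, T = LinearMap.mulLeft ℂ (MvPolynomial.X i)} ∪
     {T | ∃ (δ : Derivation ℂ A A) (E : Derivation ℂ (PowerModule A ι) (PowerModule A ι)),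
        ExtendsDerivation δ E ∧
          T = (E : PowerModule A ι →ₗ[ℂ] PowerModule A ι)
            + LinearMap.mulLeft ℂ (logDerivative f δ)})

/-- The element `f₁ ^ (s₁ + u₁) ⋯ f_r ^ (s_r + u_r)`, for integers `u₁, …, u_r`. -/
def shiftedPower (f : ι → A) (u : ι → ℤ) : PowerModule A ι :=
  MvPolynomial.C (∏ i, algebraMap A (FractionRing A) (f i) ^ u i)

/-- The binomial coefficient `s i (s i - 1) ⋯ (s i - k + 1) / k!`. -/
def binomialCoeff (A : Type*) [CommRing A] [IsDomain A] (i : ι) (k : ℕ) : PowerModule A ι :=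
  MvPolynomial.C ((Nat.factorial k : FractionRing A)⁻¹) *
    ∏ j ∈ Finset.range k, (MvPolynomial.X i - MvPolynomial.C (j : FractionRing A))

/-- The functional equation of a family `f` of elements of `A`: the element
`b(s₁ + ⋯ + s_r) f₁ ^ s₁ ⋯ f_r ^ s_r` lies in the sum, over all integer vectors `u` with
`u₁ + ⋯ + u_r = 1`, of the `D(A)[s]`-modules generated by
`(∏_{u i < 0} binom (s i) (- u i)) · f₁ ^ (s₁ + u₁) ⋯ f_r ^ (s_r + u_r)`. -/
def FamilyEquation (f : ι → A) (b : Polynomial ℂ) : Prop :=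
  Polynomial.aeval (∑ i, MvPolynomial.X i : PowerModule A ι) b * shiftedPower f 0 ∈
    Submodule.span (diffOps f)
      {v : PowerModule A ι | ∃ u : ι → ℤ, ∑ i, u i = 1 ∧
        v = (∏ i, if u i < 0 then binomialCoeff A i (-u i).toNat else 1) * shiftedPower f u}

/-- The functional equation of a single element `g`: `b(s) · g ^ s ∈ D(A)[s] · g ^ (s + 1)`. -/
def ElementEquation (g : A) (b : Polynomial ℂ) : Prop :=
  Polynomial.aeval (MvPolynomial.X () : PowerModule A Unit) b * shiftedPower (fun _ => g) 0 ∈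
    Submodule.span (diffOps (fun _ : Unit => g)) {shiftedPower (fun _ : Unit => g) 1}

/-- `b` is monic and has the least degree among the nonzero polynomials that satisfy `P`. -/
def IsMinimalPolynomial (P : Polynomial ℂ → Prop) (b : Polynomial ℂ) : Prop :=
  b.Monic ∧ P b ∧ ∀ c : Polynomial ℂ, c ≠ 0 → P c → b.natDegree ≤ c.natDegree

/-- `b` is the Bernstein-Sato polynomial of the nonzero element `g` of `A`. -/
def IsBernsteinSatoOfElement (g : A) (b : Polynomial ℂ) : Prop :=
  IsMinimalPolynomial (ElementEquation g) b

/-- `b` is the Bernstein-Sato polynomial of the nonzero (finitely generated) ideal `𝔞` of `A`: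
it is the one computed from any finite family of nonzero generators of `𝔞`. -/
def IsBernsteinSatoOfIdeal (𝔞 : Ideal A) (b : Polynomial ℂ) : Prop :=
  ∀ (r : ℕ) (f : Fin r → A), (∀ i, f i ≠ 0) → Ideal.span (Set.range f) = 𝔞 →
    IsMinimalPolynomial (FamilyEquation f) b

end BernsteinSato

end

/-!
The Bernstein-Sato polynomial of an ideal is reduced to that of a single polynomial. For a family
`f` with members `f i` in `ℂ[x]`, let `F = ∑ i, y i * f i` be the linear form in new variables `y i`
with coefficients `f i`. Then `b` satisfies the functional equation of the family `f` if and only if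
`(s + 1) b (s)` satisfies that of the polynomial `F` (`familyEquation_iff_elementEquation`), and all
polynomials in the functional equation of `F` are divisible by `s + 1`
(`X_add_one_dvd_of_elementEquation`). Hence `b_F = (s + 1) b_𝔞`.

The linear form of the family of the `f i * g` is `F * g`, and `F` and `g` involve disjoint sets of
variables. So the theorem follows from the formula `b_{F g} = b_F b_g` for polynomials in disjoint
sets of variables (`bernsteinIdeal_outerProduct`). The same formula with `g = 1` shows that
additional variables are harmless, and this gives the independence of `b_𝔞` of the generators:
enlarging `f` by elements of the ideal that it generates amounts to a linear change of the
coordinates `y` (`bernsteinIdeal_linearForm_sumElim`).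

* The passage from `f` to `F` compares values at natural exponents. An element of the module
  `Frac(A)[s] f ^ s` is determined by its specializations at vectors of natural numbers
  (`mem_opClosure_diffGen_iff`), so the functional equations become statements about spaces of
  functions `κ ↦ h (κ)`. The coefficients of `F ^ K` with respect to `y` are the multiples
  `K! / κ! · f ^ κ` with `|κ| = K`. Under this dictionary, multiplication by `y i` and `∂ / ∂ y i`
  become the shifts `h (κ) ↦ κ i h (κ - e i)` and `h (κ) ↦ h (κ + e i)`, and these shifts generate
  the elements with the binomial coefficients in the functional equation of `f` from `f ^ κ`
  (`generatorFun_mem_of_shift`). The factor `s + 1` is the quotient of `(K + 1)!` and `K!`.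

* In the product formula, `b_F b_g` clearly satisfies the functional equation of `F g`. If a proper
  divisor did, there would be a root `l` such that `b_F F ^ s · b_g g ^ s` is divisible by `s - l` in
  `D[s] (F g) ^ (s + 1)`, which is spanned by products of elements of `D[s] F ^ (s + 1)` and
  `D[s] g ^ (s + 1)`. Expanding the factors from the second module in a basis of a finitely generated
  `ℂ[s]`-submodule, one finds that `b_F F ^ s` or `b_g g ^ s` is divisible by `s - l` in its module
  (`exists_eq_smul_of_powerMul_eq_smul`). This contradicts the minimality of `b_F` or `b_g`.

* The existence of functional equations is Bernstein's theorem (`exists_elementEquation`). Over the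
  field `ℂ(s)`, the localization of `ℂ(s)[x]` at `g`, twisted by `g ^ s`, has a filtration by pole
  order whose ranks grow as a polynomial of degree `n` in `n` variables. By Bernstein's inequality
  (`IsWeylAction.pow_le_finrank`), every nonzero subquotient grows at least that fast, so the
  descending chain of the submodules generated by the `g ^ (s + j)` is stationary somewhere.
-/

set_option linter.unusedSectionVars false

noncomputable section

namespace BernsteinSato

/-! ### Subspaces generated under a family of operators -/

section OpClosure

variable {R V V' J : Type*} [CommRing R] [AddCommGroup V] [Module R V] [AddCommGroup V']
  [Module R V']

/-- The smallest submodule of `V` that contains `S` and is stable under all the operators `T j`. -/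
def opClosure (T : J → Module.End R V) (S : Set V) : Submodule R V :=
  sInf {N | S ⊆ N ∧ ∀ j, ∀ v ∈ N, T j v ∈ N}

theorem subset_opClosure (T : J → Module.End R V) (S : Set V) : S ⊆ opClosure T S := by
  intro v hv
  simp only [opClosure, SetLike.mem_coe, Submodule.mem_sInf]
  exact fun N hN => hN.1 hv

theorem apply_mem_opClosure {T : J → Module.End R V} {S : Set V} (j : J) {v : V}
    (hv : v ∈ opClosure T S) : T j v ∈ opClosure T S := by
  simp only [opClosure, Submodule.mem_sInf] at hv ⊢
  exact fun N hN => hN.2 j v (hv N hN)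

theorem opClosure_le {T : J → Module.End R V} {S : Set V} {N : Submodule R V}
    (hS : S ⊆ N) (hT : ∀ j, ∀ v ∈ N, T j v ∈ N) : opClosure T S ≤ N :=
  sInf_le ⟨hS, hT⟩

/-- Every element of the closure of a set of generators has a counterpart in the closure of the
related generators, for any linear relation that is preserved by the operators. -/
theorem exists_related_of_mem_opClosure {T : J → Module.End R V} {T' : J → Module.End R V'}
    {I : Type*} {x : I → V} {x' : I → V'} (rel : Submodule R (V × V'))
    (hT : ∀ j v v', (v, v') ∈ rel → (T j v, T' j v') ∈ rel)
    (hx : ∀ i, (x i, x' i) ∈ rel) {v : V} (hv : v ∈ opClosure T (Set.range x)) :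
    ∃ v' ∈ opClosure T' (Set.range x'), (v, v') ∈ rel := by
  have : opClosure T (Set.range x) ≤
      (rel ⊓ (opClosure T' (Set.range x')).comap (LinearMap.snd R V V')).map
        (LinearMap.fst R V V') := by
    refine opClosure_le ?_ ?_
    · rintro _ ⟨i, rfl⟩
      exact ⟨(x i, x' i), ⟨hx i, subset_opClosure _ _ ⟨i, rfl⟩⟩, rfl⟩
    · rintro j _ ⟨⟨v, v'⟩, ⟨h1, h2⟩, rfl⟩
      exact ⟨(T j v, T' j v'), ⟨hT j v v' h1, apply_mem_opClosure j h2⟩, rfl⟩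
  obtain ⟨⟨v, v'⟩, ⟨h1, h2⟩, rfl⟩ := this hv
  exact ⟨v', h2, h1⟩

/-- The module generated over an algebra of operators is the subspace generated under any family of
operators that generates this algebra. -/
theorem mem_span_adjoin_iff_mem_opClosure (T : J → Module.End R V) (S : Set V) (v : V) :
    v ∈ Submodule.span (Algebra.adjoin R (Set.range T)) S ↔ v ∈ opClosure T S := by
  constructor
  · have key : ∀ P ∈ Algebra.adjoin R (Set.range T), ∀ v ∈ opClosure T S,
        P v ∈ opClosure T S := by
      intro P hP
      induction hP using Algebra.adjoin_induction with
      | mem P h => obtain ⟨j, rfl⟩ := h; exact fun v hv => apply_mem_opClosure j hv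
      | algebraMap r => exact fun v hv => Submodule.smul_mem _ r hv
      | add P Q _ _ h1 h2 => exact fun v hv => Submodule.add_mem _ (h1 v hv) (h2 v hv)
      | mul P Q _ _ h1 h2 => exact fun v hv => h1 _ (h2 v hv)
    intro hv
    induction hv using Submodule.span_induction with
    | mem v h => exact subset_opClosure _ _ h
    | zero => exact zero_mem _
    | add v w _ _ h1 h2 => exact add_mem h1 h2
    | smul P v _ h => exact key P.1 P.2 v h
  · intro hv
    let N : Submodule R V :=
      (Submodule.span (Algebra.adjoin R (Set.range T)) S).restrictScalars R
    have : opClosure T S ≤ N := by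
      refine opClosure_le Submodule.subset_span fun j v hv => ?_
      exact Submodule.smul_mem (Submodule.span (Algebra.adjoin R (Set.range T)) S)
        (⟨T j, Algebra.subset_adjoin ⟨j, rfl⟩⟩ : Algebra.adjoin R (Set.range T)) hv
    exact this hv

end OpClosure

/-! ### Calculus in the power module -/

section Calculus

variable {A : Type*} [CommRing A] [Algebra ℂ A] {ι : Type*}

/-- An algebra map intertwines the extension of a derivation of `A` with a second derivation as soon
as it does so on `A` and on the `s i`. On fractions this is forced by the Leibniz rule. -/
theorem ExtendsDerivation.intertwines {M : Type*} [CommRing M] [Algebra ℂ M]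
    {δ : Derivation ℂ A A} {E : Derivation ℂ (PowerModule A ι) (PowerModule A ι)}
    (hE : ExtendsDerivation δ E) (φ : PowerModule A ι →ₐ[ℂ] M) (D : Derivation ℂ M M)
    (hA : ∀ a : A, D (φ (algebraMap A _ a)) = φ (algebraMap A _ (δ a)))
    (hX : ∀ i, D (φ (MvPolynomial.X i)) = 0) (p : PowerModule A ι) : D (φ p) = φ (E p) := by
  have hC : ∀ x : FractionRing A, D (φ (MvPolynomial.C x)) = φ (E (MvPolynomial.C x)) := by
    intro x
    obtain ⟨⟨a, d⟩, h⟩ := IsLocalization.surj (nonZeroDivisors A) x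
    set cx : PowerModule A ι := MvPolynomial.C x
    have h' : cx * algebraMap A (PowerModule A ι) d = algebraMap A (PowerModule A ι) a := by
      simp only [cx, IsScalarTower.algebraMap_apply A (FractionRing A) (PowerModule A ι),
        MvPolynomial.algebraMap_eq, ← map_mul]
      exact congrArg _ h
    have h1 : D (φ (cx * algebraMap A (PowerModule A ι) d))
        = φ (E (cx * algebraMap A (PowerModule A ι) d)) := by
      rw [h', hA, hE.1]
    have hu : IsUnit (φ (algebraMap A (PowerModule A ι) d)) := by
      refine IsUnit.map φ ?_
      rw [IsScalarTower.algebraMap_apply A (FractionRing A) (PowerModule A ι)]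
      exact (IsLocalization.map_units (FractionRing A) d).map _
    rw [map_mul, Derivation.leibniz, Derivation.leibniz, hA, hE.1] at h1
    simp only [smul_eq_mul, map_add, map_mul] at h1
    exact hu.mul_left_cancel (add_left_cancel h1)
  induction p using MvPolynomial.induction_on with
  | C x => exact hC x
  | add p q hp hq => rw [map_add, map_add, hp, hq, map_add, map_add]
  | mul_X p i hp =>
    rw [map_mul, Derivation.leibniz, Derivation.leibniz, hX, hE.2, hp]
    simp only [smul_eq_mul, map_add, map_mul, mul_zero, map_zero]

theorem ExtendsDerivation.unique {δ : Derivation ℂ A A}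
    {E E' : Derivation ℂ (PowerModule A ι) (PowerModule A ι)}
    (hE : ExtendsDerivation δ E) (hE' : ExtendsDerivation δ E') : E = E' := by
  refine Derivation.ext fun p => ?_
  exact (hE.intertwines (AlgHom.id ℂ _) E' hE'.1 hE'.2 p).symm

/-- The extension of a derivation of `A` to `Frac(A)[s]` that kills the `s i`. -/
def extend (ι : Type*) (δ : Derivation ℂ A A) :
    Derivation ℂ (PowerModule A ι) (PowerModule A ι) :=
  (exists_extendsDerivation δ).choose

theorem extend_spec (δ : Derivation ℂ A A) : ExtendsDerivation δ (extend ι δ) :=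
  (exists_extendsDerivation δ).choose_spec

@[simp] theorem extend_algebraMap (δ : Derivation ℂ A A) (a : A) :
    extend ι δ (algebraMap A _ a) = algebraMap A _ (δ a) := (extend_spec δ).1 a

@[simp] theorem extend_X (δ : Derivation ℂ A A) (i : ι) :
    extend ι δ (MvPolynomial.X i) = 0 := (extend_spec δ).2 i

theorem algebraMap_powerModule (a : A) : algebraMap A (PowerModule A ι) a
    = MvPolynomial.C (algebraMap A (FractionRing A) a) := by
  rw [IsScalarTower.algebraMap_apply A (FractionRing A) (PowerModule A ι),
    MvPolynomial.algebraMap_eq]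

variable [IsDomain A]

theorem algebraMap_powerModule_injective :
    Function.Injective (algebraMap A (PowerModule A ι)) := by
  intro a b h
  rw [algebraMap_powerModule, algebraMap_powerModule] at h
  exact IsFractionRing.injective A (FractionRing A) (MvPolynomial.C_injective _ _ h)

/-- The logarithmic derivative of `a ^ n`. -/
theorem extend_zpow (δ : Derivation ℂ A A) {a : A} (ha : a ≠ 0) (n : ℤ) :
    extend ι δ (MvPolynomial.C (algebraMap A (FractionRing A) a ^ n)) =
      (n • MvPolynomial.C (algebraMap A (FractionRing A) (δ a) / algebraMap A (FractionRing A) a))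
        * MvPolynomial.C (algebraMap A (FractionRing A) a ^ n) := by
  set x := algebraMap A (FractionRing A) a
  have hx : x ≠ 0 := fun h => ha ((IsFractionRing.injective A (FractionRing A))
    (by rw [map_zero]; exact h))
  set l : PowerModule A ι := MvPolynomial.C (algebraMap A (FractionRing A) (δ a) / x)
  have h1 : extend ι δ (MvPolynomial.C x) = l * MvPolynomial.C x := by
    rw [← algebraMap_powerModule, extend_algebraMap]
    simp only [l, x, algebraMap_powerModule]
    rw [← map_mul, div_mul_cancel₀ _ hx]
  have hnat : ∀ m : ℕ, extend ι δ (MvPolynomial.C (x ^ m)) = (m • l) * MvPolynomial.C (x ^ m) := by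
    intro m
    induction m with
    | zero => simp
    | succ m ih =>
      rw [pow_succ, map_mul, Derivation.leibniz, ih, h1]
      simp only [smul_eq_mul, nsmul_eq_mul]
      push_cast
      ring
  obtain ⟨m, rfl | rfl⟩ := n.eq_nat_or_neg
  · simpa using hnat m
  · have hc : (MvPolynomial.C (x ^ m) : PowerModule A ι) * MvPolynomial.C (x ^ (-(m : ℤ))) = 1 := by
      rw [← map_mul, zpow_neg, zpow_natCast, mul_inv_cancel₀ (pow_ne_zero _ hx), map_one]
    have h2 := congrArg (extend ι δ) hc
    rw [Derivation.leibniz, hnat, Derivation.map_one_eq_zero] at h2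
    simp only [smul_eq_mul] at h2
    have hu : IsUnit (MvPolynomial.C (x ^ m) : PowerModule A ι) := IsUnit.of_mul_eq_one _ hc
    refine hu.mul_left_cancel ?_
    rw [eq_neg_of_add_eq_zero_left h2]
    simp only [nsmul_eq_mul, zsmul_eq_mul]
    push_cast
    ring

variable [Fintype ι]

theorem shiftedPower_zero (f : ι → A) : shiftedPower f 0 = 1 := by
  simp [shiftedPower]

theorem shiftedPower_add {f : ι → A} (hf : ∀ i, f i ≠ 0) (u v : ι → ℤ) :
    shiftedPower f (u + v) = shiftedPower f u * shiftedPower f v := by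
  simp only [shiftedPower, ← map_mul, ← Finset.prod_mul_distrib, Pi.add_apply]
  congr 1
  refine Finset.prod_congr rfl fun i _ => zpow_add₀ (fun h => hf i ?_) _ _
  exact (IsFractionRing.injective A (FractionRing A)) (by rw [map_zero]; exact h)

theorem isUnit_shiftedPower {f : ι → A} (hf : ∀ i, f i ≠ 0) (u : ι → ℤ) :
    IsUnit (shiftedPower f u) :=
  IsUnit.of_mul_eq_one (shiftedPower f (-u)) (by
    rw [← shiftedPower_add hf, add_neg_cancel, shiftedPower_zero])

/-- The derivative of `f₁ ^ u₁ ⋯ f_r ^ u_r` is computed by its logarithmic derivative. -/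
theorem extend_shiftedPower (δ : Derivation ℂ A A) {f : ι → A} (hf : ∀ i, f i ≠ 0) (u : ι → ℤ) :
    extend ι δ (shiftedPower f u) =
      (∑ i, u i • MvPolynomial.C
        (algebraMap A (FractionRing A) (δ (f i)) / algebraMap A (FractionRing A) (f i)))
        * shiftedPower f u := by
  classical
  have : ∀ s : Finset ι,
      extend ι δ (MvPolynomial.C (∏ i ∈ s, algebraMap A (FractionRing A) (f i) ^ u i)) =
      (∑ i ∈ s, u i • MvPolynomial.C
        (algebraMap A (FractionRing A) (δ (f i)) / algebraMap A (FractionRing A) (f i)))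
        * MvPolynomial.C (∏ i ∈ s, algebraMap A (FractionRing A) (f i) ^ u i) := by
    intro s
    induction s using Finset.induction_on with
    | empty => simp
    | insert i s hi ih =>
      rw [Finset.prod_insert hi, Finset.sum_insert hi, map_mul, Derivation.leibniz, ih,
        extend_zpow δ (hf i)]
      simp only [smul_eq_mul]
      ring
  exact this Finset.univ

/-- The action of a derivation `δ` on `Frac(A)[s] · f₁ ^ s₁ ⋯ f_r ^ s_r`. -/
def connection (f : ι → A) (δ : Derivation ℂ A A) : Module.End ℂ (PowerModule A ι) :=
  (extend ι δ : PowerModule A ι →ₗ[ℂ] PowerModule A ι) + LinearMap.mulLeft ℂ (logDerivative f δ)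

theorem connection_apply (f : ι → A) (δ : Derivation ℂ A A) (p : PowerModule A ι) :
    connection f δ p = extend ι δ p + logDerivative f δ * p := rfl

/-- The generators of `D(A)[s]`, as operators on the power module. -/
def diffGen (f : ι → A) : A ⊕ ι ⊕ Derivation ℂ A A → Module.End ℂ (PowerModule A ι)
  | .inl a => LinearMap.mulLeft ℂ (algebraMap A _ a)
  | .inr (.inl i) => LinearMap.mulLeft ℂ (MvPolynomial.X i)
  | .inr (.inr δ) => connection f δ

theorem diffOps_eq_adjoin (f : ι → A) :
    diffOps f = Algebra.adjoin ℂ (Set.range (diffGen f)) := by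
  unfold diffOps
  congr 1
  ext T
  constructor
  · rintro ((⟨a, rfl⟩ | ⟨i, rfl⟩) | ⟨δ, E, hE, rfl⟩)
    · exact ⟨.inl a, rfl⟩
    · exact ⟨.inr (.inl i), rfl⟩
    · refine ⟨.inr (.inr δ), ?_⟩
      rw [hE.unique (extend_spec δ)]
      rfl
  · rintro ⟨a | i | δ, rfl⟩
    · exact .inl (.inl ⟨a, rfl⟩)
    · exact .inl (.inr ⟨i, rfl⟩)
    · exact .inr ⟨δ, extend ι δ, extend_spec δ, rfl⟩

theorem mem_span_diffOps_iff (f : ι → A) (S : Set (PowerModule A ι)) (v : PowerModule A ι) :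
    v ∈ Submodule.span (diffOps f) S ↔ v ∈ opClosure (diffGen f) S := by
  rw [diffOps_eq_adjoin]
  exact mem_span_adjoin_iff_mem_opClosure _ _ _

end Calculus

/-! ### Specialization of the exponents to integers -/

section Specialization

variable {A : Type*} [CommRing A] [Algebra ℂ A] [IsDomain A] {ι : Type*} [Fintype ι]

/-- The substitution `s i = k i` in `Frac(A)[s]`. -/
def specialize (k : ι → ℤ) : PowerModule A ι →ₐ[FractionRing A] PowerModule A ι :=
  MvPolynomial.aeval fun i => MvPolynomial.C (k i : FractionRing A)

@[simp] theorem specialize_X (k : ι → ℤ) (i : ι) :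
    specialize k (MvPolynomial.X i : PowerModule A ι) = (k i : PowerModule A ι) := by
  simp [specialize]

@[simp] theorem specialize_C (k : ι → ℤ) (x : FractionRing A) :
    specialize k (MvPolynomial.C x : PowerModule A ι) = MvPolynomial.C x := by
  simp [specialize]

@[simp] theorem specialize_shiftedPower (k u : ι → ℤ) (f : ι → A) :
    specialize k (shiftedPower f u) = shiftedPower f u := specialize_C _ _

@[simp] theorem specialize_algebraMap (k : ι → ℤ) (a : A) :
    specialize k (algebraMap A (PowerModule A ι) a) = algebraMap A (PowerModule A ι) a := by
  rw [algebraMap_powerModule, specialize_C]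

theorem extend_specialize (δ : Derivation ℂ A A) (k : ι → ℤ) (p : PowerModule A ι) :
    extend ι δ (specialize k p) = specialize k (extend ι δ p) := by
  refine (extend_spec δ).intertwines ((specialize k).restrictScalars ℂ) (extend ι δ) ?_ ?_ p
  · intro a
    rw [AlgHom.restrictScalars_apply, AlgHom.restrictScalars_apply, specialize_algebraMap,
      specialize_algebraMap, extend_algebraMap]
  · intro i
    rw [AlgHom.restrictScalars_apply, specialize_X, Derivation.map_intCast]

/-- Differentiating `p · f ^ s` and specializing the exponents commute. -/
theorem specialize_connection (f : ι → A) (hf : ∀ i, f i ≠ 0) (δ : Derivation ℂ A A) (k : ι → ℤ)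
    (p : PowerModule A ι) :
    specialize k (connection f δ p) * shiftedPower f k
      = extend ι δ (specialize k p * shiftedPower f k) := by
  rw [Derivation.leibniz, extend_specialize, extend_shiftedPower δ hf, connection_apply, map_add,
    map_mul]
  simp only [logDerivative, map_sum, map_mul, specialize_X, specialize_C, smul_eq_mul, zsmul_eq_mul]
  ring

theorem charZero_fractionRing (A : Type*) [CommRing A] [Algebra ℂ A] [IsDomain A] :
    CharZero (FractionRing A) :=
  charZero_of_injective_algebraMap (algebraMap ℂ (FractionRing A)).injective

/-- The vectors of natural numbers are Zariski dense in the space of exponents. -/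
theorem eq_zero_of_specialize_eq_zero {p : PowerModule A ι}
    (h : ∀ k : ι → ℕ, specialize (fun i => (k i : ℤ)) p = 0) : p = 0 := by
  have := charZero_fractionRing A
  refine MvPolynomial.funext_set (fun _ : ι => Set.range fun n : ℕ => (n : FractionRing A))
    (fun _ => Set.infinite_range_of_injective Nat.cast_injective) ?_
  intro x hx
  choose k hk using fun i => hx i (Set.mem_univ i)
  have h1 := congrArg (MvPolynomial.eval (0 : ι → FractionRing A)) (h k)
  rw [map_zero] at h1 ⊢
  rw [← h1]
  have : x = fun i => (k i : FractionRing A) := funext fun i => (hk i).symm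
  subst this
  simp only [specialize]
  rw [← MvPolynomial.coe_aeval_eq_eval, ← MvPolynomial.coe_aeval_eq_eval, RingHom.coe_coe,
    RingHom.coe_coe, MvPolynomial.comp_aeval_apply]
  simp

variable {Pt : Type*}

/-- The operators on functions of the exponents that correspond to the generators of `D(A)[s]`,
where the exponents run over a family `κ` of integer vectors. -/
def functionGen (κ : Pt → ι → ℤ) : A ⊕ ι ⊕ Derivation ℂ A A → Module.End ℂ (Pt → A)
  | .inl a => LinearMap.mulLeft ℂ fun _ => a
  | .inr (.inl i) => LinearMap.mulLeft ℂ fun t => (κ t i : A)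
  | .inr (.inr δ) => (δ : A →ₗ[ℂ] A).compLeft Pt

theorem functionGen_algebra (κ : Pt → ι → ℤ) (a : A) (h : Pt → A) :
    functionGen κ (.inl a) h = fun t => a * h t := rfl

theorem functionGen_exponent (κ : Pt → ι → ℤ) (i : ι) (h : Pt → A) :
    functionGen κ (.inr (.inl i)) h = fun t => (κ t i : A) * h t := rfl

theorem functionGen_derivation (κ : Pt → ι → ℤ) (δ : Derivation ℂ A A) (h : Pt → A) :
    functionGen κ (.inr (.inr δ)) h = fun t => δ (h t) := rfl

/-- The relation between an element `p · f ^ s` of the power module and the function whose value at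
`t` is the specialization of `p · f ^ s` at the exponent vector `κ t`. -/
def valueRelation (f : ι → A) (κ : Pt → ι → ℤ) : Submodule ℂ (PowerModule A ι × (Pt → A)) where
  carrier := {x | ∀ t, specialize (κ t) x.1 * shiftedPower f (κ t)
    = algebraMap A (PowerModule A ι) (x.2 t)}
  add_mem' := fun hx hy t => by
    simp only [Prod.fst_add, Prod.snd_add, Pi.add_apply, map_add, add_mul]
    rw [hx t, hy t]
  zero_mem' := fun t => by simp
  smul_mem' := fun c x hx t => by
    simp only [Prod.smul_fst, Prod.smul_snd, Pi.smul_apply]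
    have h1 : specialize (κ t) (c • x.1) = c • specialize (κ t) x.1 :=
      map_smul ((specialize (κ t)).restrictScalars ℂ) c x.1
    have h2 : algebraMap A (PowerModule A ι) (c • x.2 t)
        = c • algebraMap A (PowerModule A ι) (x.2 t) := by
      rw [Algebra.smul_def, map_mul, Algebra.smul_def, ← IsScalarTower.algebraMap_apply]
    rw [h1, h2, smul_mul_assoc, hx t]

theorem mem_valueRelation {f : ι → A} {κ : Pt → ι → ℤ} {p : PowerModule A ι} {h : Pt → A} :
    (p, h) ∈ valueRelation f κ ↔ ∀ t, specialize (κ t) p * shiftedPower f (κ t)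
      = algebraMap A (PowerModule A ι) (h t) := Iff.rfl

/-- Specialization is compatible with the action of `D(A)[s]`. -/
theorem valueRelation_stable {f : ι → A} (hf : ∀ i, f i ≠ 0) (κ : Pt → ι → ℤ)
    (j : A ⊕ ι ⊕ Derivation ℂ A A) (p : PowerModule A ι) (h : Pt → A)
    (hp : (p, h) ∈ valueRelation f κ) :
    (diffGen f j p, functionGen κ j h) ∈ valueRelation f κ := by
  rw [mem_valueRelation] at hp ⊢
  intro t
  rcases j with a | i | δ
  · simp only [diffGen, functionGen, LinearMap.mulLeft_apply, Pi.mul_apply, map_mul,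
      specialize_algebraMap]
    rw [mul_assoc, hp t]
  · simp only [diffGen, functionGen, LinearMap.mulLeft_apply, Pi.mul_apply, map_mul,
      specialize_X, map_intCast]
    rw [mul_assoc, hp t]
  · simp only [diffGen, functionGen]
    rw [specialize_connection f hf, hp t, extend_algebraMap]
    rfl

/-- The module `D(A)[s] · x` can be computed by specializing the exponents at the vectors `κ t`; the
values need only be compared on a set `D` of parameters for which `κ '' D` is Zariski dense. -/
theorem mem_opClosure_diffGen_iff {f : ι → A} (hf : ∀ i, f i ≠ 0) (κ : Pt → ι → ℤ) (D : Set Pt)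
    (hD : ∀ k : ι → ℕ, ∃ t ∈ D, κ t = fun i => (k i : ℤ))
    {I : Type*} {x : I → PowerModule A ι} {x' : I → Pt → A}
    (hx : ∀ i, (x i, x' i) ∈ valueRelation f κ) {p : PowerModule A ι} {q : Pt → A}
    (hpq : ∀ t ∈ D, specialize (κ t) p * shiftedPower f (κ t)
      = algebraMap A (PowerModule A ι) (q t)) :
    p ∈ opClosure (diffGen f) (Set.range x) ↔
      ∃ h ∈ opClosure (functionGen κ) (Set.range x'), ∀ t ∈ D, h t = q t := by
  constructor
  · intro hp
    obtain ⟨h, h1, h2⟩ := exists_related_of_mem_opClosure (valueRelation f κ)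
      (valueRelation_stable hf κ) hx hp
    refine ⟨h, h1, fun t ht => ?_⟩
    have := (mem_valueRelation.1 h2 t).symm.trans (hpq t ht)
    exact algebraMap_powerModule_injective this
  · rintro ⟨h, h1, h2⟩
    obtain ⟨p', h3, h4⟩ := exists_related_of_mem_opClosure (x := x') (x' := x)
      ((valueRelation f κ).comap (LinearEquiv.prodComm ℂ _ _).toLinearMap)
      (fun j v v' hv => valueRelation_stable hf κ j v' v hv) hx h1
    have h5 : (p', h) ∈ valueRelation f κ := h4
    have : p - p' = 0 := by
      refine eq_zero_of_specialize_eq_zero fun k => ?_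
      obtain ⟨t, ht, htk⟩ := hD k
      rw [← htk]
      refine (isUnit_shiftedPower hf (κ t)).mul_right_cancel ?_
      rw [map_sub, sub_mul, hpq t ht, mem_valueRelation.1 h5 t, h2 t ht, sub_self, zero_mul]
    rw [sub_eq_zero.1 this]
    exact h3

end Specialization

/-! ### The functional equations as identities between functions of integer exponents -/

section FunctionModel

variable {A : Type*} [CommRing A] [Algebra ℂ A] [IsDomain A] {ι : Type*} [Fintype ι]

theorem specialize_aeval_sum (k : ι → ℤ) (b : Polynomial ℂ) :
    specialize k (Polynomial.aeval (∑ i, MvPolynomial.X i : PowerModule A ι) b)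
      = algebraMap A (PowerModule A ι) (algebraMap ℂ A (b.eval (∑ i, k i : ℂ))) := by
  have h1 := Polynomial.map_aeval_eq_aeval_map (φ := RingHom.id ℂ)
    (ψ := ((specialize k).restrictScalars ℂ : PowerModule A ι →ₐ[ℂ] PowerModule A ι).toRingHom)
    (by ext c; simp) b (∑ i, MvPolynomial.X i : PowerModule A ι)
  have h2 : specialize k (Polynomial.aeval (∑ i, MvPolynomial.X i : PowerModule A ι) b)
    = Polynomial.aeval (specialize k (∑ i, MvPolynomial.X i : PowerModule A ι)) b := by
    simpa using h1
  rw [h2, map_sum]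
  simp only [specialize_X]
  rw [← IsScalarTower.algebraMap_apply]
  have h3 : (∑ i, (k i : PowerModule A ι))
      = algebraMap ℂ (PowerModule A ι) (∑ i, (k i : ℂ)) := by simp
  rw [h3, Polynomial.aeval_algebraMap_apply, Polynomial.coe_aeval_eq_eval]

theorem shiftedPower_natCast (f : ι → A) (k : ι → ℕ) :
    shiftedPower f (fun i => (k i : ℤ)) = algebraMap A (PowerModule A ι) (∏ i, f i ^ k i) := by
  simp [shiftedPower]

theorem specialize_binomialCoeff (k : ι → ℕ) (i : ι) (m : ℕ) :
    specialize (fun i => (k i : ℤ)) (binomialCoeff A i m)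
      = algebraMap A (PowerModule A ι) ((k i).choose m) := by
  have := charZero_fractionRing A
  have hm : (m.factorial : FractionRing A) ≠ 0 := Nat.cast_ne_zero.2 m.factorial_ne_zero
  have h1 : (∏ j ∈ Finset.range m, ((k i : FractionRing A) - j))
      = (m.factorial : FractionRing A) * (k i).choose m := by
    rw [← Nat.cast_mul, ← Nat.descFactorial_eq_factorial_mul_choose]
    rcases lt_or_ge (k i) m with h | h
    · rw [Nat.descFactorial_eq_zero_iff_lt.2 h, Nat.cast_zero]
      exact Finset.prod_eq_zero (Finset.mem_range.2 h) (sub_self _)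
    · rw [Nat.descFactorial_eq_prod_range, Nat.cast_prod]
      refine Finset.prod_congr rfl fun j hj => ?_
      rw [Nat.cast_sub ((Finset.mem_range.1 hj).le.trans h)]
  have h2 : specialize (fun i => (k i : ℤ)) (binomialCoeff A i m)
      = MvPolynomial.C ((m.factorial : FractionRing A)⁻¹ *
        ∏ j ∈ Finset.range m, ((k i : FractionRing A) - j)) := by
    simp only [binomialCoeff, map_mul, map_prod, map_sub, specialize_X, specialize_C]
    simp
  rw [h2, h1, inv_mul_cancel_left₀ hm, algebraMap_powerModule, map_natCast, map_natCast, map_natCast]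

/-- The integer vector underlying a vector of natural numbers. -/
def intVec (κ : ι →₀ ℕ) : ι → ℤ := fun i => (κ i : ℤ)

/-- The value of `binom (k, -u) · a ^ (k + u)` at a natural number `k`, where the binomial
coefficient only occurs for negative `u`. It vanishes for `k + u < 0`, so the truncation of the
exponent is immaterial. -/
def binomialPower (a : A) (u : ℤ) (k : ℕ) : A :=
  (if u < 0 then (k.choose (-u).toNat : A) else 1) * a ^ (k + u).toNat

/-- The values of the generator `(∏_{u i < 0} binom (s i) (- u i)) · f₁ ^ (s₁ + u₁) ⋯ f_r ^ (s_r + u_r)`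
at the vectors of natural numbers. -/
def generatorFun (f : ι → A) (u : ι → ℤ) (κ : ι →₀ ℕ) : A :=
  ∏ i, binomialPower (f i) (u i) (κ i)

/-- The subspace of functions of `κ` generated by the generators of weight `v` under `A`, the
derivations of `A` and the multiplications by the coordinates of `κ`. -/
def weightModule (f : ι → A) (v : ℤ) : Submodule ℂ ((ι →₀ ℕ) → A) :=
  opClosure (functionGen intVec) (Set.range fun u : {u : ι → ℤ // ∑ i, u i = v} => generatorFun f u)

/-- The values of the generators at natural exponents lie in `A`, since the binomial coefficients
vanish where an exponent would be negative. -/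
theorem generator_mem_valueRelation {f : ι → A} (hf : ∀ i, f i ≠ 0) (u : ι → ℤ) :
    ((∏ i, if u i < 0 then binomialCoeff A i (-u i).toNat else 1) * shiftedPower f u,
      generatorFun f u) ∈ valueRelation f intVec := by
  rw [mem_valueRelation]
  intro κ
  have h1 : specialize (intVec κ) (∏ i, if u i < 0 then binomialCoeff A i (-u i).toNat else 1)
      = algebraMap A (PowerModule A ι)
        (∏ i, if u i < 0 then ((κ i).choose (-u i).toNat : A) else 1) := by
    rw [map_prod, map_prod]
    refine Finset.prod_congr rfl fun i _ => ?_
    split_ifs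
    · exact specialize_binomialCoeff κ i _
    · rw [map_one, map_one]
  rw [map_mul, h1, specialize_shiftedPower, mul_assoc, ← shiftedPower_add hf]
  by_cases h : ∃ i, (κ i : ℤ) + u i < 0
  · obtain ⟨i, hi⟩ := h
    have h2 : ((κ i).choose (-u i).toNat : A) = 0 := by
      rw [Nat.choose_eq_zero_of_lt (by omega), Nat.cast_zero]
    have h3 : u i < 0 := by omega
    rw [Finset.prod_eq_zero (Finset.mem_univ i) (by rw [if_pos h3, h2]), map_zero, zero_mul,
      generatorFun, Finset.prod_eq_zero (Finset.mem_univ i), map_zero]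
    rw [binomialPower, if_pos h3, h2, zero_mul]
  · push Not at h
    have h4 : u + intVec κ = fun i => (((κ i + u i).toNat : ℕ) : ℤ) := by
      funext i
      have := h i
      simp only [Pi.add_apply, intVec]
      omega
    rw [h4, shiftedPower_natCast, ← map_mul, ← Finset.prod_mul_distrib]
    rfl

/-- The functional equation of a family, in terms of the values at all vectors of natural numbers. -/
theorem familyEquation_iff {f : ι → A} (hf : ∀ i, f i ≠ 0) (b : Polynomial ℂ) :
    FamilyEquation f b ↔
      (fun κ : ι →₀ ℕ => algebraMap ℂ A (b.eval (κ.degree : ℂ)) * ∏ i, f i ^ κ i)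
        ∈ weightModule f 1 := by
  have hS : {v : PowerModule A ι | ∃ u : ι → ℤ, ∑ i, u i = 1 ∧
        v = (∏ i, if u i < 0 then binomialCoeff A i (-u i).toNat else 1) * shiftedPower f u}
      = Set.range fun u : {u : ι → ℤ // ∑ i, u i = 1} =>
        (∏ i, if u.1 i < 0 then binomialCoeff A i (-u.1 i).toNat else 1) * shiftedPower f u.1 := by
    ext v
    constructor
    · rintro ⟨u, hu, rfl⟩
      exact ⟨⟨u, hu⟩, rfl⟩
    · rintro ⟨⟨u, hu⟩, rfl⟩
      exact ⟨u, hu, rfl⟩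
  rw [FamilyEquation, hS, mem_span_diffOps_iff, weightModule,
    mem_opClosure_diffGen_iff hf intVec Set.univ (fun k => ⟨Finsupp.equivFunOnFinite.symm k,
      trivial, rfl⟩)
      (x := fun u : {u : ι → ℤ // ∑ i, u i = 1} =>
        (∏ i, if u.1 i < 0 then binomialCoeff A i (-u.1 i).toNat else 1) * shiftedPower f u.1)
      (x' := fun u => generatorFun f u.1) (fun u => generator_mem_valueRelation hf u.1)
      (q := fun κ : ι →₀ ℕ => algebraMap ℂ A (b.eval (κ.degree : ℂ)) * ∏ i, f i ^ κ i)]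
  · constructor
    · rintro ⟨h, h1, h2⟩
      have h3 := funext fun κ => h2 κ trivial
      rwa [h3] at h1
    · exact fun h => ⟨_, h, fun _ _ => rfl⟩
  · intro κ _
    rw [map_mul, specialize_shiftedPower, shiftedPower_zero, mul_one, specialize_aeval_sum,
      map_mul]
    congr 1
    · simp [intVec, Finsupp.degree_eq_sum]
    · exact shiftedPower_natCast f κ

theorem shiftedPower_unit (g : A) (n : ℕ) :
    shiftedPower (fun _ : Unit => g) (fun _ => (n : ℤ)) = algebraMap A _ (g ^ n) := by
  rw [shiftedPower_natCast]
  simp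

theorem elementEquation_iff_mem_opClosure (g : A) (b : Polynomial ℂ) :
    ElementEquation g b ↔ Polynomial.aeval (MvPolynomial.X () : PowerModule A Unit) b ∈
      opClosure (diffGen fun _ : Unit => g) (Set.range fun _ : Unit => algebraMap A _ g) := by
  have h := shiftedPower_unit g 1
  rw [pow_one] at h
  rw [ElementEquation, mem_span_diffOps_iff, shiftedPower_zero, mul_one, Set.range_const, ← h]
  rfl

/-- The functional equation of an element, in terms of the values at all natural numbers. -/
theorem elementEquation_iff {g : A} (hg : g ≠ 0) (b : Polynomial ℂ) :
    ElementEquation g b ↔ (fun k : ℕ => algebraMap ℂ A (b.eval (k : ℂ)) * g ^ k) ∈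
      opClosure (functionGen fun (k : ℕ) (_ : Unit) => (k : ℤ))
        (Set.range fun (_ : Unit) (k : ℕ) => g ^ (k + 1)) := by
  rw [elementEquation_iff_mem_opClosure,
    mem_opClosure_diffGen_iff (f := fun _ : Unit => g) (fun _ => hg)
      (fun (k : ℕ) (_ : Unit) => (k : ℤ)) Set.univ (fun k => ⟨k (), trivial, rfl⟩)
      (x' := fun (_ : Unit) (k : ℕ) => g ^ (k + 1))
      (q := fun k : ℕ => algebraMap ℂ A (b.eval (k : ℂ)) * g ^ k)]
  · constructor
    · rintro ⟨h, h1, h2⟩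
      have h3 := funext fun κ => h2 κ trivial
      rwa [h3] at h1
    · exact fun h => ⟨_, h, fun _ _ => rfl⟩
  · intro _ k
    rw [specialize_algebraMap, shiftedPower_unit, ← map_mul, ← pow_succ']
  · intro k _
    have := specialize_aeval_sum (A := A) (fun _ : Unit => (k : ℤ)) b
    simp only [Finset.univ_unique, Finset.sum_singleton] at this
    rw [shiftedPower_unit, map_mul]
    congr 1

/-- A variant of the previous criterion that also uses the value `-1` of the exponent. -/
theorem elementEquation_iff_shifted {g : A} (hg : g ≠ 0) (b : Polynomial ℂ) :
    ElementEquation g b ↔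
      ∃ H ∈ opClosure (functionGen fun (k : ℕ) (_ : Unit) => (k : ℤ) - 1)
        (Set.range fun (_ : Unit) (k : ℕ) => g ^ k),
        ∀ k : ℕ, H (k + 1) = algebraMap ℂ A (b.eval (k : ℂ)) * g ^ k := by
  rw [elementEquation_iff_mem_opClosure,
    mem_opClosure_diffGen_iff (f := fun _ : Unit => g) (fun _ => hg)
      (fun (k : ℕ) (_ : Unit) => (k : ℤ) - 1) {k | 0 < k}
      (fun k => ⟨k () + 1, Nat.succ_pos _, by funext; push_cast; ring⟩)
      (x' := fun (_ : Unit) (k : ℕ) => g ^ k)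
      (q := fun k : ℕ => algebraMap ℂ A (b.eval ((k - 1 : ℕ) : ℂ)) * g ^ (k - 1))]
  · refine exists_congr fun H => and_congr_right fun _ => ⟨fun h k => h (k + 1) k.succ_pos, ?_⟩
    rintro h (_ | k) hk
    · exact absurd hk (lt_irrefl 0)
    · exact h k
  · intro _ k
    have h1 := shiftedPower_unit g 1
    rw [pow_one] at h1
    rw [specialize_algebraMap, ← h1, ← shiftedPower_add fun _ => hg, ← shiftedPower_unit]
    congr 1
    funext
    simp
  · rintro (_ | k) hk
    · exact absurd hk (lt_irrefl 0)
    · have h2 : (fun _ : Unit => ((k + 1 : ℕ) : ℤ) - 1) = fun _ => (k : ℤ) := by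
        funext; push_cast; ring
      have := specialize_aeval_sum (A := A) (fun _ : Unit => (k : ℤ)) b
      simp only [Finset.univ_unique, Finset.sum_singleton] at this
      rw [h2, shiftedPower_unit, map_mul]
      congr 1

end FunctionModel

/-- At the exponent `-1`, the functional equation says that `b (-1)` is a multiple of `g`. -/
theorem ElementEquation.exists_eval_neg_one_eq_mul {A : Type*} [CommRing A] [Algebra ℂ A]
    [IsDomain A] {g : A} (hg : g ≠ 0) {b : Polynomial ℂ} (h : ElementEquation g b) :
    ∃ a : A, algebraMap ℂ A (b.eval (-1)) = a * g := by
  rw [elementEquation_iff_mem_opClosure] at h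
  have h1 := shiftedPower_unit g 1
  rw [pow_one] at h1
  obtain ⟨H, _, h2⟩ := exists_related_of_mem_opClosure (x' := fun _ _ => 1)
    (valueRelation (fun _ : Unit => g) fun _ : Unit => fun _ => (-1 : ℤ))
    (valueRelation_stable (fun _ => hg) _) (fun _ t => by
      dsimp only
      rw [specialize_algebraMap, ← h1, ← shiftedPower_add (fun _ => hg), map_one,
        ← shiftedPower_zero fun _ : Unit => g]
      congr 1) h
  refine ⟨H (), algebraMap_powerModule_injective (ι := Unit) ?_⟩
  have h3 := mem_valueRelation.1 h2 ()
  have h4 := specialize_aeval_sum (A := A) (fun _ : Unit => (-1 : ℤ)) b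
  simp only [Finset.univ_unique, Finset.sum_singleton, Int.cast_neg, Int.cast_one] at h4
  rw [map_mul, ← h3, ← h1, mul_assoc, ← shiftedPower_add (fun _ => hg)]
  have h5 : ((fun _ => (-1 : ℤ)) + fun _ => ((1 : ℕ) : ℤ) : Unit → ℤ) = 0 := by
    funext; simp
  rw [h5, shiftedPower_zero, mul_one, ← h4]

/-! ### Coefficients with respect to a group of variables -/

section Coefficients

open MvPolynomial

variable {σ ι : Type*}

theorem derivation_sum_apply {R A : Type*} [CommRing R] [CommRing A] [Algebra R A] {I : Type*}
    (s : Finset I) (D : I → Derivation R A A) (a : A) : (∑ i ∈ s, D i) a = ∑ i ∈ s, D i a := by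
  have := congrFun (map_sum (Derivation.coeFnAddMonoidHom (R := R) (A := A) (M := A)) D s) a
  rwa [Finset.sum_apply] at this

theorem derivation_eq_sum_pderiv [Fintype σ]
    (δ : Derivation ℂ (MvPolynomial σ ℂ) (MvPolynomial σ ℂ)) :
    δ = ∑ i, δ (X i) • pderiv i := by
  classical
  refine MvPolynomial.derivation_ext fun j => ?_
  rw [derivation_sum_apply, Finset.sum_eq_single j]
  · rw [Derivation.smul_apply, pderiv_X_self, smul_eq_mul, mul_one]
  · intro i _ hij
    rw [Derivation.smul_apply, pderiv_X_of_ne hij.symm, smul_zero]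
  · exact fun h => absurd (Finset.mem_univ j) h

/-- Stability of a space of functions under all of `D(A)`, for a polynomial ring `A`, need only be
checked for the variables and the partial derivatives. -/
theorem functionGen_mem_of_stable [Fintype σ] {Pt ι : Type*} {κ : Pt → ι → ℤ}
    {N : Submodule ℂ (Pt → MvPolynomial σ ℂ)}
    (hX : ∀ i, ∀ h ∈ N, (fun t => X i * h t) ∈ N)
    (hd : ∀ i, ∀ h ∈ N, (fun t => pderiv i (h t)) ∈ N)
    (hκ : ∀ i, ∀ h ∈ N, (fun t => (κ t i : MvPolynomial σ ℂ) * h t) ∈ N)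
    (j : MvPolynomial σ ℂ ⊕ ι ⊕ Derivation ℂ (MvPolynomial σ ℂ) (MvPolynomial σ ℂ)) :
    ∀ h ∈ N, functionGen κ j h ∈ N := by
  have hA : ∀ a : MvPolynomial σ ℂ, ∀ h ∈ N, (fun t => a * h t) ∈ N := by
    intro a
    induction a using MvPolynomial.induction_on with
    | C c =>
      intro h hh
      convert N.smul_mem c hh using 1
      funext t
      rw [Pi.smul_apply, MvPolynomial.smul_eq_C_mul]
    | add p q hp hq =>
      intro h hh
      convert N.add_mem (hp h hh) (hq h hh) using 1
      funext t
      simp [add_mul]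
    | mul_X p i hp =>
      intro h hh
      convert hp _ (hX i h hh) using 1
      funext t
      rw [mul_assoc]
  rcases j with a | i | δ
  · exact hA a
  · exact hκ i
  · intro h hh
    have : functionGen κ (.inr (.inr δ)) h = ∑ i, fun t => δ (X i) * pderiv i (h t) := by
      funext t
      change δ (h t) = _
      conv_lhs => rw [derivation_eq_sum_pderiv δ]
      rw [derivation_sum_apply, Finset.sum_apply]
      rfl
    rw [this]
    exact N.sum_mem fun i _ => hA _ _ (hd i h hh)

/-- The coefficient of the monomial `κ` in the variables indexed by `ι`, as a polynomial in the
variables indexed by `σ`. -/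
def innerCoeff (κ : ι →₀ ℕ) : MvPolynomial (ι ⊕ σ) ℂ →ₗ[ℂ] MvPolynomial σ ℂ :=
  (MvPolynomial.lcoeff (MvPolynomial σ ℂ) κ).restrictScalars ℂ ∘ₗ
    (sumAlgEquiv ℂ ι σ).toLinearMap

theorem innerCoeff_apply (κ : ι →₀ ℕ) (H : MvPolynomial (ι ⊕ σ) ℂ) :
    innerCoeff κ H = coeff κ (sumAlgEquiv ℂ ι σ H) := rfl

theorem innerCoeff_ext {H H' : MvPolynomial (ι ⊕ σ) ℂ}
    (h : ∀ κ, innerCoeff κ H = innerCoeff κ H') : H = H' :=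
  (sumAlgEquiv ℂ ι σ).injective (MvPolynomial.ext _ _ h)

theorem sumAlgEquiv_rename_inr (p : MvPolynomial σ ℂ) :
    sumAlgEquiv ℂ ι σ (rename Sum.inr p) = C p := by
  induction p using MvPolynomial.induction_on with
  | C c => rw [rename_C, sumAlgEquiv_C_inl]
  | add p q hp hq => simp only [map_add, hp, hq]
  | mul_X p i hp => rw [map_mul, map_mul, hp, rename_X, sumAlgEquiv_X_inr, map_mul]

theorem innerCoeff_X_inl_mul [DecidableEq ι] (κ : ι →₀ ℕ) (i : ι) (H : MvPolynomial (ι ⊕ σ) ℂ) :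
    innerCoeff κ (X (Sum.inl i) * H) =
      if κ i = 0 then 0 else innerCoeff (κ - Finsupp.single i 1) H := by
  rw [innerCoeff_apply, map_mul, sumAlgEquiv_X_inl, coeff_X_mul', innerCoeff_apply]
  simp only [Finsupp.mem_support_iff, ne_eq, ite_not]

theorem innerCoeff_rename_inr_mul (κ : ι →₀ ℕ) (p : MvPolynomial σ ℂ)
    (H : MvPolynomial (ι ⊕ σ) ℂ) :
    innerCoeff κ (rename Sum.inr p * H) = p * innerCoeff κ H := by
  rw [innerCoeff_apply, map_mul, sumAlgEquiv_rename_inr, coeff_C_mul, innerCoeff_apply]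

theorem innerCoeff_X_inr_mul (κ : ι →₀ ℕ) (j : σ) (H : MvPolynomial (ι ⊕ σ) ℂ) :
    innerCoeff κ (X (Sum.inr j) * H) = X j * innerCoeff κ H := by
  rw [innerCoeff_apply, map_mul, sumAlgEquiv_X_inr, coeff_C_mul, innerCoeff_apply]

theorem innerCoeff_pderiv_inl (κ : ι →₀ ℕ) (i : ι) (H : MvPolynomial (ι ⊕ σ) ℂ) :
    innerCoeff κ (pderiv (Sum.inl i) H) = (κ i + 1 : ℕ) * innerCoeff (κ + Finsupp.single i 1) H := by
  classical
  have h : sumAlgEquiv ℂ ι σ (pderiv (Sum.inl i) H) = pderiv i (sumAlgEquiv ℂ ι σ H) := by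
    induction H using MvPolynomial.induction_on with
    | C c =>
      rw [pderiv_C, map_zero]
      rw [sumAlgEquiv_C_inl, pderiv_C]
    | add p q hp hq => simp only [map_add, hp, hq]
    | mul_X p n hp =>
      rw [Derivation.leibniz, map_add, map_mul, Derivation.leibniz]
      rcases n with n | n
      · simp only [smul_eq_mul, map_mul, hp, pderiv_X, sumAlgEquiv_X_inl]
        by_cases hn : n = i
        · subst hn; simp
        · simp [hn]
      · simp only [smul_eq_mul, map_mul, hp, pderiv_X, sumAlgEquiv_X_inr, pderiv_C]
        simp
  rw [innerCoeff_apply, h, coeff_pderiv, innerCoeff_apply, mul_comm]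
  push_cast
  ring

theorem innerCoeff_pderiv_inr (κ : ι →₀ ℕ) (j : σ) (H : MvPolynomial (ι ⊕ σ) ℂ) :
    innerCoeff κ (pderiv (Sum.inr j) H) = pderiv j (innerCoeff κ H) := by
  classical
  induction H using MvPolynomial.induction_on generalizing κ with
  | C c =>
    rw [pderiv_C, map_zero, innerCoeff_apply, sumAlgEquiv_C_inl, coeff_C]
    split_ifs <;> simp
  | add p q hp hq => simp only [map_add, hp, hq]
  | mul_X p n hp =>
    rcases n with n | n
    · rw [Derivation.leibniz, pderiv_X_of_ne (by simp), smul_zero, zero_add, smul_eq_mul,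
        innerCoeff_X_inl_mul, mul_comm p, innerCoeff_X_inl_mul]
      split_ifs
      · rw [map_zero]
      · exact hp _
    · have h1 : pderiv (Sum.inr j) (X (Sum.inr n) : MvPolynomial (ι ⊕ σ) ℂ)
          = rename Sum.inr (pderiv j (X n)) := by
        by_cases hn : n = j
        · subst hn; simp
        · rw [pderiv_X_of_ne hn, pderiv_X_of_ne (by simpa using hn), map_zero]
      rw [Derivation.leibniz, map_add, smul_eq_mul, smul_eq_mul, innerCoeff_X_inr_mul, hp,
        mul_comm p (X _), innerCoeff_X_inr_mul, Derivation.leibniz, smul_eq_mul, smul_eq_mul,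
        h1, mul_comm p, innerCoeff_rename_inr_mul]
      ring

end Coefficients

/-! ### Shifts of the exponents -/

section Shift

variable {A : Type*} [CommRing A] [Algebra ℂ A] [IsDomain A] {ι : Type*} [Fintype ι]

/-- The operator `h (κ) ↦ h (κ + e i)`. -/
def raise (i : ι) : ((ι →₀ ℕ) → A) →ₗ[ℂ] ((ι →₀ ℕ) → A) where
  toFun h κ := h (κ + Finsupp.single i 1)
  map_add' _ _ := rfl
  map_smul' _ _ := rfl

/-- The operator `h (κ) ↦ κ i * h (κ - e i)`. Its value is `0` where `κ i = 0`, so the truncation of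
the difference is immaterial. -/
def lower (i : ι) : ((ι →₀ ℕ) → A) →ₗ[ℂ] ((ι →₀ ℕ) → A) where
  toFun h κ := (κ i : A) * h (κ - Finsupp.single i 1)
  map_add' _ _ := by funext κ; simp [mul_add]
  map_smul' _ _ := by funext κ; simp

theorem raise_apply (i : ι) (h : (ι →₀ ℕ) → A) (κ : ι →₀ ℕ) :
    raise i h κ = h (κ + Finsupp.single i 1) := rfl

theorem lower_apply (i : ι) (h : (ι →₀ ℕ) → A) (κ : ι →₀ ℕ) :
    lower i h κ = (κ i : A) * h (κ - Finsupp.single i 1) := rfl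

theorem sub_single_add_single {κ : ι →₀ ℕ} {i : ι} (h : κ i ≠ 0) :
    κ - Finsupp.single i 1 + Finsupp.single i 1 = κ :=
  tsub_add_cancel_of_le (by rw [Finsupp.single_le_iff]; omega)

theorem lower_raise (i : ι) (h : (ι →₀ ℕ) → A) (κ : ι →₀ ℕ) :
    lower i (raise i h) κ = (κ i : A) * h κ := by
  rw [lower_apply, raise_apply]
  by_cases hi : κ i = 0
  · simp [hi]
  · rw [sub_single_add_single hi]

theorem binomialPower_succ (a : A) {u : ℤ} (hu : 0 ≤ u) (k : ℕ) :
    binomialPower a u (k + 1) = binomialPower a (u + 1) k := by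
  rw [binomialPower, binomialPower, if_neg (by omega), if_neg (by omega)]
  congr 2
  omega

theorem binomialPower_succ_of_neg (a : A) {u : ℤ} (hu : u < 0) (k : ℕ) :
    ((-u).toNat : A) * binomialPower a u (k + 1) = ((k + 1 : ℕ) : A) * binomialPower a (u + 1) k := by
  obtain ⟨m, hm⟩ : ∃ m : ℕ, (-u).toNat = m + 1 := ⟨(-u).toNat - 1, by omega⟩
  have h1 : (if u + 1 < 0 then (k.choose (-(u + 1)).toNat : A) else 1) = (k.choose m : A) := by
    split_ifs with h
    · congr 2; omega
    · rw [show m = 0 by omega]; simp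
  have h2 := Nat.add_one_mul_choose_eq k m
  rw [binomialPower, binomialPower, if_pos hu, h1, hm, ← mul_assoc, ← mul_assoc, ← Nat.cast_mul,
    ← Nat.cast_mul, mul_comm (m + 1), ← h2]
  congr 2
  omega

theorem mul_binomialPower_pred (a : A) {u : ℤ} (hu : u ≤ 0) (k : ℕ) :
    (k : A) * binomialPower a u (k - 1) = ((1 - u).toNat : A) * binomialPower a (u - 1) k := by
  rcases k with _ | k
  · rw [Nat.cast_zero, zero_mul, binomialPower, if_pos (by omega),
      Nat.choose_eq_zero_of_lt (by omega)]
    simp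
  · have := binomialPower_succ_of_neg a (show u - 1 < 0 by omega) k
    rw [Nat.add_sub_cancel, show (1 - u).toNat = (-(u - 1)).toNat by omega, this,
      sub_add_cancel]

theorem mul_binomialPower_pred_of_pos (a : A) {u : ℤ} (hu : 0 < u) (k : ℕ) :
    (k : A) * binomialPower a u (k - 1) = (k : A) * binomialPower a (u - 1) k := by
  rcases k with _ | k
  · simp
  · rw [Nat.add_sub_cancel, binomialPower_succ a (show 0 ≤ u - 1 by omega), sub_add_cancel]

theorem mul_generatorFun_eq [DecidableEq ι] (f : ι → A) {u u' : ι → ℤ} {κ κ' : ι →₀ ℕ} (i : ι)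
    (c c' : A) (hu : ∀ j, j ≠ i → u j = u' j) (hκ : ∀ j, j ≠ i → κ j = κ' j)
    (h : c * binomialPower (f i) (u i) (κ i) = c' * binomialPower (f i) (u' i) (κ' i)) :
    c * generatorFun f u κ = c' * generatorFun f u' κ' := by
  rw [generatorFun, generatorFun, ← Finset.mul_prod_erase _ _ (Finset.mem_univ i),
    ← Finset.mul_prod_erase (a := i) _ (fun i => binomialPower (f i) (u' i) (κ' i))
      (Finset.mem_univ i), ← mul_assoc, ← mul_assoc, h]
  congr 1
  refine Finset.prod_congr rfl fun j hj => ?_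
  rw [hu j (Finset.ne_of_mem_erase hj), hκ j (Finset.ne_of_mem_erase hj)]

variable [DecidableEq ι]

theorem raise_generatorFun (f : ι → A) {u : ι → ℤ} {i : ι} (hu : 0 ≤ u i) :
    raise i (generatorFun f u) = generatorFun f (u + Pi.single i 1) := by
  funext κ
  rw [raise_apply]
  have := mul_generatorFun_eq f (u := u) (u' := u + Pi.single i 1)
    (κ := κ + Finsupp.single i 1) (κ' := κ) i 1 1
    (fun j hj => by simp [hj]) (fun j hj => by simp [hj.symm]) (by
      simpa using binomialPower_succ (f i) hu (κ i))
  simpa using this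

theorem raise_generatorFun_of_neg (f : ι → A) {u : ι → ℤ} {i : ι} (hu : u i < 0) :
    ((-u i).toNat : ℂ) • raise i (generatorFun f u)
      = fun κ => ((κ i + 1 : ℕ) : A) * generatorFun f (u + Pi.single i 1) κ := by
  funext κ
  rw [Pi.smul_apply, raise_apply, Algebra.smul_def, map_natCast]
  exact mul_generatorFun_eq f (u := u) (u' := u + Pi.single i 1)
    (κ := κ + Finsupp.single i 1) (κ' := κ) i _ _
    (fun j hj => by simp [hj]) (fun j hj => by simp [hj.symm]) (by
      simpa using binomialPower_succ_of_neg (f i) hu (κ i))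

theorem lower_generatorFun (f : ι → A) {u : ι → ℤ} {i : ι} (hu : u i ≤ 0) :
    lower i (generatorFun f u)
      = ((1 - u i).toNat : ℂ) • generatorFun f (u - Pi.single i 1) := by
  funext κ
  rw [Pi.smul_apply, lower_apply, Algebra.smul_def, map_natCast]
  exact mul_generatorFun_eq f (u := u) (u' := u - Pi.single i 1)
    (κ := κ - Finsupp.single i 1) (κ' := κ) i _ _
    (fun j hj => by simp [hj]) (fun j hj => by simp [hj.symm]) (by
      simpa using mul_binomialPower_pred (f i) hu (κ i))

theorem lower_generatorFun_of_pos (f : ι → A) {u : ι → ℤ} {i : ι} (hu : 0 < u i) :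
    lower i (generatorFun f u)
      = fun κ => (κ i : A) * generatorFun f (u - Pi.single i 1) κ := by
  funext κ
  rw [lower_apply]
  exact mul_generatorFun_eq f (u := u) (u' := u - Pi.single i 1)
    (κ := κ - Finsupp.single i 1) (κ' := κ) i _ _
    (fun j hj => by simp [hj]) (fun j hj => by simp [hj.symm]) (by
      simpa using mul_binomialPower_pred_of_pos (f i) hu (κ i))

theorem sum_add_single (u : ι → ℤ) (i : ι) : ∑ j, (u + Pi.single i 1 : ι → ℤ) j = ∑ j, u j + 1 := by
  simp [Finset.sum_add_distrib]

theorem sum_sub_single (u : ι → ℤ) (i : ι) : ∑ j, (u - Pi.single i 1 : ι → ℤ) j = ∑ j, u j - 1 := by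
  simp [Finset.sum_sub_distrib]

/-- All generators arise from `f ^ κ` by the operators `raise` and `lower`. -/
theorem generatorFun_mem_of_shift (f : ι → A) (N : ℤ → Submodule ℂ ((ι →₀ ℕ) → A))
    (h0 : generatorFun f 0 ∈ N 0) (hr : ∀ v i, ∀ h ∈ N v, raise i h ∈ N (v + 1))
    (hl : ∀ v i, ∀ h ∈ N v, lower i h ∈ N (v - 1)) (u : ι → ℤ) :
    generatorFun f u ∈ N (∑ i, u i) := by
  -- induction on the sum of the absolute values of the entries of `u`
  induction hn : ∑ i, (u i).natAbs using Nat.strong_induction_on generalizing u with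
  | _ n ih =>
  by_cases hu : u = 0
  · subst hu; simpa using h0
  obtain ⟨i, hi⟩ := Function.ne_iff.1 hu
  have hlt : ∀ u' : ι → ℤ, (∀ j, j ≠ i → u' j = u j) → (u' i).natAbs < (u i).natAbs →
      generatorFun f u' ∈ N (∑ i, u' i) := by
    intro u' h1 h2
    refine ih _ ?_ u' rfl
    rw [← hn]
    refine Finset.sum_lt_sum (fun j _ => ?_) ⟨i, Finset.mem_univ i, h2⟩
    by_cases hj : j = i
    · subst hj; exact h2.le
    · rw [h1 j hj]
  rcases lt_or_gt_of_ne hi with h | h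
  · rw [Pi.zero_apply] at h
    have h1 := hl _ i _ (hlt (u + Pi.single i 1) (fun j hj => by simp [hj]) (by simp; omega))
    rw [lower_generatorFun f (by simp; omega), sum_add_single, add_sub_cancel_right,
      add_sub_cancel_right] at h1
    refine (Submodule.smul_mem_iff _ ?_).1 h1
    rw [Nat.cast_ne_zero]
    simp
    omega
  · rw [Pi.zero_apply] at h
    have h1 := hr _ i _ (hlt (u - Pi.single i 1) (fun j hj => by simp [hj]) (by simp; omega))
    rwa [raise_generatorFun f (by simp; omega), sum_sub_single, sub_add_cancel,
      sub_add_cancel] at h1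

theorem generatorFun_mem_weightModule (f : ι → A) (u : ι → ℤ) {v : ℤ} (hu : ∑ i, u i = v) :
    generatorFun f u ∈ weightModule f v :=
  subset_opClosure _ _ (Set.mem_range_self
    (f := fun u : {u : ι → ℤ // ∑ i, u i = v} => generatorFun f u) ⟨u, hu⟩)

theorem functionGen_mem_weightModule {f : ι → A} {v : ℤ} (j : A ⊕ ι ⊕ Derivation ℂ A A)
    {h : (ι →₀ ℕ) → A} (hh : h ∈ weightModule f v) : functionGen intVec j h ∈ weightModule f v :=
  apply_mem_opClosure j hh

theorem weightModule_le {f : ι → A} {v : ℤ} {N : Submodule ℂ ((ι →₀ ℕ) → A)}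
    (h1 : ∀ u : ι → ℤ, ∑ i, u i = v → generatorFun f u ∈ N)
    (h2 : ∀ j, ∀ h ∈ N, functionGen intVec j h ∈ N) : weightModule f v ≤ N := by
  refine opClosure_le ?_ h2
  rintro _ ⟨⟨u, hu⟩, rfl⟩
  exact h1 u hu

theorem coord_mul_mem_weightModule {f : ι → A} {v : ℤ} (i : ι) {h : (ι →₀ ℕ) → A}
    (hh : h ∈ weightModule f v) : (fun κ => (κ i : A) * h κ) ∈ weightModule f v := by
  have := functionGen_mem_weightModule (.inr (.inl i)) hh
  have h2 : functionGen intVec (.inr (.inl i)) h = fun κ => (κ i : A) * h κ := by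
    funext κ
    simp [functionGen, intVec]
  rwa [h2] at this

/-- The operator `raise i` maps the module of weight `v` to that of weight `v + 1`: on generators it
changes `u` to `u + e i`, up to a factor that is a nonzero constant or `κ i + 1`. -/
theorem raise_mem_weightModule {f : ι → A} {v : ℤ} (i : ι) {h : (ι →₀ ℕ) → A}
    (hh : h ∈ weightModule f v) : raise i h ∈ weightModule f (v + 1) := by
  have : weightModule f v ≤ (weightModule f (v + 1)).comap (raise i) := by
    refine weightModule_le ?_ ?_
    · intro u huv
      rw [Submodule.mem_comap]
      have h1 := generatorFun_mem_weightModule f (u + Pi.single i 1) (v := v + 1)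
        (by rw [sum_add_single, huv])
      rcases le_or_gt 0 (u i) with hu | hu
      · rwa [raise_generatorFun f hu]
      · refine (Submodule.smul_mem_iff _ (s := ((-u i).toNat : ℂ)) ?_).1 ?_
        · rw [Nat.cast_ne_zero]; omega
        · rw [raise_generatorFun_of_neg f hu]
          have h2 := add_mem (coord_mul_mem_weightModule i h1) h1
          refine (congrArg (· ∈ weightModule f (v + 1)) ?_).mp h2
          funext κ
          simp [add_mul]
    · rintro (a | j | δ) h hh <;> rw [Submodule.mem_comap] at hh ⊢
      · exact functionGen_mem_weightModule (.inl a) hh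
      · by_cases hj : j = i
        · subst hj
          have h2 := add_mem (coord_mul_mem_weightModule j hh) hh
          refine (congrArg (· ∈ weightModule f (v + 1)) ?_).mp h2
          funext κ
          simp [functionGen, intVec, raise_apply, add_mul]
        · refine (congrArg (· ∈ weightModule f (v + 1)) ?_).mp (coord_mul_mem_weightModule j hh)
          funext κ
          simp [functionGen, intVec, raise_apply, Ne.symm hj]
      · exact functionGen_mem_weightModule (.inr (.inr δ)) hh
  exact this hh

/-- The operator `lower i` maps the module of weight `v` to that of weight `v - 1`. -/
theorem lower_mem_weightModule {f : ι → A} {v : ℤ} (i : ι) {h : (ι →₀ ℕ) → A}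
    (hh : h ∈ weightModule f v) : lower i h ∈ weightModule f (v - 1) := by
  have : weightModule f v ≤ (weightModule f (v - 1)).comap (lower i) := by
    refine weightModule_le ?_ ?_
    · intro u huv
      rw [Submodule.mem_comap]
      have h1 := generatorFun_mem_weightModule f (u - Pi.single i 1) (v := v - 1)
        (by rw [sum_sub_single, huv])
      rcases le_or_gt (u i) 0 with hu | hu
      · rw [lower_generatorFun f hu]
        exact Submodule.smul_mem _ _ h1
      · rw [lower_generatorFun_of_pos f hu]
        exact coord_mul_mem_weightModule i h1
    · rintro (a | j | δ) h hh <;> rw [Submodule.mem_comap] at hh ⊢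
      · refine (congrArg (· ∈ weightModule f (v - 1)) ?_).mp
          (functionGen_mem_weightModule (.inl a) hh)
        funext κ
        simp [functionGen, lower_apply, mul_left_comm]
      · by_cases hj : j = i
        · subst hj
          refine (congrArg (· ∈ weightModule f (v - 1)) ?_).mp
            (sub_mem (coord_mul_mem_weightModule j hh) hh)
          funext κ
          rcases hκ : κ j with _ | k
          · simp [functionGen, intVec, lower_apply, hκ]
          · simp [functionGen, intVec, lower_apply, hκ]
            ring
        · refine (congrArg (· ∈ weightModule f (v - 1)) ?_).mp (coord_mul_mem_weightModule j hh)
          funext κ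
          simp [functionGen, intVec, lower_apply, Ne.symm hj, mul_left_comm]
      · refine (congrArg (· ∈ weightModule f (v - 1)) ?_).mp
          (functionGen_mem_weightModule (.inr (.inr δ)) hh)
        funext κ
        simp [functionGen, lower_apply]
  exact this hh

end Shift

/-! ### From a family to a linear form in new variables -/

section LinearForm

open MvPolynomial

variable {σ ι : Type*} [Fintype σ] [Fintype ι] [DecidableEq ι]

/-- The linear form `∑ i, y i * f i` in new variables `y i`, with the family `f` as coefficients. -/
def linearForm (f : ι → MvPolynomial σ ℂ) : MvPolynomial (ι ⊕ σ) ℂ :=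
  ∑ i, X (Sum.inl i) * rename Sum.inr (f i)

/-- The product of the factorials of the entries of `κ`. -/
def multiFactorial (κ : ι →₀ ℕ) : ℕ := ∏ i, (κ i).factorial

omit [DecidableEq ι] in
theorem multiFactorial_ne_zero (κ : ι →₀ ℕ) : (multiFactorial κ : ℂ) ≠ 0 :=
  Nat.cast_ne_zero.2 (Finset.prod_ne_zero_iff.2 fun i _ => (κ i).factorial_ne_zero)

theorem multiFactorial_add_single (κ : ι →₀ ℕ) (i : ι) :
    multiFactorial (κ + Finsupp.single i 1) = (κ i + 1) * multiFactorial κ := by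
  rw [multiFactorial, multiFactorial, ← Finset.mul_prod_erase _ _ (Finset.mem_univ i),
    ← Finset.mul_prod_erase (a := i) _ (fun i => (κ i).factorial) (Finset.mem_univ i), ← mul_assoc]
  congr 1
  · simp [Nat.factorial_succ]
  · refine Finset.prod_congr rfl fun j hj => ?_
    simp [(Finset.ne_of_mem_erase hj).symm]

theorem multiFactorial_of_ne_zero {κ : ι →₀ ℕ} {i : ι} (h : κ i ≠ 0) :
    multiFactorial κ = κ i * multiFactorial (κ - Finsupp.single i 1) := by
  conv_lhs => rw [← sub_single_add_single h]
  rw [multiFactorial_add_single]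
  congr 1
  simp
  omega

theorem prod_pow_of_ne_zero {A : Type*} [CommRing A] (f : ι → A) {κ : ι →₀ ℕ} {i : ι} (h : κ i ≠ 0) :
    f i * ∏ j, f j ^ (κ - Finsupp.single i 1 : ι →₀ ℕ) j = ∏ j, f j ^ κ j := by
  rw [← Finset.mul_prod_erase _ _ (Finset.mem_univ i),
    ← Finset.mul_prod_erase (a := i) _ (fun i => f i ^ κ i) (Finset.mem_univ i), ← mul_assoc]
  congr 1
  · obtain ⟨m, hm⟩ := Nat.exists_eq_succ_of_ne_zero h
    simp [hm, pow_succ']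
  · refine Finset.prod_congr rfl fun j hj => ?_
    simp [(Finset.ne_of_mem_erase hj).symm]

omit [Fintype ι] in
theorem degree_add_single (κ : ι →₀ ℕ) (i : ι) :
    (κ + Finsupp.single i 1).degree = κ.degree + 1 := by
  simp

theorem degree_sub_single {κ : ι →₀ ℕ} {i : ι} (h : κ i ≠ 0) :
    (κ - Finsupp.single i 1).degree + 1 = κ.degree := by
  rw [← degree_add_single _ i, sub_single_add_single h]

/-- The multinomial theorem for the powers of the linear form. -/
theorem multiFactorial_smul_innerCoeff_linearForm_pow (f : ι → MvPolynomial σ ℂ) (K : ℕ)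
    (κ : ι →₀ ℕ) :
    (multiFactorial κ : ℂ) • innerCoeff κ (linearForm f ^ K)
      = if κ.degree = K then (K.factorial : ℂ) • ∏ i, f i ^ κ i else 0 := by
  induction K generalizing κ with
  | zero =>
    rw [pow_zero, innerCoeff_apply, map_one, coeff_one]
    by_cases h : κ = 0
    · subst h; simp [multiFactorial]
    · rw [if_neg (Ne.symm h), if_neg (by rwa [Finsupp.degree_eq_zero_iff]), smul_zero]
  | succ K ih =>
    have h1 : ∀ i, (multiFactorial κ : ℂ) •
        innerCoeff κ (X (Sum.inl i) * rename Sum.inr (f i) * linearForm f ^ K)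
        = if κ.degree = K + 1 then ((κ i : ℂ) * K.factorial) • ∏ i, f i ^ κ i else 0 := by
      intro i
      rw [mul_assoc, innerCoeff_X_inl_mul]
      by_cases hi : κ i = 0
      · simp [hi]
      · rw [if_neg hi, innerCoeff_rename_inr_mul, multiFactorial_of_ne_zero hi, Nat.cast_mul,
          mul_smul, ← mul_smul_comm, ih]
        have h2 := degree_sub_single hi
        by_cases h3 : κ.degree = K + 1
        · rw [if_pos h3, if_pos (by omega), mul_smul_comm, prod_pow_of_ne_zero f hi, mul_smul]
        · rw [if_neg h3, if_neg (by omega), mul_zero, smul_zero]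
    rw [pow_succ', linearForm, Finset.sum_mul, map_sum, Finset.smul_sum]
    rw [← linearForm, Finset.sum_congr rfl fun i _ => h1 i]
    by_cases h3 : κ.degree = K + 1
    · simp only [if_pos h3]
      rw [← Finset.sum_smul, ← Finset.sum_mul, ← Nat.cast_sum, ← Finsupp.degree_eq_sum, h3,
        ← Nat.cast_mul, Nat.factorial_succ]
    · simp only [if_neg h3, Finset.sum_const_zero]

/-- The normalized coefficient `κ! / (|κ| + v)! · [y ^ κ] H (|κ| + v)` of a sequence `H` of
polynomials, as a function of `κ`; it is `0` where `|κ| + v` is negative. -/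
def coeffFun (v : ℤ) :
    (ℕ → MvPolynomial (ι ⊕ σ) ℂ) →ₗ[ℂ] ((ι →₀ ℕ) → MvPolynomial σ ℂ) where
  toFun H κ := if 0 ≤ (κ.degree : ℤ) + v then
    ((multiFactorial κ : ℂ) / (((κ.degree : ℤ) + v).toNat.factorial : ℂ)) •
      innerCoeff κ (H ((κ.degree : ℤ) + v).toNat) else 0
  map_add' H H' := by
    funext κ
    simp only [Pi.add_apply]
    split_ifs
    · simp
    · simp
  map_smul' c H := by
    funext κ
    simp only [Pi.smul_apply, RingHom.id_apply]
    split_ifs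
    · rw [map_smul, smul_comm]
    · simp

theorem coeffFun_apply (v : ℤ) (H : ℕ → MvPolynomial (ι ⊕ σ) ℂ) (κ : ι →₀ ℕ) :
    coeffFun v H κ = if 0 ≤ (κ.degree : ℤ) + v then
    ((multiFactorial κ : ℂ) / (((κ.degree : ℤ) + v).toNat.factorial : ℂ)) •
      innerCoeff κ (H ((κ.degree : ℤ) + v).toNat) else 0 := rfl

/-- Multiplication by the new variable `y i` corresponds to `lower i`, and `∂ / ∂ y i` to `raise i`;
both change the weight `v` by one. -/
theorem coeffFun_X_inl_mul (v : ℤ) (i : ι) (H : ℕ → MvPolynomial (ι ⊕ σ) ℂ) :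
    coeffFun v (fun t => X (Sum.inl i) * H t) = lower i (coeffFun (v + 1) H) := by
  funext κ
  rw [lower_apply, coeffFun_apply, coeffFun_apply, innerCoeff_X_inl_mul]
  by_cases hi : κ i = 0
  · simp [hi]
  · have h2 := degree_sub_single hi
    have h3 : ((κ - Finsupp.single i 1).degree : ℤ) + (v + 1) = κ.degree + v := by omega
    rw [if_neg hi, h3]
    split_ifs
    · rw [multiFactorial_of_ne_zero hi, ← map_natCast (algebraMap ℂ (MvPolynomial σ ℂ)),
        ← Algebra.smul_def, smul_smul]
      push_cast
      congr 1
      ring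
    · rw [mul_zero]

theorem coeffFun_pderiv_inl (v : ℤ) (i : ι) (H : ℕ → MvPolynomial (ι ⊕ σ) ℂ) :
    coeffFun v (fun t => pderiv (Sum.inl i) (H t)) = raise i (coeffFun (v - 1) H) := by
  funext κ
  rw [raise_apply, coeffFun_apply, coeffFun_apply, innerCoeff_pderiv_inl]
  have h3 : ((κ + Finsupp.single i 1).degree : ℤ) + (v - 1) = κ.degree + v := by
    rw [degree_add_single]; push_cast; ring
  rw [h3]
  split_ifs
  · rw [multiFactorial_add_single, ← map_natCast (algebraMap ℂ (MvPolynomial σ ℂ)),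
      ← Algebra.smul_def, smul_smul]
    push_cast
    congr 1
    ring
  · rfl

theorem coeffFun_X_inr_mul (v : ℤ) (j : σ) (H : ℕ → MvPolynomial (ι ⊕ σ) ℂ) :
    coeffFun v (fun t => X (Sum.inr j) * H t)
      = functionGen intVec (.inl (X j)) (coeffFun v H) := by
  funext κ
  simp only [functionGen, LinearMap.mulLeft_apply, Pi.mul_apply]
  rw [coeffFun_apply, coeffFun_apply, innerCoeff_X_inr_mul]
  split_ifs
  · rw [mul_smul_comm]
  · rw [mul_zero]

theorem coeffFun_pderiv_inr (v : ℤ) (j : σ) (H : ℕ → MvPolynomial (ι ⊕ σ) ℂ) :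
    coeffFun v (fun t => pderiv (Sum.inr j) (H t))
      = functionGen intVec (.inr (.inr (pderiv j))) (coeffFun v H) := by
  funext κ
  change _ = pderiv j (coeffFun v H κ)
  rw [coeffFun_apply, coeffFun_apply, innerCoeff_pderiv_inr]
  split_ifs
  · rw [Derivation.map_smul]
  · rw [map_zero]

/-- Multiplication by the exponent `s = k - 1` corresponds to multiplication by `|κ| + v - 1`. -/
theorem coeffFun_exponent_mul (v : ℤ) (H : ℕ → MvPolynomial (ι ⊕ σ) ℂ) :
    coeffFun v (fun k => (((k : ℤ) - 1 : ℤ) : MvPolynomial (ι ⊕ σ) ℂ) * H k)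
      = (∑ i, fun κ => (κ i : MvPolynomial σ ℂ) * coeffFun v H κ)
        + ((v - 1 : ℤ) : ℂ) • coeffFun v H := by
  funext κ
  rw [Pi.add_apply, Finset.sum_apply, ← Finset.sum_mul, ← Nat.cast_sum, ← Finsupp.degree_eq_sum,
    Pi.smul_apply, ← map_natCast (algebraMap ℂ (MvPolynomial σ ℂ)), ← Algebra.smul_def, ← add_smul,
    coeffFun_apply, coeffFun_apply]
  split_ifs with h
  · rw [← map_intCast (algebraMap ℂ (MvPolynomial (ι ⊕ σ) ℂ)), ← Algebra.smul_def, map_smul,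
      smul_comm]
    congr 1
    rw [Int.toNat_of_nonneg h]
    push_cast
    ring
  · rw [smul_zero]

theorem coeffFun_linearForm_pow (f : ι → MvPolynomial σ ℂ) (v : ℤ) :
    coeffFun v (fun k => linearForm f ^ k) = if v = 0 then generatorFun f 0 else 0 := by
  funext κ
  rw [coeffFun_apply, div_eq_inv_mul, mul_smul, multiFactorial_smul_innerCoeff_linearForm_pow]
  by_cases hv : v = 0
  · subst hv
    rw [if_pos (by omega), if_pos (by omega), if_pos rfl, smul_smul, inv_mul_cancel₀, one_smul]
    · simp [generatorFun, binomialPower]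
    · exact Nat.cast_ne_zero.2 (Nat.factorial_ne_zero _)
  · rw [if_neg hv]
    split_ifs with h1 h2
    · omega
    · rw [smul_zero]; rfl
    · rfl

/-- Extraction of coefficients turns elements of `D[s] · F ^ (s + 1)` for the linear form `F` with
coefficients `f` into elements of the modules that occur in the functional equation of `f`. -/
theorem coeffFun_mem_weightModule (f : ι → MvPolynomial σ ℂ) (v : ℤ)
    {H : ℕ → MvPolynomial (ι ⊕ σ) ℂ}
    (hH : H ∈ opClosure (functionGen fun (k : ℕ) (_ : Unit) => (k : ℤ) - 1)
        (Set.range fun (_ : Unit) (k : ℕ) => linearForm f ^ k)) :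
    coeffFun v H ∈ weightModule f v := by
  have hle : opClosure (functionGen fun (k : ℕ) (_ : Unit) => (k : ℤ) - 1)
        (Set.range fun (_ : Unit) (k : ℕ) => linearForm f ^ k)
      ≤ ⨅ v, (weightModule f v).comap (coeffFun v) := by
    refine opClosure_le ?_ (functionGen_mem_of_stable ?_ ?_ ?_)
    · rintro _ ⟨_, rfl⟩
      simp only [SetLike.mem_coe, Submodule.mem_iInf, Submodule.mem_comap]
      intro v
      rw [coeffFun_linearForm_pow]
      split_ifs with hv
      · exact generatorFun_mem_weightModule f 0 (by simp [hv])
      · exact zero_mem _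
    · intro n h hh
      simp only [Submodule.mem_iInf, Submodule.mem_comap] at hh ⊢
      intro v
      rcases n with i | j
      · rw [coeffFun_X_inl_mul]
        have := lower_mem_weightModule i (hh (v + 1))
        rwa [add_sub_cancel_right] at this
      · rw [coeffFun_X_inr_mul]
        exact functionGen_mem_weightModule _ (hh v)
    · intro n h hh
      simp only [Submodule.mem_iInf, Submodule.mem_comap] at hh ⊢
      intro v
      rcases n with i | j
      · rw [coeffFun_pderiv_inl]
        have := raise_mem_weightModule i (hh (v - 1))
        rwa [sub_add_cancel] at this
      · rw [coeffFun_pderiv_inr]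
        exact functionGen_mem_weightModule _ (hh v)
    · intro _ h hh
      simp only [Submodule.mem_iInf, Submodule.mem_comap] at hh ⊢
      intro v
      rw [coeffFun_exponent_mul]
      exact add_mem (Submodule.sum_mem _ fun i _ => coord_mul_mem_weightModule i (hh v))
        (Submodule.smul_mem _ _ (hh v))
  have := hle hH
  simp only [Submodule.mem_iInf, Submodule.mem_comap] at this
  exact this v

omit [Fintype σ] in
theorem linearForm_not_isUnit (f : ι → MvPolynomial σ ℂ) : ¬ IsUnit (linearForm f) := by
  intro h
  have h1 := h.map (aeval (Sum.elim (fun _ : ι => (0 : ℂ)) fun _ : σ => (0 : ℂ)) :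
    MvPolynomial (ι ⊕ σ) ℂ →ₐ[ℂ] ℂ)
  simp [linearForm] at h1

theorem linearForm_ne_zero [Nonempty ι] {f : ι → MvPolynomial σ ℂ} (hf : ∀ i, f i ≠ 0) :
    linearForm f ≠ 0 := by
  intro h
  obtain ⟨i⟩ := ‹Nonempty ι›
  have h1 := multiFactorial_smul_innerCoeff_linearForm_pow f 1 (Finsupp.single i 1)
  rw [pow_one, h, map_zero, smul_zero, if_pos (by simp)] at h1
  refine hf i ?_
  have h2 : ∏ j, f j ^ (Finsupp.single i 1) j = f i := by
    rw [Finset.prod_eq_single i]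
    · simp
    · intro j _ hj
      simp [hj.symm]
    · simp
  rw [h2] at h1
  simpa using h1.symm

/-- The coefficients of weight `1` of the values `(k + 1) b (k) F ^ k` are the values
`b (|κ|) f ^ κ`. -/
theorem familyEquation_of_elementEquation [Nonempty ι] {f : ι → MvPolynomial σ ℂ}
    (hf : ∀ i, f i ≠ 0) {b : Polynomial ℂ}
    (h : ElementEquation (linearForm f) ((Polynomial.X + 1) * b)) : FamilyEquation f b := by
  obtain ⟨H, h1, h2⟩ := (elementEquation_iff_shifted (linearForm_ne_zero hf) _).1 h
  rw [familyEquation_iff hf]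
  refine (congrArg (· ∈ weightModule f 1) ?_).mp (coeffFun_mem_weightModule f 1 h1)
  funext κ
  have h3 : ((κ.degree : ℤ) + 1).toNat = κ.degree + 1 := by omega
  rw [coeffFun_apply, if_pos (by omega), h3, h2, ← Algebra.smul_def, map_smul, smul_comm,
    div_eq_inv_mul, mul_smul, multiFactorial_smul_innerCoeff_linearForm_pow, if_pos rfl, smul_smul,
    smul_smul, ← Algebra.smul_def, Nat.factorial_succ]
  congr 1
  have h4 : (κ.degree.factorial : ℂ) ≠ 0 := Nat.cast_ne_zero.2 (Nat.factorial_ne_zero _)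
  have h5 : (κ.degree : ℂ) + 1 ≠ 0 := Nat.cast_add_one_ne_zero _
  simp only [Polynomial.eval_mul, Polynomial.eval_add, Polynomial.eval_X, Polynomial.eval_one]
  push_cast
  field_simp

/-- Since the linear form is not a unit, `-1` is a root of every polynomial in its functional
equation. -/
theorem X_add_one_dvd_of_elementEquation [Nonempty ι] {f : ι → MvPolynomial σ ℂ}
    (hf : ∀ i, f i ≠ 0) {c : Polynomial ℂ} (h : ElementEquation (linearForm f) c) :
    Polynomial.X + 1 ∣ c := by
  obtain ⟨a, ha⟩ := h.exists_eval_neg_one_eq_mul (linearForm_ne_zero hf)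
  have h1 : c.eval (-1) = 0 := by
    by_contra h0
    refine linearForm_not_isUnit f (isUnit_of_mul_isUnit_right (x := a) ?_)
    rw [← ha]
    exact (isUnit_iff_ne_zero.2 h0).map _
  have h2 := Polynomial.dvd_iff_isRoot.2 h1
  rwa [map_neg, map_one, sub_neg_eq_add] at h2

/-- The homogeneous polynomial `∑_{|κ| = K} h (κ) y ^ κ / κ!`; it is `0` for negative `K`. -/
def expComponent (K : ℤ) (h : (ι →₀ ℕ) → MvPolynomial σ ℂ) : MvPolynomial (ι ⊕ σ) ℂ :=
  (sumAlgEquiv ℂ ι σ).symm (∑ κ ∈ Finset.finsuppAntidiag Finset.univ K.toNat,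
    if (κ.degree : ℤ) = K then monomial κ ((multiFactorial κ : ℂ)⁻¹ • h κ) else 0)

theorem innerCoeff_expComponent (K : ℤ) (h : (ι →₀ ℕ) → MvPolynomial σ ℂ) (κ : ι →₀ ℕ) :
    innerCoeff κ (expComponent K h)
      = if (κ.degree : ℤ) = K then (multiFactorial κ : ℂ)⁻¹ • h κ else 0 := by
  rw [expComponent, innerCoeff_apply, AlgEquiv.apply_symm_apply, coeff_sum]
  have h1 : ∀ κ' : ι →₀ ℕ, coeff κ (if (κ'.degree : ℤ) = K then
      monomial κ' ((multiFactorial κ' : ℂ)⁻¹ • h κ') else 0)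
      = if κ' = κ then (if (κ.degree : ℤ) = K then (multiFactorial κ : ℂ)⁻¹ • h κ else 0) else 0 := by
    intro κ'
    by_cases hk : κ' = κ
    · subst hk
      rw [if_pos rfl]
      split_ifs <;> simp
    · rw [if_neg hk]
      split_ifs <;> simp [coeff_monomial, hk]
  rw [Finset.sum_congr rfl fun κ' _ => h1 κ', Finset.sum_ite_eq']
  split_ifs with h2 h3 h3
  · rfl
  · rfl
  · refine absurd ?_ h2
    rw [Finset.mem_finsuppAntidiag]
    refine ⟨?_, Finset.subset_univ _⟩
    rw [← h3, Finsupp.degree_eq_sum, Int.toNat_natCast]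
  · rfl

theorem expComponent_lower (K : ℤ) (i : ι) (h : (ι →₀ ℕ) → MvPolynomial σ ℂ) :
    expComponent K (lower i h) = X (Sum.inl i) * expComponent (K - 1) h := by
  refine innerCoeff_ext fun κ => ?_
  rw [innerCoeff_X_inl_mul, innerCoeff_expComponent, innerCoeff_expComponent, lower_apply]
  by_cases hi : κ i = 0
  · simp [hi]
  · have h2 := degree_sub_single hi
    rw [if_neg hi]
    by_cases h3 : (κ.degree : ℤ) = K
    · rw [if_pos h3, if_pos (by omega), multiFactorial_of_ne_zero hi,
        ← map_natCast (algebraMap ℂ (MvPolynomial σ ℂ)), ← Algebra.smul_def, smul_smul]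
      congr 1
      have : (κ i : ℂ) ≠ 0 := Nat.cast_ne_zero.2 hi
      push_cast
      field_simp
    · rw [if_neg h3, if_neg (by omega)]

theorem expComponent_raise (K : ℤ) (i : ι) (h : (ι →₀ ℕ) → MvPolynomial σ ℂ) :
    expComponent K (raise i h) = pderiv (Sum.inl i) (expComponent (K + 1) h) := by
  refine innerCoeff_ext fun κ => ?_
  rw [innerCoeff_pderiv_inl, innerCoeff_expComponent, innerCoeff_expComponent, raise_apply,
    degree_add_single]
  by_cases h3 : (κ.degree : ℤ) = K
  · rw [if_pos h3, if_pos (by push_cast; omega), multiFactorial_add_single,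
      ← map_natCast (algebraMap ℂ (MvPolynomial σ ℂ)), ← Algebra.smul_def, smul_smul]
    congr 1
    have : (κ i : ℂ) + 1 ≠ 0 := Nat.cast_add_one_ne_zero _
    push_cast
    field_simp
  · rw [if_neg h3, if_neg (by push_cast; omega), mul_zero]

theorem expComponent_X_mul (K : ℤ) (j : σ) (h : (ι →₀ ℕ) → MvPolynomial σ ℂ) :
    expComponent K (fun κ => X j * h κ) = X (Sum.inr j) * expComponent K h := by
  refine innerCoeff_ext fun κ => ?_
  rw [innerCoeff_X_inr_mul, innerCoeff_expComponent, innerCoeff_expComponent]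
  split_ifs
  · rw [mul_smul_comm]
  · rw [mul_zero]

theorem expComponent_pderiv (K : ℤ) (j : σ) (h : (ι →₀ ℕ) → MvPolynomial σ ℂ) :
    expComponent K (fun κ => pderiv j (h κ)) = pderiv (Sum.inr j) (expComponent K h) := by
  refine innerCoeff_ext fun κ => ?_
  rw [innerCoeff_pderiv_inr, innerCoeff_expComponent, innerCoeff_expComponent]
  split_ifs
  · rw [Derivation.map_smul]
  · rw [map_zero]

/-- The sequence `k ↦ (k + 1)! ∑_{|κ| = k + 1 - v} h (κ) y ^ κ / κ!`. -/
def expSeries (v : ℤ) : ((ι →₀ ℕ) → MvPolynomial σ ℂ) →ₗ[ℂ] (ℕ → MvPolynomial (ι ⊕ σ) ℂ) where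
  toFun h k := ((k + 1).factorial : ℂ) • expComponent (k + 1 - v) h
  map_add' h h' := by
    funext k
    rw [Pi.add_apply, ← smul_add]
    congr 1
    refine innerCoeff_ext fun κ => ?_
    rw [map_add]
    simp only [innerCoeff_expComponent]
    split_ifs <;> simp
  map_smul' c h := by
    funext k
    rw [Pi.smul_apply, RingHom.id_apply, smul_comm]
    congr 1
    refine innerCoeff_ext fun κ => ?_
    rw [map_smul]
    simp only [innerCoeff_expComponent]
    split_ifs
    · rw [Pi.smul_apply, smul_comm]
    · rw [smul_zero]

theorem expSeries_apply (v : ℤ) (h : (ι →₀ ℕ) → MvPolynomial σ ℂ) (k : ℕ) :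
    expSeries v h k = ((k + 1).factorial : ℂ) • expComponent (k + 1 - v) h := rfl

/-- The functions of `k` obtained from `g ^ (k + 1)` by differential operators with coefficients
that are polynomials in `k`. -/
def powerModuleFun {A : Type*} [CommRing A] [Algebra ℂ A] (g : A) : Submodule ℂ (ℕ → A) :=
  opClosure (functionGen fun (k : ℕ) (_ : Unit) => (k : ℤ))
    (Set.range fun (_ : Unit) (k : ℕ) => g ^ (k + 1))

theorem X_mul_mem_powerModuleFun {τ : Type*} {g : MvPolynomial τ ℂ} (n : τ)
    {H : ℕ → MvPolynomial τ ℂ} (hH : H ∈ powerModuleFun g) :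
    (fun k => X n * H k) ∈ powerModuleFun g := by
  rw [← functionGen_algebra fun (k : ℕ) (_ : Unit) => (k : ℤ)]
  exact apply_mem_opClosure _ hH

theorem pderiv_mem_powerModuleFun {τ : Type*} {g : MvPolynomial τ ℂ} (n : τ)
    {H : ℕ → MvPolynomial τ ℂ} (hH : H ∈ powerModuleFun g) :
    (fun k => pderiv n (H k)) ∈ powerModuleFun g := by
  rw [← functionGen_derivation fun (k : ℕ) (_ : Unit) => (k : ℤ)]
  exact apply_mem_opClosure _ hH

theorem innerCoeff_linearForm_pow (f : ι → MvPolynomial σ ℂ) (κ : ι →₀ ℕ) (K : ℕ) :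
    innerCoeff κ (linearForm f ^ K)
      = if κ.degree = K then ((K.factorial : ℂ) * (multiFactorial κ : ℂ)⁻¹) • ∏ i, f i ^ κ i
        else 0 := by
  have h1 := multiFactorial_smul_innerCoeff_linearForm_pow f K κ
  rw [← eq_inv_smul_iff₀ (multiFactorial_ne_zero κ)] at h1
  rw [h1]
  split_ifs
  · rw [smul_smul, mul_comm]
  · rw [smul_zero]

/-- The functions `h` of `κ` whose series `expSeries v h` belongs to `D[s] · F ^ (s + 1)`, where
`F` is the linear form with coefficients `f`. -/
def seriesModule (f : ι → MvPolynomial σ ℂ) (v : ℤ) :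
    Submodule ℂ ((ι →₀ ℕ) → MvPolynomial σ ℂ) :=
  (powerModuleFun (linearForm f)).comap (expSeries v)

theorem mem_seriesModule {f : ι → MvPolynomial σ ℂ} {v : ℤ} {h : (ι →₀ ℕ) → MvPolynomial σ ℂ} :
    h ∈ seriesModule f v ↔ expSeries v h ∈ powerModuleFun (linearForm f) := Iff.rfl

theorem raise_mem_seriesModule {f : ι → MvPolynomial σ ℂ} (v : ℤ) (i : ι)
    (h : (ι →₀ ℕ) → MvPolynomial σ ℂ) (hh : h ∈ seriesModule f v) :
    raise i h ∈ seriesModule f (v + 1) := by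
  rw [mem_seriesModule] at hh ⊢
  convert pderiv_mem_powerModuleFun (Sum.inl i) hh using 1
  funext k
  rw [expSeries_apply, expSeries_apply, expComponent_raise, Derivation.map_smul,
    show (k : ℤ) + 1 - (v + 1) + 1 = k + 1 - v by ring]

theorem lower_mem_seriesModule {f : ι → MvPolynomial σ ℂ} (v : ℤ) (i : ι)
    (h : (ι →₀ ℕ) → MvPolynomial σ ℂ) (hh : h ∈ seriesModule f v) :
    lower i h ∈ seriesModule f (v - 1) := by
  rw [mem_seriesModule] at hh ⊢
  convert X_mul_mem_powerModuleFun (Sum.inl i) hh using 1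
  funext k
  rw [expSeries_apply, expSeries_apply, expComponent_lower, mul_smul_comm,
    show (k : ℤ) + 1 - (v - 1) - 1 = k + 1 - v by ring]

/-- The series of weight `0` of `κ ↦ f ^ κ` is the sequence of the powers `F ^ (k + 1)`. -/
theorem generatorFun_zero_mem_seriesModule (f : ι → MvPolynomial σ ℂ) :
    generatorFun f 0 ∈ seriesModule f 0 := by
  rw [mem_seriesModule]
  have h1 : (fun k => linearForm f ^ (k + 1)) ∈ powerModuleFun (linearForm f) :=
    subset_opClosure _ _ ⟨(), rfl⟩
  convert h1 using 1
  funext k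
  rw [expSeries_apply]
  refine innerCoeff_ext fun κ => ?_
  rw [map_smul, innerCoeff_expComponent, innerCoeff_linearForm_pow]
  by_cases h3 : κ.degree = k + 1
  · rw [if_pos h3, if_pos (by omega), smul_smul]
    simp [generatorFun, binomialPower]
  · rw [if_neg h3, if_neg (by omega), smul_zero]

/-- The exponential series turns elements of the modules that occur in the functional equation of
`f` into elements of `D[s] · F ^ (s + 1)`. -/
theorem weightModule_le_seriesModule (f : ι → MvPolynomial σ ℂ) :
    weightModule f 1 ≤ seriesModule f 1 := by
  refine weightModule_le (fun u hu => hu ▸ generatorFun_mem_of_shift f (seriesModule f)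
    (generatorFun_zero_mem_seriesModule f) raise_mem_seriesModule lower_mem_seriesModule u)
    (functionGen_mem_of_stable ?_ ?_ ?_)
  · intro j h hh
    rw [mem_seriesModule] at hh ⊢
    convert X_mul_mem_powerModuleFun (Sum.inr j) hh using 1
    funext k
    rw [expSeries_apply, expSeries_apply, expComponent_X_mul, mul_smul_comm]
  · intro j h hh
    rw [mem_seriesModule] at hh ⊢
    convert pderiv_mem_powerModuleFun (Sum.inr j) hh using 1
    funext k
    rw [expSeries_apply, expSeries_apply, expComponent_pderiv, Derivation.map_smul]
  · intro i h hh
    -- multiplication by `κ i` is the composition of `raise i` and `lower i`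
    have h1 := lower_mem_seriesModule _ i _ (raise_mem_seriesModule 1 i h hh)
    rw [add_sub_cancel_right] at h1
    have h2 : (fun κ => ((intVec κ i : ℤ) : MvPolynomial σ ℂ) * h κ) = lower i (raise i h) := by
      funext κ
      rw [lower_raise]
      simp [intVec]
    rwa [h2]

/-- The series of weight `1` of the function `κ ↦ b (|κ|) f ^ κ` is the sequence
`(k + 1) b (k) F ^ k`. -/
theorem elementEquation_of_familyEquation [Nonempty ι] {f : ι → MvPolynomial σ ℂ}
    (hf : ∀ i, f i ≠ 0) {b : Polynomial ℂ} (h : FamilyEquation f b) :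
    ElementEquation (linearForm f) ((Polynomial.X + 1) * b) := by
  rw [elementEquation_iff (linearForm_ne_zero hf)]
  rw [familyEquation_iff hf] at h
  have h1 := mem_seriesModule.1 (weightModule_le_seriesModule f h)
  change _ ∈ powerModuleFun (linearForm f)
  convert h1 using 1
  funext k
  rw [expSeries_apply]
  refine innerCoeff_ext fun κ => ?_
  rw [map_smul, innerCoeff_expComponent, ← Algebra.smul_def, map_smul, innerCoeff_linearForm_pow]
  by_cases h3 : κ.degree = k
  · subst h3
    rw [if_pos rfl, if_pos (by omega), ← Algebra.smul_def, smul_smul, smul_smul, smul_smul,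
      Nat.factorial_succ]
    congr 1
    simp only [Polynomial.eval_mul, Polynomial.eval_add, Polynomial.eval_X, Polynomial.eval_one]
    push_cast
    ring
  · rw [if_neg h3, if_neg (by omega), smul_zero, smul_zero]

/-- The Bernstein-Sato theory of a family is that of the associated linear form, up to the factor
`s + 1`. -/
theorem familyEquation_iff_elementEquation [Nonempty ι] {f : ι → MvPolynomial σ ℂ}
    (hf : ∀ i, f i ≠ 0) (b : Polynomial ℂ) :
    FamilyEquation f b ↔ ElementEquation (linearForm f) ((Polynomial.X + 1) * b) :=
  ⟨elementEquation_of_familyEquation hf, familyEquation_of_elementEquation hf⟩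

end LinearForm

/-! ### The case of one element: modules over the polynomial ring in the exponent -/

section Element

variable {A : Type*} [CommRing A] [Algebra ℂ A]

/-- `Frac(A)[s]` as an algebra over `ℂ[s]`. -/
instance exponentAlgebra : Algebra (Polynomial ℂ) (PowerModule A Unit) :=
  (Polynomial.aeval (MvPolynomial.X () : PowerModule A Unit)).toAlgebra

theorem exponent_algebraMap (c : Polynomial ℂ) : algebraMap (Polynomial ℂ) (PowerModule A Unit) c
    = Polynomial.aeval (MvPolynomial.X () : PowerModule A Unit) c := rfl

theorem exponent_smul_def (c : Polynomial ℂ) (p : PowerModule A Unit) :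
    c • p = Polynomial.aeval (MvPolynomial.X () : PowerModule A Unit) c * p := rfl

instance : IsScalarTower ℂ (Polynomial ℂ) (PowerModule A Unit) :=
  IsScalarTower.of_algebraMap_eq fun c => by
    rw [exponent_algebraMap, Polynomial.algebraMap_eq, Polynomial.aeval_C]

theorem extend_smul (δ : Derivation ℂ A A) (c : Polynomial ℂ) (p : PowerModule A Unit) :
    extend Unit δ (c • p) = c • extend Unit δ p := by
  rw [exponent_smul_def, exponent_smul_def, Derivation.leibniz, Derivation.map_aeval, extend_X]
  simp

theorem extend_sum_smul {ι I : Type*} (s : Finset I) (a : I → A) (D : I → Derivation ℂ A A) :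
    extend ι (∑ i ∈ s, a i • D i)
      = ∑ i ∈ s, algebraMap A (PowerModule A ι) (a i) • extend ι (D i) := by
  refine (extend_spec _).unique ⟨fun x => ?_, fun j => ?_⟩
  · rw [derivation_sum_apply, derivation_sum_apply, map_sum]
    refine Finset.sum_congr rfl fun i _ => ?_
    rw [Derivation.smul_apply, extend_algebraMap, Derivation.smul_apply, smul_eq_mul, smul_eq_mul,
      map_mul]
  · rw [derivation_sum_apply]
    refine Finset.sum_eq_zero fun i _ => ?_
    rw [Derivation.smul_apply, extend_X, smul_zero]

variable [IsDomain A]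

/-- The action of derivations on `Frac(A)[s] · g ^ s` is linear over `A`. -/
theorem connection_sum_smul {I : Type*} (g : A) (s : Finset I) (a : I → A)
    (D : I → Derivation ℂ A A) (p : PowerModule A Unit) :
    connection (fun _ : Unit => g) (∑ i ∈ s, a i • D i) p
      = ∑ i ∈ s, algebraMap A _ (a i) * connection (fun _ : Unit => g) (D i) p := by
  have h2 : logDerivative (fun _ : Unit => g) (∑ i ∈ s, a i • D i)
      = ∑ i ∈ s, algebraMap A _ (a i) * logDerivative (fun _ : Unit => g) (D i) := by
    simp only [logDerivative, Finset.univ_unique, Finset.sum_singleton]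
    rw [derivation_sum_apply, map_sum, Finset.sum_div, map_sum, Finset.mul_sum]
    refine Finset.sum_congr rfl fun i _ => ?_
    rw [Derivation.smul_apply, smul_eq_mul, map_mul, mul_div_assoc, map_mul,
      algebraMap_powerModule]
    ring
  rw [connection_apply, extend_sum_smul, h2, derivation_sum_apply, Finset.sum_mul,
    ← Finset.sum_add_distrib]
  refine Finset.sum_congr rfl fun i _ => ?_
  rw [connection_apply, Derivation.smul_apply, smul_eq_mul]
  ring

theorem specialize_smul (k : Unit → ℤ) (c : Polynomial ℂ) (p : PowerModule A Unit) :
    specialize k (c • p) = c.eval (k () : ℂ) • specialize k p := by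
  have h1 := specialize_aeval_sum (A := A) k c
  simp only [Finset.univ_unique, Finset.sum_singleton, PUnit.default_eq_unit] at h1
  rw [exponent_smul_def, map_mul, h1, ← IsScalarTower.algebraMap_apply, ← Algebra.smul_def]

/-- `Frac(A)[s]` is torsion-free over `ℂ[s]`. -/
instance : Module.IsTorsionFree (Polynomial ℂ) (PowerModule A Unit) := by
  rw [Module.isTorsionFree_iff_algebraMap_injective, injective_iff_map_eq_zero]
  intro c hc
  refine Polynomial.eq_zero_of_infinite_isRoot c ?_
  refine (Set.infinite_range_of_injective (f := fun n : ℕ => (n : ℂ)) Nat.cast_injective).mono ?_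
  rintro _ ⟨n, rfl⟩
  have h1 := specialize_smul (A := A) (fun _ => (n : ℤ)) c 1
  rw [Algebra.smul_def, hc, zero_mul, map_zero, map_one, ← Algebra.algebraMap_eq_smul_one] at h1
  have h2 := (map_eq_zero_iff _ (algebraMap ℂ (PowerModule A Unit)).injective).1 h1.symm
  simpa using h2

theorem connection_smul (g : A) (δ : Derivation ℂ A A) (c : Polynomial ℂ)
    (p : PowerModule A Unit) :
    connection (fun _ : Unit => g) δ (c • p) = c • connection (fun _ : Unit => g) δ p := by
  rw [connection_apply, connection_apply, extend_smul, smul_add, mul_smul_comm]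

theorem logDerivative_unit (g : A) (δ : Derivation ℂ A A) :
    logDerivative (fun _ : Unit => g) δ = MvPolynomial.X () *
      MvPolynomial.C (algebraMap A (FractionRing A) (δ g) / algebraMap A (FractionRing A) g) := by
  simp [logDerivative]

/-- The module `D(A)[s] · g ^ (s + j)`, as a `ℂ[s]`-submodule of `Frac(A)[s] · g ^ s`. -/
def powerSubmodule (g : A) (j : ℕ) : Submodule (Polynomial ℂ) (PowerModule A Unit) where
  carrier := opClosure (diffGen fun _ : Unit => g) {algebraMap A _ (g ^ j)}
  add_mem' := add_mem
  zero_mem' := zero_mem _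
  smul_mem' c p hp := by
    simp only [SetLike.mem_coe] at hp ⊢
    induction c using Polynomial.induction_on' with
    | add c d hc hd => rw [add_smul]; exact add_mem hc hd
    | monomial n a =>
      have h : ∀ n : ℕ, (MvPolynomial.X () : PowerModule A Unit) ^ n * p ∈
          opClosure (diffGen fun _ : Unit => g) {algebraMap A _ (g ^ j)} := by
        intro n
        induction n with
        | zero => rwa [pow_zero, one_mul]
        | succ n ih =>
          rw [pow_succ', mul_assoc]
          exact apply_mem_opClosure (T := diffGen fun _ : Unit => g) (.inr (.inl ())) ih
      rw [exponent_smul_def, Polynomial.aeval_monomial, mul_assoc, ← Algebra.smul_def]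
      exact Submodule.smul_mem _ _ (h n)

theorem mem_powerSubmodule {g : A} {j : ℕ} {p : PowerModule A Unit} :
    p ∈ powerSubmodule g j ↔ p ∈ opClosure (diffGen fun _ : Unit => g) {algebraMap A _ (g ^ j)} :=
  Iff.rfl

theorem algebraMap_pow_mem_powerSubmodule (g : A) (j : ℕ) :
    algebraMap A _ (g ^ j) ∈ powerSubmodule g j :=
  subset_opClosure _ _ rfl

theorem algebraMap_mul_mem_powerSubmodule {g : A} {j : ℕ} (a : A) {p : PowerModule A Unit}
    (hp : p ∈ powerSubmodule g j) : algebraMap A _ a * p ∈ powerSubmodule g j :=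
  apply_mem_opClosure (T := diffGen fun _ : Unit => g) (.inl a) hp

theorem connection_mem_powerSubmodule {g : A} {j : ℕ} (δ : Derivation ℂ A A)
    {p : PowerModule A Unit} (hp : p ∈ powerSubmodule g j) :
    connection (fun _ : Unit => g) δ p ∈ powerSubmodule g j :=
  apply_mem_opClosure (T := diffGen fun _ : Unit => g) (.inr (.inr δ)) hp

theorem powerSubmodule_le {g : A} {j : ℕ} {N : Submodule (Polynomial ℂ) (PowerModule A Unit)}
    (h1 : algebraMap A _ (g ^ j) ∈ N) (h2 : ∀ t, ∀ p ∈ N, diffGen (fun _ : Unit => g) t p ∈ N) :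
    powerSubmodule g j ≤ N := by
  have : opClosure (diffGen fun _ : Unit => g) {algebraMap A _ (g ^ j)} ≤ N.restrictScalars ℂ :=
    opClosure_le (Set.singleton_subset_iff.2 h1) h2
  exact this

theorem elementEquation_iff_smul_one_mem (g : A) (b : Polynomial ℂ) :
    ElementEquation g b ↔ b • (1 : PowerModule A Unit) ∈ powerSubmodule g 1 := by
  rw [elementEquation_iff_mem_opClosure, mem_powerSubmodule, Set.range_const, pow_one,
    exponent_smul_def, mul_one]

/-- The ideal of all polynomials that satisfy the functional equation of `g`. -/
def bernsteinIdeal (g : A) : Ideal (Polynomial ℂ) :=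
  (powerSubmodule g 1).comap (LinearMap.toSpanSingleton _ _ (1 : PowerModule A Unit))

theorem mem_bernsteinIdeal {g : A} {b : Polynomial ℂ} :
    b ∈ bernsteinIdeal g ↔ ElementEquation g b :=
  (elementEquation_iff_smul_one_mem g b).symm

/-- The functional equation is invariant under isomorphisms of algebras. -/
theorem ElementEquation.map_algEquiv {A' : Type*} [CommRing A'] [Algebra ℂ A'] [IsDomain A']
    (e : A ≃ₐ[ℂ] A') {g : A} (hg : g ≠ 0) {b : Polynomial ℂ} (h : ElementEquation g b) :
    ElementEquation (e g) b := by
  rw [elementEquation_iff hg] at h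
  rw [elementEquation_iff ((map_ne_zero_iff e e.injective).2 hg)]
  have hle : opClosure (functionGen fun (k : ℕ) (_ : Unit) => (k : ℤ))
        (Set.range fun (_ : Unit) (k : ℕ) => g ^ (k + 1))
      ≤ (opClosure (functionGen fun (k : ℕ) (_ : Unit) => (k : ℤ))
        (Set.range fun (_ : Unit) (k : ℕ) => e g ^ (k + 1))).comap
        ((e.toLinearMap : A →ₗ[ℂ] A').compLeft ℕ) := by
    refine opClosure_le ?_ ?_
    · rintro _ ⟨_, rfl⟩
      refine subset_opClosure _ _ ⟨(), ?_⟩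
      funext k
      exact (map_pow e g (k + 1)).symm
    · rintro (a | i | δ) H hH <;> rw [Submodule.mem_comap] at hH ⊢
      · refine (congrArg (· ∈ opClosure _ _) ?_).mp (apply_mem_opClosure (.inl (e a)) hH)
        funext k
        exact (map_mul e a (H k)).symm
      · refine (congrArg (· ∈ opClosure _ _) ?_).mp (apply_mem_opClosure (.inr (.inl i)) hH)
        funext k
        change ((k : ℤ) : A') * e (H k) = e (((k : ℤ) : A) * H k)
        rw [map_mul, map_intCast]
      · let δ' : Derivation ℂ A' A' := Derivation.mk'
          (e.toLinearMap ∘ₗ (δ : A →ₗ[ℂ] A) ∘ₗ e.symm.toLinearMap) (fun a b => by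
            change e (δ (e.symm (a * b))) = a * e (δ (e.symm b)) + b * e (δ (e.symm a))
            rw [map_mul, Derivation.leibniz, map_add, smul_eq_mul, smul_eq_mul, map_mul, map_mul,
              AlgEquiv.apply_symm_apply, AlgEquiv.apply_symm_apply])
        refine (congrArg (· ∈ opClosure _ _) ?_).mp (apply_mem_opClosure (.inr (.inr δ')) hH)
        funext k
        change e (δ (e.symm (e (H k)))) = e (δ (H k))
        rw [AlgEquiv.symm_apply_apply]
  refine (congrArg (· ∈ opClosure _ _) ?_).mp (hle h)
  funext k
  change e (algebraMap ℂ A _ * g ^ k) = _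
  rw [map_mul, map_pow, AlgEquiv.commutes]

theorem bernsteinIdeal_algEquiv {A' : Type*} [CommRing A'] [Algebra ℂ A'] [IsDomain A']
    (e : A ≃ₐ[ℂ] A') {g : A} (hg : g ≠ 0) : bernsteinIdeal (e g) = bernsteinIdeal g := by
  ext b
  rw [mem_bernsteinIdeal, mem_bernsteinIdeal]
  refine ⟨fun h => ?_, fun h => h.map_algEquiv e hg⟩
  have := h.map_algEquiv e.symm ((map_ne_zero_iff e e.injective).2 hg)
  rwa [AlgEquiv.symm_apply_apply] at this

theorem bernsteinIdeal_one : bernsteinIdeal (1 : A) = ⊤ := by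
  rw [Ideal.eq_top_iff_one, mem_bernsteinIdeal, elementEquation_iff_smul_one_mem, one_smul]
  have := algebraMap_pow_mem_powerSubmodule (1 : A) 1
  rwa [one_pow, map_one] at this

end Element

section Polynomial

open MvPolynomial

variable {σ : Type*} [Fintype σ]

/-- For a polynomial ring, stability under `D(A)[s]` need only be checked for the variables and the
partial derivatives. -/
theorem diffGen_mem_of_stable {g : MvPolynomial σ ℂ}
    {N : Submodule (Polynomial ℂ) (PowerModule (MvPolynomial σ ℂ) Unit)}
    (hX : ∀ i, ∀ p ∈ N, algebraMap (MvPolynomial σ ℂ) _ (X i) * p ∈ N)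
    (hd : ∀ i, ∀ p ∈ N, connection (fun _ : Unit => g) (pderiv i) p ∈ N)
    (j : MvPolynomial σ ℂ ⊕ Unit ⊕ Derivation ℂ (MvPolynomial σ ℂ) (MvPolynomial σ ℂ)) :
    ∀ p ∈ N, diffGen (fun _ : Unit => g) j p ∈ N := by
  have hA : ∀ a : MvPolynomial σ ℂ, ∀ p ∈ N, algebraMap (MvPolynomial σ ℂ) _ a * p ∈ N := by
    intro a
    induction a using MvPolynomial.induction_on with
    | C c =>
      intro p hp
      rw [← MvPolynomial.algebraMap_eq, ← IsScalarTower.algebraMap_apply, ← Algebra.smul_def]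
      exact Submodule.smul_of_tower_mem N c hp
    | add a b ha hb =>
      intro p hp
      rw [map_add, add_mul]
      exact add_mem (ha p hp) (hb p hp)
    | mul_X a i ha =>
      intro p hp
      rw [map_mul, mul_assoc]
      exact ha _ (hX i p hp)
  rcases j with a | i | δ
  · exact hA a
  · intro p hp
    have := N.smul_mem (Polynomial.X : Polynomial ℂ) hp
    rwa [exponent_smul_def, Polynomial.aeval_X] at this
  · intro p hp
    have : diffGen (fun _ : Unit => g) (.inr (.inr δ)) p = connection (fun _ : Unit => g) δ p := rfl
    rw [this, derivation_eq_sum_pderiv δ, connection_sum_smul]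
    exact sum_mem fun i _ => hA _ _ (hd i p hp)

end Polynomial

/-! ### Products of polynomials in disjoint sets of variables -/

section BaseChange

variable {A B C : Type*} [CommRing A] [Algebra ℂ A] [IsDomain A] [CommRing B] [Algebra ℂ B]
  [IsDomain B] [CommRing C] [Algebra ℂ C] [IsDomain C]

/-- The map `Frac(A)[s] → Frac(C)[s]` induced by an injective map of algebras `A → C`. -/
def mapPower (φ : A →ₐ[ℂ] C) (hφ : Function.Injective φ) :
    PowerModule A Unit →+* PowerModule C Unit :=
  MvPolynomial.map (IsFractionRing.map (K := FractionRing A) (L := FractionRing C)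
    (j := (φ : A →+* C)) hφ)

variable {φ : A →ₐ[ℂ] C} (hφ : Function.Injective φ) {ψ : B →ₐ[ℂ] C}
  (hψ : Function.Injective ψ)

theorem fractionMap_algebraMap (a : A) :
    IsFractionRing.map (K := FractionRing A) (L := FractionRing C) (j := (φ : A →+* C)) hφ
      (algebraMap A _ a) = algebraMap C _ (φ a) := by
  exact IsLocalization.map_eq _ a

theorem mapPower_algebraMap (a : A) :
    mapPower φ hφ (algebraMap A _ a) = algebraMap C _ (φ a) := by
  rw [algebraMap_powerModule, mapPower, MvPolynomial.map_C, fractionMap_algebraMap,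
    algebraMap_powerModule]

theorem mapPower_C_div (a b : A) :
    mapPower φ hφ (MvPolynomial.C (algebraMap A (FractionRing A) a / algebraMap A _ b))
      = MvPolynomial.C (algebraMap C (FractionRing C) (φ a) / algebraMap C _ (φ b)) := by
  rw [mapPower, MvPolynomial.map_C, map_div₀, fractionMap_algebraMap, fractionMap_algebraMap]

theorem mapPower_X : mapPower φ hφ (MvPolynomial.X ()) = MvPolynomial.X () := by
  rw [mapPower, MvPolynomial.map_X]

theorem mapPower_algebraMap_complex (c : ℂ) :
    mapPower φ hφ (algebraMap ℂ _ c) = algebraMap ℂ _ c := by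
  rw [IsScalarTower.algebraMap_apply ℂ A (PowerModule A Unit), mapPower_algebraMap,
    AlgHom.commutes, ← IsScalarTower.algebraMap_apply]

theorem mapPower_smul (c : Polynomial ℂ) (p : PowerModule A Unit) :
    mapPower φ hφ (c • p) = c • mapPower φ hφ p := by
  rw [exponent_smul_def, exponent_smul_def, map_mul]
  congr 1
  let i : PowerModule A Unit →ₐ[ℂ] PowerModule C Unit :=
    { mapPower φ hφ with commutes' := mapPower_algebraMap_complex hφ }
  have : i (Polynomial.aeval (MvPolynomial.X ()) c)
      = Polynomial.aeval (i (MvPolynomial.X ())) c := (Polynomial.aeval_algHom_apply i _ c).symm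
  exact this.trans (by rw [show i (MvPolynomial.X ()) = MvPolynomial.X () from mapPower_X hφ])

theorem extend_mapPower {δ : Derivation ℂ A A} {δ' : Derivation ℂ C C}
    (h : ∀ a, δ' (φ a) = φ (δ a)) (p : PowerModule A Unit) :
    extend Unit δ' (mapPower φ hφ p) = mapPower φ hφ (extend Unit δ p) := by
  let i : PowerModule A Unit →ₐ[ℂ] PowerModule C Unit :=
    { mapPower φ hφ with commutes' := mapPower_algebraMap_complex hφ }
  refine (extend_spec δ).intertwines i (extend Unit δ') (fun a => ?_) (fun _ => ?_) p
  · change extend Unit δ' (mapPower φ hφ _) = mapPower φ hφ _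
    rw [mapPower_algebraMap, extend_algebraMap, h, mapPower_algebraMap]
  · change extend Unit δ' (mapPower φ hφ _) = 0
    rw [mapPower_X, extend_X]

theorem extend_zero : extend Unit (0 : Derivation ℂ A A) = 0 :=
  (extend_spec _).unique ⟨fun a => by simp, fun i => by simp⟩

theorem extend_mapPower_eq_zero {δ' : Derivation ℂ C C} (h : ∀ a, δ' (φ a) = 0)
    (p : PowerModule A Unit) : extend Unit δ' (mapPower φ hφ p) = 0 := by
  rw [extend_mapPower hφ (δ := 0) (fun a => by rw [h, Derivation.zero_apply, map_zero]),
    extend_zero, Derivation.zero_apply, map_zero]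

/-- A derivation in the direction of the first factor acts on products `p · q` through `p` only. -/
theorem connection_mapPower_mul {δ : Derivation ℂ A A} {δ' : Derivation ℂ C C}
    (h : ∀ a, δ' (φ a) = φ (δ a)) (h' : ∀ b, δ' (ψ b) = 0) (f : A) {g : B} (hg : g ≠ 0)
    (p : PowerModule A Unit) (q : PowerModule B Unit) :
    connection (fun _ : Unit => φ f * ψ g) δ' (mapPower φ hφ p * mapPower ψ hψ q)
      = mapPower φ hφ (connection (fun _ : Unit => f) δ p) * mapPower ψ hψ q := by
  have h1 : logDerivative (fun _ : Unit => φ f * ψ g) δ'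
      = mapPower φ hφ (logDerivative (fun _ : Unit => f) δ) := by
    have hg' : algebraMap C (FractionRing C) (ψ g) ≠ 0 := by
      rw [ne_eq, map_eq_zero_iff _ (IsFractionRing.injective C (FractionRing C)),
        map_eq_zero_iff _ hψ]
      exact hg
    rw [logDerivative_unit, logDerivative_unit, map_mul (mapPower φ hφ), mapPower_X, mapPower_C_div,
      Derivation.leibniz, h, h', smul_zero, zero_add, smul_eq_mul, map_mul, map_mul, mul_comm,
      mul_comm (algebraMap C (FractionRing C) (φ f)), mul_div_mul_left _ _ hg', mul_comm]
  rw [connection_apply, connection_apply, Derivation.leibniz, extend_mapPower_eq_zero hψ h',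
    extend_mapPower hφ h, h1, map_add, map_mul]
  simp only [smul_eq_mul]
  ring

end BaseChange

section Product

open MvPolynomial

variable {σ τ : Type*}

theorem pderiv_inl_rename_inl (i : σ) (a : MvPolynomial σ ℂ) :
    pderiv (Sum.inl i : σ ⊕ τ) (rename Sum.inl a) = rename Sum.inl (pderiv i a) :=
  pderiv_rename Sum.inl_injective i a

theorem pderiv_inr_rename_inr (i : τ) (a : MvPolynomial τ ℂ) :
    pderiv (Sum.inr i : σ ⊕ τ) (rename Sum.inr a) = rename Sum.inr (pderiv i a) :=
  pderiv_rename Sum.inr_injective i a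

theorem pderiv_rename_eq_zero {ρ ρ' : Type*} {e : ρ → ρ'} {n : ρ'} (hn : ∀ i, e i ≠ n)
    (a : MvPolynomial ρ ℂ) : pderiv n (rename e a) = 0 := by
  induction a using MvPolynomial.induction_on with
  | C c => rw [rename_C, pderiv_C]
  | add p q hp hq => rw [map_add, map_add, hp, hq, add_zero]
  | mul_X p i hp =>
    rw [map_mul, Derivation.leibniz, hp, rename_X, pderiv_X_of_ne (hn i), smul_zero, smul_zero,
      add_zero]

/-- The inclusion of the power module of the first group of variables. -/
def powerInl (σ τ : Type*) :
    PowerModule (MvPolynomial σ ℂ) Unit →+* PowerModule (MvPolynomial (σ ⊕ τ) ℂ) Unit :=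
  mapPower (rename Sum.inl) (rename_injective _ Sum.inl_injective)

/-- The inclusion of the power module of the second group of variables. -/
def powerInr (σ τ : Type*) :
    PowerModule (MvPolynomial τ ℂ) Unit →+* PowerModule (MvPolynomial (σ ⊕ τ) ℂ) Unit :=
  mapPower (rename Sum.inr) (rename_injective _ Sum.inr_injective)

/-- The product of polynomials in disjoint sets of variables. -/
def outerProduct (f : MvPolynomial σ ℂ) (g : MvPolynomial τ ℂ) : MvPolynomial (σ ⊕ τ) ℂ :=
  rename Sum.inl f * rename Sum.inr g

theorem connection_pderiv_inl {f : MvPolynomial σ ℂ} {g : MvPolynomial τ ℂ} (hg : g ≠ 0) (i : σ)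
    (p : PowerModule (MvPolynomial σ ℂ) Unit) (q : PowerModule (MvPolynomial τ ℂ) Unit) :
    connection (fun _ : Unit => outerProduct f g) (pderiv (Sum.inl i))
        (powerInl σ τ p * powerInr σ τ q)
      = powerInl σ τ (connection (fun _ : Unit => f) (pderiv i) p) * powerInr σ τ q :=
  connection_mapPower_mul _ _ (pderiv_inl_rename_inl i)
    (pderiv_rename_eq_zero fun _ => by simp) f hg p q

theorem connection_pderiv_inr {f : MvPolynomial σ ℂ} (hf : f ≠ 0) {g : MvPolynomial τ ℂ} (i : τ)
    (p : PowerModule (MvPolynomial σ ℂ) Unit) (q : PowerModule (MvPolynomial τ ℂ) Unit) :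
    connection (fun _ : Unit => outerProduct f g) (pderiv (Sum.inr i))
        (powerInl σ τ p * powerInr σ τ q)
      = powerInl σ τ p * powerInr σ τ (connection (fun _ : Unit => g) (pderiv i) q) := by
  rw [mul_comm, mul_comm (powerInl σ τ p), outerProduct, mul_comm (rename Sum.inl f)]
  exact connection_mapPower_mul _ _ (pderiv_inr_rename_inr i)
    (pderiv_rename_eq_zero fun _ => by simp) g hf q p

theorem algebraMap_X_inl_mul (i : σ) (p : PowerModule (MvPolynomial σ ℂ) Unit)
    (q : PowerModule (MvPolynomial τ ℂ) Unit) :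
    algebraMap (MvPolynomial (σ ⊕ τ) ℂ) _ (X (Sum.inl i)) * (powerInl σ τ p * powerInr σ τ q)
      = powerInl σ τ (algebraMap (MvPolynomial σ ℂ) _ (X i) * p) * powerInr σ τ q := by
  rw [map_mul, powerInl, mapPower_algebraMap, rename_X, mul_assoc]

theorem algebraMap_X_inr_mul (i : τ) (p : PowerModule (MvPolynomial σ ℂ) Unit)
    (q : PowerModule (MvPolynomial τ ℂ) Unit) :
    algebraMap (MvPolynomial (σ ⊕ τ) ℂ) _ (X (Sum.inr i)) * (powerInl σ τ p * powerInr σ τ q)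
      = powerInl σ τ p * powerInr σ τ (algebraMap (MvPolynomial τ ℂ) _ (X i) * q) := by
  rw [map_mul (powerInr σ τ), powerInr, mapPower_algebraMap, rename_X, mul_left_comm]

theorem powerInl_smul (c : Polynomial ℂ) (p : PowerModule (MvPolynomial σ ℂ) Unit) :
    powerInl σ τ (c • p) = c • powerInl σ τ p := mapPower_smul _ c p

theorem powerInr_smul (c : Polynomial ℂ) (p : PowerModule (MvPolynomial τ ℂ) Unit) :
    powerInr σ τ (c • p) = c • powerInr σ τ p := mapPower_smul _ c p

theorem powerInl_mul_powerInr_algebraMap (f : MvPolynomial σ ℂ) (g : MvPolynomial τ ℂ) :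
    powerInl σ τ (algebraMap _ _ (f ^ 1)) * powerInr σ τ (algebraMap _ _ (g ^ 1))
      = algebraMap _ _ (outerProduct f g ^ 1) := by
  rw [powerInl, powerInr, mapPower_algebraMap, mapPower_algebraMap, ← map_mul, pow_one, pow_one,
    pow_one, outerProduct]

/-- Multiplication of elements of the power modules of the two groups of variables. -/
def powerMul (σ τ : Type*) : PowerModule (MvPolynomial σ ℂ) Unit →ₗ[Polynomial ℂ]
    PowerModule (MvPolynomial τ ℂ) Unit →ₗ[Polynomial ℂ]
      PowerModule (MvPolynomial (σ ⊕ τ) ℂ) Unit :=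
  LinearMap.mk₂ (Polynomial ℂ) (fun p q => powerInl σ τ p * powerInr σ τ q)
    (fun p p' q => by rw [map_add, add_mul]) (fun c p q => by rw [powerInl_smul, smul_mul_assoc])
    (fun p q q' => by rw [map_add, mul_add]) (fun c p q => by rw [powerInr_smul, mul_smul_comm])

theorem powerMul_apply (p : PowerModule (MvPolynomial σ ℂ) Unit)
    (q : PowerModule (MvPolynomial τ ℂ) Unit) :
    powerMul σ τ p q = powerInl σ τ p * powerInr σ τ q := rfl

variable [Fintype σ] [Fintype τ]

/-- Products of elements of `D[s] · f ^ (s + 1)` and `D[s] · g ^ (s + 1)` lie in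
`D[s] · (f g) ^ (s + 1)`. -/
theorem mul_mem_powerSubmodule {f : MvPolynomial σ ℂ} (hf : f ≠ 0) {g : MvPolynomial τ ℂ}
    (hg : g ≠ 0) {p : PowerModule (MvPolynomial σ ℂ) Unit} (hp : p ∈ powerSubmodule f 1)
    {q : PowerModule (MvPolynomial τ ℂ) Unit} (hq : q ∈ powerSubmodule g 1) :
    powerInl σ τ p * powerInr σ τ q ∈ powerSubmodule (outerProduct f g) 1 := by
  have h1 : powerSubmodule g 1 ≤ (powerSubmodule (outerProduct f g) 1).comap
      (powerMul σ τ (algebraMap _ _ (f ^ 1))) := by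
    refine powerSubmodule_le ?_ (diffGen_mem_of_stable ?_ ?_)
    · rw [Submodule.mem_comap, powerMul_apply, powerInl_mul_powerInr_algebraMap]
      exact algebraMap_pow_mem_powerSubmodule _ _
    · intro i q hq
      rw [Submodule.mem_comap, powerMul_apply] at hq ⊢
      rw [← algebraMap_X_inr_mul]
      exact algebraMap_mul_mem_powerSubmodule _ hq
    · intro i q hq
      rw [Submodule.mem_comap, powerMul_apply] at hq ⊢
      rw [← connection_pderiv_inr hf]
      exact connection_mem_powerSubmodule _ hq
  have h2 : powerSubmodule f 1 ≤ (powerSubmodule (outerProduct f g) 1).comap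
      ((powerMul σ τ).flip q) := by
    refine powerSubmodule_le ?_ (diffGen_mem_of_stable ?_ ?_)
    · exact h1 hq
    · intro i p hp
      rw [Submodule.mem_comap, LinearMap.flip_apply, powerMul_apply] at hp ⊢
      rw [← algebraMap_X_inl_mul]
      exact algebraMap_mul_mem_powerSubmodule _ hp
    · intro i p hp
      rw [Submodule.mem_comap, LinearMap.flip_apply, powerMul_apply] at hp ⊢
      rw [← connection_pderiv_inl hg]
      exact connection_mem_powerSubmodule _ hp
  exact h2 hp

/-- Conversely, `D[s] · (f g) ^ (s + 1)` is spanned by such products. -/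
theorem powerSubmodule_outerProduct_le {f : MvPolynomial σ ℂ} (hf : f ≠ 0) {g : MvPolynomial τ ℂ}
    (hg : g ≠ 0) : powerSubmodule (outerProduct f g) 1 ≤ Submodule.span (Polynomial ℂ)
      {z | ∃ p ∈ powerSubmodule f 1, ∃ q ∈ powerSubmodule g 1,
        z = powerInl σ τ p * powerInr σ τ q} := by
  refine powerSubmodule_le ?_ (diffGen_mem_of_stable ?_ ?_)
  · exact Submodule.subset_span ⟨_, algebraMap_pow_mem_powerSubmodule f 1, _,
      algebraMap_pow_mem_powerSubmodule g 1, (powerInl_mul_powerInr_algebraMap f g).symm⟩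
  · intro n z hz
    induction hz using Submodule.span_induction with
    | zero => rw [mul_zero]; exact zero_mem _
    | add z w _ _ h1 h2 => rw [mul_add]; exact add_mem h1 h2
    | smul c z _ h => rw [mul_smul_comm]; exact Submodule.smul_mem _ c h
    | mem z h =>
      obtain ⟨p, hp, q, hq, rfl⟩ := h
      refine Submodule.subset_span ?_
      rcases n with i | i
      · exact ⟨_, algebraMap_mul_mem_powerSubmodule (X i) hp, q, hq, algebraMap_X_inl_mul i p q⟩
      · exact ⟨p, hp, _, algebraMap_mul_mem_powerSubmodule (X i) hq, algebraMap_X_inr_mul i p q⟩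
  · intro n z hz
    induction hz using Submodule.span_induction with
    | zero => rw [map_zero]; exact zero_mem _
    | add z w _ _ h1 h2 => rw [map_add]; exact add_mem h1 h2
    | smul c z _ h => rw [connection_smul]; exact Submodule.smul_mem _ c h
    | mem z h =>
      obtain ⟨p, hp, q, hq, rfl⟩ := h
      refine Submodule.subset_span ?_
      rcases n with i | i
      · exact ⟨_, connection_mem_powerSubmodule (pderiv i) hp, q, hq,
          connection_pderiv_inl hg i p q⟩
      · exact ⟨p, hp, _, connection_mem_powerSubmodule (pderiv i) hq,
          connection_pderiv_inr hf i p q⟩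

end Product

/-! ### Divisibility by linear factors in the exponent -/

section Independence

open MvPolynomial

attribute [local instance] MvPolynomial.algebraMvPolynomial in
/-- A finite family in `Frac(A)[s]` has a common denominator in `A`. -/
theorem exists_common_denominator {A I : Type*} [CommRing A] [Algebra ℂ A] [IsDomain A] [Finite I]
    (p : I → PowerModule A Unit) : ∃ a : A, a ≠ 0 ∧ ∃ q : I → MvPolynomial Unit A,
      ∀ i, algebraMap A _ a * p i = MvPolynomial.map (algebraMap A (FractionRing A)) (q i) := by
  obtain ⟨⟨d, a, ha, rfl⟩, hd⟩ := IsLocalization.exist_integer_multiples_of_finite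
    ((nonZeroDivisors A).map (C : A →+* MvPolynomial Unit A)) p
  choose q hq using hd
  refine ⟨a, nonZeroDivisors.ne_zero ha, q, fun i => ?_⟩
  have h1 := hq i
  rw [Algebra.smul_def] at h1
  have h2 : ∀ x : MvPolynomial Unit A, algebraMap (MvPolynomial Unit A) (PowerModule A Unit) x
      = MvPolynomial.map (algebraMap A (FractionRing A)) x := fun x => rfl
  rw [h2, h2] at h1
  rw [h1, algebraMap_powerModule]
  congr 1
  exact (MvPolynomial.map_C _ _).symm

/-- A finitely generated module in a torsion-free module over a principal ideal domain has a finite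
basis; here the coordinates of finitely many elements are spelled out. -/
theorem exists_linearIndependent_of_finite {R V : Type*} [CommRing R] [IsDomain R]
    [IsPrincipalIdealRing R] [AddCommGroup V] [Module R V] [Module.IsTorsionFree R V]
    (N : Submodule R V) {r : ℕ} (n : Fin r → V) (hn : ∀ i, n i ∈ N) :
    ∃ (d : ℕ) (e : Fin d → V) (c : Fin r → Fin d → R), (∀ k, e k ∈ N) ∧ LinearIndependent R e ∧
      ∀ i, n i = ∑ k, c i k • e k := by
  let N' : Submodule R V := Submodule.span R (Set.range n)
  have hN' : N' ≤ N := by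
    refine Submodule.span_le.2 ?_
    rintro _ ⟨i, rfl⟩
    exact hn i
  have : Module.Finite R N' := Module.Finite.iff_fg.2 (Submodule.fg_span (Set.finite_range _))
  obtain ⟨d, e⟩ := Module.basisOfFiniteTypeTorsionFree' (R := R) (M := N')
  have hn' : ∀ i, n i ∈ N' := fun i => Submodule.subset_span ⟨i, rfl⟩
  refine ⟨d, fun k => e k, fun i => e.repr ⟨n i, hn' i⟩, fun k => hN' (e k).2,
    e.linearIndependent.map' N'.subtype (Submodule.ker_subtype _), fun i => ?_⟩
  have := congrArg N'.subtype (e.sum_repr ⟨n i, hn' i⟩)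
  rw [map_sum] at this
  exact this.symm

theorem mapPower_map {A C : Type*} [CommRing A] [Algebra ℂ A] [IsDomain A] [CommRing C]
    [Algebra ℂ C] [IsDomain C] (φ : A →ₐ[ℂ] C) (hφ : Function.Injective φ)
    (x : MvPolynomial Unit A) :
    mapPower φ hφ (MvPolynomial.map (algebraMap A (FractionRing A)) x)
      = MvPolynomial.map (algebraMap C (FractionRing C)) (MvPolynomial.map (φ : A →+* C) x) := by
  rw [mapPower, MvPolynomial.map_map, MvPolynomial.map_map]
  congr 2
  exact RingHom.ext fun y => fractionMap_algebraMap hφ y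

/-- Polynomials in `s` with constant coefficients, viewed in `Frac(A)[s]`. -/
theorem map_algebraMap_complex {A : Type*} [CommRing A] [Algebra ℂ A]
    (x : MvPolynomial Unit ℂ) :
    MvPolynomial.map ((algebraMap A (FractionRing A)).comp (algebraMap ℂ A)) x
      = algebraMap (Polynomial ℂ) (PowerModule A Unit) (MvPolynomial.uniqueAlgEquiv ℂ Unit x) := by
  rw [exponent_algebraMap]
  induction x using MvPolynomial.induction_on with
  | C z =>
    have h1 : MvPolynomial.uniqueAlgEquiv ℂ Unit (C z) = Polynomial.C z :=
      (MvPolynomial.uniqueAlgEquiv ℂ Unit).commutes z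
    rw [MvPolynomial.map_C, h1, Polynomial.aeval_C, RingHom.comp_apply, ← algebraMap_powerModule,
      ← IsScalarTower.algebraMap_apply]
  | add x y hx hy => simp only [map_add, hx, hy]
  | mul_X x i hx =>
    have : MvPolynomial.uniqueAlgEquiv ℂ Unit (X i) = Polynomial.X :=
      MvPolynomial.eval₂_X _ _ i
    rw [map_mul, map_mul, map_mul, hx, MvPolynomial.map_X, this, Polynomial.aeval_X]

theorem algebraMap_powerModule_ne_zero {A : Type*} [CommRing A] [Algebra ℂ A] [IsDomain A] {a : A}
    (ha : a ≠ 0) : algebraMap A (PowerModule A Unit) a ≠ 0 :=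
  (map_ne_zero_iff _ algebraMap_powerModule_injective).2 ha

variable {σ τ : Type*}

/-- A family in `Frac(ℂ[y])[s]` that is independent over `ℂ[s]` remains independent over
`Frac(ℂ[x])[s]` in `Frac(ℂ[x, y])[s]`. After denominators have been cleared, this is seen by
evaluating the coefficients at the points of the affine space with coordinates `x`. -/
theorem eq_zero_of_sum_powerInl_mul_powerInr {I : Type*} [Fintype I]
    {e : I → PowerModule (MvPolynomial τ ℂ) Unit} (he : LinearIndependent (Polynomial ℂ) e)
    {p : I → PowerModule (MvPolynomial σ ℂ) Unit}
    (h : ∑ k, powerInl σ τ (p k) * powerInr σ τ (e k) = 0) (k : I) : p k = 0 := by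
  obtain ⟨a, ha, q, hq⟩ := exists_common_denominator p
  obtain ⟨b, hb, r, hr⟩ := exists_common_denominator e
  -- the relation, with polynomial entries
  have h1 : ∑ k, MvPolynomial.map ((rename Sum.inl : MvPolynomial σ ℂ →ₐ[ℂ]
        MvPolynomial (σ ⊕ τ) ℂ) : MvPolynomial σ ℂ →+* MvPolynomial (σ ⊕ τ) ℂ) (q k) *
      MvPolynomial.map ((rename Sum.inr : MvPolynomial τ ℂ →ₐ[ℂ]
        MvPolynomial (σ ⊕ τ) ℂ) : MvPolynomial τ ℂ →+* MvPolynomial (σ ⊕ τ) ℂ) (r k) = 0 := by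
    refine MvPolynomial.map_injective _ (IsFractionRing.injective (MvPolynomial (σ ⊕ τ) ℂ)
      (FractionRing (MvPolynomial (σ ⊕ τ) ℂ))) ?_
    rw [map_zero, map_sum]
    have h2 : ∀ k, powerInl σ τ (algebraMap _ _ a * p k) * powerInr σ τ (algebraMap _ _ b * e k)
        = (powerInl σ τ (algebraMap _ _ a) * powerInr σ τ (algebraMap _ _ b)) *
          (powerInl σ τ (p k) * powerInr σ τ (e k)) := by
      intro k
      rw [map_mul, map_mul]
      ring
    rw [← mul_zero (powerInl σ τ (algebraMap _ _ a) * powerInr σ τ (algebraMap _ _ b)), ← h,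
      Finset.mul_sum]
    refine Finset.sum_congr rfl fun k _ => ?_
    rw [← h2, hq, hr, powerInl, powerInr, mapPower_map, mapPower_map, map_mul]
  -- the coefficients vanish at every point
  have h3 : ∀ (ξ : σ → ℂ) (k : I), MvPolynomial.map (MvPolynomial.eval ξ) (q k) = 0 := by
    intro ξ
    let ev : MvPolynomial (σ ⊕ τ) ℂ →ₐ[ℂ] MvPolynomial τ ℂ :=
      aeval (Sum.elim (fun i => C (ξ i)) X)
    have hl : (ev : MvPolynomial (σ ⊕ τ) ℂ →+* MvPolynomial τ ℂ).comp
        (rename Sum.inl : MvPolynomial σ ℂ →ₐ[ℂ] MvPolynomial (σ ⊕ τ) ℂ)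
        = (algebraMap ℂ (MvPolynomial τ ℂ)).comp (MvPolynomial.eval ξ) := by
      apply MvPolynomial.ringHom_ext
      · intro c; simp [ev]
      · intro i; simp [ev]
    have hr' : (ev : MvPolynomial (σ ⊕ τ) ℂ →+* MvPolynomial τ ℂ).comp
        (rename Sum.inr : MvPolynomial τ ℂ →ₐ[ℂ] MvPolynomial (σ ⊕ τ) ℂ) = RingHom.id _ := by
      apply MvPolynomial.ringHom_ext
      · intro c; simp [ev]
      · intro i; simp [ev]
    have h4 := congrArg (MvPolynomial.map (ev : MvPolynomial (σ ⊕ τ) ℂ →+* MvPolynomial τ ℂ)) h1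
    simp only [map_sum, map_mul, MvPolynomial.map_map, map_zero] at h4
    rw [hl, hr'] at h4
    have h5 := congrArg (MvPolynomial.map (algebraMap (MvPolynomial τ ℂ)
      (FractionRing (MvPolynomial τ ℂ)))) h4
    simp only [map_sum, map_mul, MvPolynomial.map_map, map_zero, RingHom.comp_id] at h5
    -- the coefficients as polynomials in `s`
    let c : I → Polynomial ℂ := fun k =>
      MvPolynomial.uniqueAlgEquiv ℂ Unit (MvPolynomial.map (MvPolynomial.eval ξ) (q k))
    have hc : ∀ k, MvPolynomial.map ((algebraMap (MvPolynomial τ ℂ)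
        (FractionRing (MvPolynomial τ ℂ))).comp ((algebraMap ℂ (MvPolynomial τ ℂ)).comp
          (MvPolynomial.eval ξ))) (q k)
        = algebraMap (Polynomial ℂ) (PowerModule (MvPolynomial τ ℂ) Unit) (c k) := by
      intro k
      rw [← map_algebraMap_complex, ← RingHom.comp_assoc, ← MvPolynomial.map_map]
    have h6 : algebraMap (MvPolynomial τ ℂ) (PowerModule (MvPolynomial τ ℂ) Unit) b
        * ∑ k, c k • e k = 0 := by
      rw [← h5, Finset.mul_sum]
      refine Finset.sum_congr rfl fun k _ => ?_
      rw [hc, ← hr, Algebra.smul_def]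
      ring
    have h7 : ∑ k, c k • e k = 0 := by
      exact (mul_eq_zero.1 h6).resolve_left (algebraMap_powerModule_ne_zero hb)
    intro k
    have h8 := Fintype.linearIndependent_iff.1 he c h7 k
    exact (map_eq_zero_iff _ (MvPolynomial.uniqueAlgEquiv ℂ Unit).injective).1 h8
  have h9 : q k = 0 := by
    ext1 n
    refine MvPolynomial.funext fun ξ => ?_
    have := congrArg (coeff n) (h3 ξ k)
    rwa [MvPolynomial.coeff_map, coeff_zero] at this
  have h10 := hq k
  rw [h9, map_zero] at h10
  exact (mul_eq_zero.1 h10).resolve_left (algebraMap_powerModule_ne_zero ha)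

/-- If a product `u · v` in disjoint sets of variables is divisible by `s - l` in the span of
`M · N`, then `u` is divisible by `s - l` in `M` or `v` is so in `N`. -/
theorem exists_eq_smul_of_powerMul_eq_smul
    {M : Submodule (Polynomial ℂ) (PowerModule (MvPolynomial σ ℂ) Unit)}
    {N : Submodule (Polynomial ℂ) (PowerModule (MvPolynomial τ ℂ) Unit)}
    {u : PowerModule (MvPolynomial σ ℂ) Unit} (hu : u ∈ M)
    {v : PowerModule (MvPolynomial τ ℂ) Unit} (hv : v ∈ N) (l : ℂ)
    {w : PowerModule (MvPolynomial (σ ⊕ τ) ℂ) Unit}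
    (hw : w ∈ Submodule.span (Polynomial ℂ)
      {z | ∃ p ∈ M, ∃ q ∈ N, z = powerInl σ τ p * powerInr σ τ q})
    (h : powerInl σ τ u * powerInr σ τ v = (Polynomial.X - Polynomial.C l) • w) :
    (∃ m ∈ M, u = (Polynomial.X - Polynomial.C l) • m) ∨
      ∃ n ∈ N, v = (Polynomial.X - Polynomial.C l) • n := by
  -- `w` is a finite sum of products
  obtain ⟨r, m, n, hw'⟩ : ∃ (r : ℕ) (m : Fin r → M) (n : Fin r → N),
      w = ∑ i, powerInl σ τ (m i) * powerInr σ τ (n i) := by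
    rw [Submodule.mem_span_set'] at hw
    obtain ⟨r, c, z, rfl⟩ := hw
    choose p hp q hq hz using fun i => (z i).2
    refine ⟨r, fun i => ⟨c i • p i, M.smul_mem _ (hp i)⟩, fun i => ⟨q i, hq i⟩, ?_⟩
    refine Finset.sum_congr rfl fun i _ => ?_
    rw [hz i, powerInl_smul, smul_mul_assoc]
  -- coordinates of `v` and of the entries from `N` with respect to an independent family
  obtain ⟨d, e, c, heN, he, hc⟩ := exists_linearIndependent_of_finite N
    (Fin.cons v fun i => (n i : PowerModule (MvPolynomial τ ℂ) Unit) : Fin (r + 1) → _)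
    (Fin.cases hv fun i => (n i).2)
  have hcv : v = ∑ k, c 0 k • e k := hc 0
  have hcn : ∀ i, (n i : PowerModule (MvPolynomial τ ℂ) Unit) = ∑ k, c i.succ k • e k :=
    fun i => hc i.succ
  have key : ∀ k, c 0 k • u - (Polynomial.X - Polynomial.C l) •
      ∑ i, c (Fin.succ i) k • (m i : PowerModule (MvPolynomial σ ℂ) Unit) = 0 := by
    refine eq_zero_of_sum_powerInl_mul_powerInr he ?_
    have h1 : powerInl σ τ u * powerInr σ τ v
        = ∑ k, powerInl σ τ (c 0 k • u) * powerInr σ τ (e k) := by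
      rw [hcv, map_sum, Finset.mul_sum]
      refine Finset.sum_congr rfl fun k _ => ?_
      rw [powerInl_smul, powerInr_smul, smul_mul_assoc, mul_smul_comm]
    have h2 : w = ∑ k, powerInl σ τ (∑ i, c (Fin.succ i) k •
        (m i : PowerModule (MvPolynomial σ ℂ) Unit)) * powerInr σ τ (e k) := by
      simp only [map_sum, Finset.sum_mul]
      rw [hw', Finset.sum_comm]
      refine Finset.sum_congr rfl fun i _ => ?_
      rw [hcn i, map_sum, Finset.mul_sum]
      refine Finset.sum_congr rfl fun k _ => ?_
      rw [powerInl_smul, powerInr_smul, smul_mul_assoc, mul_smul_comm]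
    simp only [map_sub, sub_mul, Finset.sum_sub_distrib]
    rw [← h1, h, h2, Finset.smul_sum, ← Finset.sum_sub_distrib]
    refine Finset.sum_eq_zero fun k _ => ?_
    rw [powerInl_smul, smul_mul_assoc, sub_self]
  by_cases hdvd : ∀ k, Polynomial.X - Polynomial.C l ∣ c 0 k
  · right
    choose q hq using hdvd
    refine ⟨∑ k, q k • e k, sum_mem fun k _ => N.smul_mem _ (heN k), ?_⟩
    rw [Finset.smul_sum, hcv]
    refine Finset.sum_congr rfl fun k _ => ?_
    rw [hq k, mul_smul]
  · left
    push Not at hdvd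
    obtain ⟨k, hk⟩ := hdvd
    -- the coordinate `c 0 k` is a nonzero constant modulo `s - l`
    have h0 : (c 0 k).eval l ≠ 0 := fun h0 => hk (Polynomial.dvd_iff_isRoot.2 h0)
    obtain ⟨q, hq⟩ := Polynomial.X_sub_C_dvd_sub_C_eval (a := l) (p := c 0 k)
    refine ⟨((c 0 k).eval l)⁻¹ • (∑ i, c (Fin.succ i) k •
      (m i : PowerModule (MvPolynomial σ ℂ) Unit) - q • u),
      Submodule.smul_of_tower_mem M _ (sub_mem (sum_mem fun i _ => M.smul_mem _ (m i).2)
        (M.smul_mem _ hu)), ?_⟩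
    have h1 : ((c 0 k).eval l) • u = (Polynomial.X - Polynomial.C l) •
        (∑ i, c (Fin.succ i) k • (m i : PowerModule (MvPolynomial σ ℂ) Unit) - q • u) := by
      rw [smul_sub, ← sub_eq_zero.1 (key k), smul_smul, ← hq, sub_smul, sub_sub_cancel,
        ← Polynomial.algebraMap_eq, algebraMap_smul]
    rw [smul_comm, ← h1, smul_smul, inv_mul_cancel₀ h0, one_smul]

end Independence

section ProductFormula

variable {A : Type*} [CommRing A] [Algebra ℂ A] [IsDomain A]

/-- For a generator `b` of the ideal of `g`, the element `b (s) g ^ s` of `D[s] · g ^ (s + 1)` is not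
divisible by any `s - l` there. -/
theorem smul_one_ne_smul {g : A} {b : Polynomial ℂ} (hb : b ≠ 0)
    (hbg : bernsteinIdeal g = Ideal.span {b}) (l : ℂ) {m : PowerModule A Unit}
    (hm : m ∈ powerSubmodule g 1) :
    b • (1 : PowerModule A Unit) ≠ (Polynomial.X - Polynomial.C l) • m := by
  intro h
  have h1 : b.eval l = 0 := by
    have h2 := congrArg (MvPolynomial.aeval fun _ : Unit => algebraMap ℂ (FractionRing A) l) h
    rw [exponent_smul_def, exponent_smul_def, mul_one, map_mul] at h2
    have h3 : ∀ c : Polynomial ℂ, MvPolynomial.aeval (fun _ : Unit =>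
        algebraMap ℂ (FractionRing A) l) (Polynomial.aeval (MvPolynomial.X () :
          PowerModule A Unit) c) = algebraMap ℂ (FractionRing A) (c.eval l) := by
      intro c
      have h4 := Polynomial.aeval_algHom_apply (((MvPolynomial.aeval fun _ : Unit =>
        algebraMap ℂ (FractionRing A) l) :
          PowerModule A Unit →ₐ[FractionRing A] FractionRing A).restrictScalars ℂ)
            (MvPolynomial.X ()) c
      rw [AlgHom.restrictScalars_apply, AlgHom.restrictScalars_apply, MvPolynomial.aeval_X,
        Polynomial.aeval_algebraMap_apply, Polynomial.coe_aeval_eq_eval] at h4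
      exact h4.symm
    rw [h3, h3] at h2
    simp only [Polynomial.eval_sub, Polynomial.eval_X, Polynomial.eval_C, sub_self, map_zero,
      zero_mul] at h2
    exact (map_eq_zero_iff _ (algebraMap ℂ (FractionRing A)).injective).1 h2
  obtain ⟨c, rfl⟩ := Polynomial.dvd_iff_isRoot.2 h1
  have hl : (Polynomial.X - Polynomial.C l : Polynomial ℂ) ≠ 0 := Polynomial.X_sub_C_ne_zero l
  rw [mul_smul] at h
  have h5 := smul_right_injective (PowerModule A Unit) hl h
  have h6 : c ∈ bernsteinIdeal g := by
    rw [mem_bernsteinIdeal, elementEquation_iff_smul_one_mem]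
    rw [show c • (1 : PowerModule A Unit) = m from h5]
    exact hm
  rw [hbg, Ideal.mem_span_singleton] at h6
  have hc : c ≠ 0 := right_ne_zero_of_mul hb
  have h7 := Polynomial.natDegree_le_of_dvd h6 hc
  rw [Polynomial.natDegree_mul hl hc, Polynomial.natDegree_X_sub_C] at h7
  omega

/-- The Bernstein-Sato polynomial is multiplicative for products of polynomials in disjoint sets of
variables. -/
theorem bernsteinIdeal_outerProduct {σ τ : Type*} [Fintype σ] [Fintype τ]
    {f : MvPolynomial σ ℂ} (hf : f ≠ 0) {g : MvPolynomial τ ℂ} (hg : g ≠ 0)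
    {b c : Polynomial ℂ} (hb : b ≠ 0) (hc : c ≠ 0)
    (hbf : bernsteinIdeal f = Ideal.span {b}) (hcg : bernsteinIdeal g = Ideal.span {c}) :
    bernsteinIdeal (outerProduct f g) = Ideal.span {b * c} := by
  have hbM : b • (1 : PowerModule (MvPolynomial σ ℂ) Unit) ∈ powerSubmodule f 1 := by
    rw [← elementEquation_iff_smul_one_mem, ← mem_bernsteinIdeal, hbf]
    exact Ideal.mem_span_singleton_self b
  have hcN : c • (1 : PowerModule (MvPolynomial τ ℂ) Unit) ∈ powerSubmodule g 1 := by
    rw [← elementEquation_iff_smul_one_mem, ← mem_bernsteinIdeal, hcg]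
    exact Ideal.mem_span_singleton_self c
  have hprod : powerInl σ τ (b • 1) * powerInr σ τ (c • 1)
      = (b * c) • (1 : PowerModule (MvPolynomial (σ ⊕ τ) ℂ) Unit) := by
    rw [powerInl_smul, powerInr_smul, map_one, map_one, smul_mul_smul_comm, mul_one]
  have hle : b * c ∈ bernsteinIdeal (outerProduct f g) := by
    rw [mem_bernsteinIdeal, elementEquation_iff_smul_one_mem, ← hprod]
    exact mul_mem_powerSubmodule hf hg hbM hcN
  obtain ⟨d, hd⟩ := (IsPrincipalIdealRing.principal (bernsteinIdeal (outerProduct f g))).principal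
  rw [hd] at hle ⊢
  -- the quotient `q` of `b c` by the generator `d` has to be constant
  obtain ⟨q, hq⟩ := Ideal.mem_span_singleton.1 hle
  have hq0 : q ≠ 0 := right_ne_zero_of_mul (hq ▸ mul_ne_zero hb hc)
  by_cases hqu : IsUnit q
  · exact (Ideal.span_singleton_eq_span_singleton.2 ⟨hqu.unit, hq.symm⟩)
  · -- a linear factor `s - l` of `q` would divide `b f ^ s` or `c g ^ s` in the respective module
    exfalso
    obtain ⟨l, hl⟩ := Complex.exists_root (f := q)
      (Polynomial.degree_pos_of_ne_zero_of_nonunit hq0 hqu)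
    obtain ⟨q', rfl⟩ := Polynomial.dvd_iff_isRoot.2 hl
    have hdW : (q' * d) • (1 : PowerModule (MvPolynomial (σ ⊕ τ) ℂ) Unit) ∈
        powerSubmodule (outerProduct f g) 1 := by
      rw [← elementEquation_iff_smul_one_mem, ← mem_bernsteinIdeal, hd]
      exact Ideal.mul_mem_left _ _ (Ideal.mem_span_singleton_self d)
    have h := exists_eq_smul_of_powerMul_eq_smul hbM hcN l
      (powerSubmodule_outerProduct_le hf hg hdW) (by
        rw [hprod, hq, smul_smul]
        congr 1
        ring)
    rcases h with ⟨m, hm, h⟩ | ⟨n, hn, h⟩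
    · exact smul_one_ne_smul hb hbf l hm h
    · exact smul_one_ne_smul hc hcg l hn h

end ProductFormula

/-! ### Bernstein's inequality -/

section Weyl

open MvPolynomial

variable {K V σ : Type*} [CommRing K] [AddCommGroup V] [Module K V]

open scoped IsMulCommutative in
/-- Commuting elements of an algebra can be substituted for the variables of a polynomial. -/
theorem exists_algHom_of_commute {R E I : Type*} [CommRing R] [Ring E] [Algebra R E] (t : I → E)
    (h : ∀ i j, t i * t j = t j * t i) : ∃ ρ : MvPolynomial I R →ₐ[R] E, ∀ i, ρ (X i) = t i := by
  have := Algebra.isMulCommutative_adjoin R (s := Set.range t) (by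
    rintro _ ⟨i, rfl⟩ _ ⟨j, rfl⟩
    exact h i j)
  let τ : I → Algebra.adjoin R (Set.range t) := fun i => ⟨t i, Algebra.subset_adjoin ⟨i, rfl⟩⟩
  refine ⟨(Algebra.adjoin R (Set.range t)).val.comp (aeval τ), fun i => ?_⟩
  rw [AlgHom.comp_apply, aeval_X]
  rfl

/-- Linear operators `x i` and `d i` that satisfy the relations of the Weyl algebra. -/
structure IsWeylAction [DecidableEq σ] (x d : σ → Module.End K V) : Prop where
  comm_x : ∀ i j, x i * x j = x j * x i
  comm_d : ∀ i j, d i * d j = d j * d i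
  d_mul_x : ∀ i j, d i * x j = x j * d i + if i = j then 1 else 0

namespace IsWeylAction

variable [DecidableEq σ] {x d : σ → Module.End K V}

/-- The symbol calculus: a polynomial in the variables `inl i` and `inr i` is sent to the operator
in which `x i` and `d i` are substituted, the `x i` being written to the left. The two commutators
are then given by partial derivatives of the symbol. -/
theorem exists_normalOrder (h : IsWeylAction x d) :
    ∃ P : MvPolynomial (σ ⊕ σ) K →ₗ[K] Module.End K V, P 1 = 1 ∧
      (∀ q i, P (q * X (.inl i)) = x i * P q) ∧ (∀ q i, P (q * X (.inr i)) = P q * d i) ∧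
      (∀ q i, d i * P q = P q * d i + P (pderiv (.inl i) q)) ∧
      ∀ q i, P q * x i = x i * P q + P (pderiv (.inr i) q) := by
  -- the left multiplications by `x i` and the right multiplications by `d i` commute
  obtain ⟨ρ, hρ⟩ := exists_algHom_of_commute (R := K) (E := Module.End K (Module.End K V))
    (Sum.elim (fun i => LinearMap.mulLeft K (x i)) fun i => LinearMap.mulRight K (d i)) (by
      rintro (i | i) (j | j) <;> refine LinearMap.ext fun u => ?_
      · change x i * (x j * u) = x j * (x i * u)
        rw [← mul_assoc, h.comm_x, mul_assoc]
      · exact (mul_assoc _ _ _).symm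
      · exact mul_assoc _ _ _
      · change u * d j * d i = u * d i * d j
        rw [mul_assoc, h.comm_d, mul_assoc])
  let P : MvPolynomial (σ ⊕ σ) K →ₗ[K] Module.End K V :=
    (LinearMap.applyₗ (1 : Module.End K V)).comp ρ.toLinearMap
  have hP : ∀ q, P q = ρ q 1 := fun q => rfl
  have h1 : P 1 = 1 := by rw [hP, map_one ρ, Module.End.one_apply]
  have hl : ∀ q i, P (q * X (.inl i)) = x i * P q := by
    intro q i
    rw [hP, mul_comm, map_mul, hρ]
    rfl
  have hr : ∀ q i, P (q * X (.inr i)) = P q * d i := by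
    intro q i
    rw [hP, mul_comm, map_mul, hρ]
    rfl
  have hC : ∀ a : K, P (C a) = a • 1 := by
    intro a
    rw [C_eq_smul_one, map_smul, h1]
  refine ⟨P, h1, hl, hr, fun q i => ?_, fun q i => ?_⟩
  · induction q using MvPolynomial.induction_on with
    | C a => rw [hC, pderiv_C, map_zero, add_zero, mul_smul_comm, smul_mul_assoc, one_mul, mul_one]
    | add p q hp hq => rw [map_add, map_add, map_add, mul_add, add_mul, hp, hq]; abel
    | mul_X q j hq =>
      rw [pderiv_mul]
      rcases j with j | j
      · rw [hl, ← mul_assoc, h.d_mul_x, add_mul, mul_assoc, hq, map_add, hl, pderiv_X, mul_add,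
          mul_assoc]
        by_cases hij : i = j
        · subst hij
          rw [if_pos rfl, Pi.single_eq_same, mul_one, one_mul, add_assoc]
        · rw [if_neg hij, Pi.single_eq_of_ne (by simpa using Ne.symm hij), mul_zero, zero_mul,
            map_zero, add_assoc]
      · rw [hr, ← mul_assoc, hq, add_mul, map_add, hr, pderiv_X_of_ne (by simp), mul_zero, map_zero,
          add_zero, mul_assoc, h.comm_d, mul_assoc]
  · induction q using MvPolynomial.induction_on with
    | C a => rw [hC, pderiv_C, map_zero, add_zero, mul_smul_comm, smul_mul_assoc, one_mul, mul_one]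
    | add p q hp hq => rw [map_add, map_add, map_add, mul_add, add_mul, hp, hq]; abel
    | mul_X q j hq =>
      rw [pderiv_mul]
      rcases j with j | j
      · rw [hl, mul_assoc, hq, mul_add, map_add, hl, pderiv_X_of_ne (by simp), mul_zero, map_zero,
          add_zero, ← mul_assoc, h.comm_x, mul_assoc]
      · rw [hr, mul_assoc, h.d_mul_x, mul_add, ← mul_assoc, hq, map_add, hr, add_mul, pderiv_X,
          mul_assoc]
        by_cases hij : j = i
        · subst hij
          rw [if_pos rfl, Pi.single_eq_same, mul_one, mul_one, add_assoc]
        · rw [if_neg hij, Pi.single_eq_of_ne (by simpa using hij), mul_zero, mul_zero, map_zero,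
            add_assoc]

end IsWeylAction

theorem IsWeylAction.baseChange [DecidableEq σ] {x d : σ → Module.End K V} (h : IsWeylAction x d)
    (L : Type*) [CommRing L] [Algebra K L] :
    IsWeylAction (fun i => (x i).baseChange L) fun i => (d i).baseChange L := by
  refine ⟨fun i j => ?_, fun i j => ?_, fun i j => ?_⟩
  · rw [← LinearMap.baseChange_mul, h.comm_x, LinearMap.baseChange_mul]
  · rw [← LinearMap.baseChange_mul, h.comm_d, LinearMap.baseChange_mul]
  · rw [← LinearMap.baseChange_mul, h.d_mul_x, LinearMap.baseChange_add, LinearMap.baseChange_mul]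
    split_ifs
    · rw [LinearMap.baseChange_one]
    · rw [LinearMap.baseChange_zero]

end Weyl

section Field

open MvPolynomial

variable {K V σ : Type*} [Field K] [AddCommGroup V] [Module K V]

theorem totalDegree_pderiv_le {I : Type*} {q : MvPolynomial I K} {N : ℕ}
    (h : q.totalDegree ≤ N + 1) (i : I) : (pderiv i q).totalDegree ≤ N := by
  classical
  refine Finset.sup_le fun m hm => ?_
  rw [mem_support_iff, coeff_pderiv] at hm
  have h1 := (le_totalDegree (mem_support_iff.2 (left_ne_zero_of_mul hm))).trans h
  rw [Finsupp.sum_add_index' (fun _ => rfl) (fun _ _ _ => rfl), Finsupp.sum_single_index rfl] at h1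
  omega

theorem eq_C_of_pderiv_eq_zero [CharZero K] {I : Type*} {q : MvPolynomial I K}
    (h : ∀ i, pderiv i q = 0) : q = C (coeff 0 q) := by
  classical
  ext m
  rw [coeff_C]
  split_ifs with hm
  · rw [hm]
  · obtain ⟨i, hi⟩ := Finsupp.ne_iff.1 (Ne.symm hm)
    rw [Finsupp.zero_apply] at hi
    have h1 := congrArg (coeff (m - Finsupp.single i 1)) (h i)
    rw [coeff_pderiv, coeff_zero, tsub_add_cancel_of_le
      (Finsupp.single_le_iff.2 (Nat.one_le_iff_ne_zero.2 hi))] at h1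
    exact (mul_eq_zero.1 h1).resolve_right (Nat.cast_add_one_ne_zero _)

/-- **Bernstein's inequality**: a nonzero module over the Weyl algebra in `n` pairs of variables has
dimension at least `n`, in the sense that the ranks of a filtration that is compatible with the
Bernstein filtration grow at least as a polynomial of degree `n`. The normally ordered operators of
degree at most `N` act injectively on a sufficiently late step of the filtration, since a
commutator with a variable or a derivative lowers the degree. -/
theorem IsWeylAction.pow_le_finrank [CharZero K] [Fintype σ] [DecidableEq σ]
    {x d : σ → Module.End K V} (h : IsWeylAction x d) {Q : ℕ → Submodule K V} (hQ : Monotone Q)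
    [∀ k, FiniteDimensional K (Q k)] (hx : ∀ i k, ∀ v ∈ Q k, x i v ∈ Q (k + 1))
    (hd : ∀ i k, ∀ v ∈ Q k, d i v ∈ Q (k + 1)) {k₀ : ℕ} {v : V} (hv : v ∈ Q k₀) (hv0 : v ≠ 0)
    (m : ℕ) :
    (m + 1) ^ Fintype.card σ ≤ Module.finrank K (Q (4 * Fintype.card σ * m + k₀)) := by
  obtain ⟨P, h1, hl, hr, hdP, hPx⟩ := h.exists_normalOrder
  -- operators that vanish on a late step vanish
  have hzero : ∀ N (q : MvPolynomial (σ ⊕ σ) K), q.totalDegree ≤ N →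
      (∀ u ∈ Q (N + k₀), P q u = 0) → q = 0 := by
    have hC : ∀ a : K, P (C a) v = 0 → (C a : MvPolynomial (σ ⊕ σ) K) = 0 := by
      intro a ha
      rw [C_eq_smul_one, map_smul, h1, LinearMap.smul_apply, Module.End.one_apply] at ha
      rw [(smul_eq_zero.1 ha).resolve_right hv0, C_0]
    intro N
    induction N with
    | zero =>
      intro q hq hu
      rw [totalDegree_eq_zero_iff_eq_C.1 (Nat.le_zero.1 hq)] at hu ⊢
      exact hC _ (hu v (by rwa [zero_add]))
    | succ N ih =>
      intro q hq hu
      have hu' : ∀ u ∈ Q (N + k₀), P q u = 0 := fun u h => hu u (hQ (by omega) h)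
      have h2 : q = C (coeff 0 q) := by
        refine eq_C_of_pderiv_eq_zero fun j => ih _ (totalDegree_pderiv_le hq j) fun u hu1 => ?_
        rcases j with i | i
        · have h3 := LinearMap.congr_fun (hdP q i) u
          rw [LinearMap.add_apply, Module.End.mul_apply, Module.End.mul_apply, hu' u hu1, map_zero,
            hu _ (by rw [add_right_comm]; exact hd i _ u hu1), zero_add] at h3
          exact h3.symm
        · have h3 := LinearMap.congr_fun (hPx q i) u
          rw [LinearMap.add_apply, Module.End.mul_apply, Module.End.mul_apply, hu' u hu1, map_zero,
            hu _ (by rw [add_right_comm]; exact hx i _ u hu1), zero_add] at h3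
          exact h3.symm
      rw [h2] at hu ⊢
      exact hC _ (hu v (hQ (by omega) hv))
  -- the monomials of degree at most `m` in each of the variables
  let e : (σ ⊕ σ → Fin (m + 1)) → MvPolynomial (σ ⊕ σ) K := fun α => ∏ j, X j ^ (α j : ℕ)
  set n := Fintype.card σ
  have he : LinearIndependent K e := by
    have h2 := (basisMonomials (σ ⊕ σ) K).linearIndependent.comp
      (fun α : σ ⊕ σ → Fin (m + 1) => Finsupp.equivFunOnFinite.symm fun j => (α j : ℕ)) (by
        intro α β hαβ
        funext j
        exact Fin.ext (congrFun (Finsupp.equivFunOnFinite.symm.injective hαβ) j))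
    have h3 : (basisMonomials (σ ⊕ σ) K) ∘ (fun α : σ ⊕ σ → Fin (m + 1) =>
        Finsupp.equivFunOnFinite.symm fun j => (α j : ℕ)) = e := by
      funext α
      rw [Function.comp_apply, coe_basisMonomials]
      change monomial _ 1 = _
      rw [monomial_eq, C_1, one_mul,
        Finsupp.prod_fintype _ _ (fun _ => pow_zero _)]
      rfl
    rwa [h3] at h2
  have hsum : ∀ α : σ ⊕ σ → Fin (m + 1), ∑ j, (α j : ℕ) ≤ 2 * n * m := by
    intro α
    refine (Finset.sum_le_card_nsmul _ _ m fun j _ => Nat.lt_succ_iff.1 (α j).2).trans ?_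
    rw [Finset.card_univ, Fintype.card_sum, smul_eq_mul, ← two_mul]
  have hdeg : ∀ α, (e α).totalDegree ≤ 2 * n * m := by
    intro α
    refine ((totalDegree_finsetProd _ _).trans (Finset.sum_le_sum fun j _ => ?_)).trans (hsum α)
    rw [totalDegree_X_pow]
  have hgrow : ∀ (a : ℕ) (q : MvPolynomial (σ ⊕ σ) K), (∀ k, ∀ u ∈ Q k, P q u ∈ Q (k + a)) →
      ∀ j, ∀ k, ∀ u ∈ Q k, P (q * X j) u ∈ Q (k + (a + 1)) := by
    rintro a q hq (i | i) k u hu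
    · rw [hl]
      exact hx i _ _ (hq k u hu)
    · rw [hr, add_comm a, ← add_assoc]
      exact hq _ _ (hd i k u hu)
  have hgrow' : ∀ (a : ℕ) (q : MvPolynomial (σ ⊕ σ) K), (∀ k, ∀ u ∈ Q k, P q u ∈ Q (k + a)) →
      ∀ j b, ∀ k, ∀ u ∈ Q k, P (q * X j ^ b) u ∈ Q (k + (a + b)) := by
    intro a q hq j b
    induction b with
    | zero => simpa using hq
    | succ b ih =>
      rw [pow_succ, ← mul_assoc, ← add_assoc]
      exact hgrow _ _ ih j
  have hmap : ∀ α k, ∀ u ∈ Q k, P (e α) u ∈ Q (k + 2 * n * m) := by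
    intro α k u hu
    have h2 : ∀ s : Finset (σ ⊕ σ), ∀ k, ∀ u ∈ Q k,
        P (∏ j ∈ s, X j ^ (α j : ℕ)) u ∈ Q (k + ∑ j ∈ s, (α j : ℕ)) := by
      intro s
      induction s using Finset.induction_on with
      | empty => intro k u hu; rwa [Finset.prod_empty, Finset.sum_empty, h1]
      | insert j s hj ih =>
        rw [Finset.prod_insert hj, Finset.sum_insert hj, mul_comm, add_comm (α j : ℕ)]
        exact hgrow' _ _ ih j _
    exact hQ (Nat.add_le_add_left (hsum α) k) (h2 Finset.univ k u hu)
  -- they act as independent maps between two steps of the filtration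
  let T : (σ ⊕ σ → Fin (m + 1)) → Q (2 * n * m + k₀) →ₗ[K] Q (4 * n * m + k₀) := fun α =>
    (P (e α)).restrict fun u hu => by
      have := hmap α _ u hu
      rwa [show 2 * n * m + k₀ + 2 * n * m = 4 * n * m + k₀ by ring] at this
  have hT : LinearIndependent K T := by
    rw [Fintype.linearIndependent_iff]
    intro c hc
    refine Fintype.linearIndependent_iff.1 he c (hzero (2 * n * m) _ ?_ fun u hu => ?_)
    · exact totalDegree_finsetSum_le fun α _ => (totalDegree_smul_le _ _).trans (hdeg α)
    · have h2 := congrArg (Subtype.val) (LinearMap.congr_fun hc ⟨u, hu⟩)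
      rw [LinearMap.sum_apply, AddSubmonoidClass.coe_finsetSum] at h2
      rw [map_sum, LinearMap.sum_apply]
      refine Eq.trans (Finset.sum_congr rfl fun α _ => ?_) h2
      rw [map_smul]
      rfl
  have hcard := hT.fintype_card_le_finrank
  rw [Module.finrank_linearMap, Fintype.card_fun, Fintype.card_sum, Fintype.card_fin, pow_add]
    at hcard
  have hle : Module.finrank K (Q (2 * n * m + k₀)) ≤ Module.finrank K (Q (4 * n * m + k₀)) :=
    Submodule.finrank_mono (hQ (by gcongr; norm_num))
  exact Nat.mul_self_le_mul_self_iff.1 (hcard.trans (Nat.mul_le_mul_right _ hle))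

/-- Holonomic modules have finite length: in a module over the Weyl algebra with a filtration of
growth of degree at most `n`, a descending chain of submodules contains only a bounded number of
proper inclusions. -/
theorem IsWeylAction.exists_mem_of_antitone [CharZero K] [Fintype σ] [DecidableEq σ]
    {x d : σ → Module.End K V} (h : IsWeylAction x d) {F : ℕ → Submodule K V} (hF : Monotone F)
    [∀ k, FiniteDimensional K (F k)] (hx : ∀ i k, ∀ v ∈ F k, x i v ∈ F (k + 1))
    (hd : ∀ i k, ∀ v ∈ F k, d i v ∈ F (k + 1)) (c : ℕ)
    (hc : ∀ k, Module.finrank K (F k) ≤ c * (k + 1) ^ Fintype.card σ)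
    {N : ℕ → Submodule K V} (hN : Antitone N) (hNx : ∀ i j, ∀ v ∈ N j, x i v ∈ N j)
    (hNd : ∀ i j, ∀ v ∈ N j, d i v ∈ N j) {v : ℕ → V} (hv : ∀ j, v j ∈ N j) {κ : ℕ → ℕ}
    (hκ : ∀ j, v j ∈ F (κ j)) : ∃ j, v j ∈ N (j + 1) := by
  by_contra! hcon
  set n := Fintype.card σ
  set L := c * (4 * n + 1) ^ n + 1
  -- from the step `k₀` on, the filtration contains `v j` for all `j < L`
  let k₀ := (Finset.range L).sup κ
  let G : (j k : ℕ) → Submodule K (V ⧸ N (j + 1)) := fun j k => (F k ⊓ N j).map (N (j + 1)).mkQ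
  have hfin : ∀ j k, FiniteDimensional K (F k ⊓ N j : Submodule K V) := fun j k =>
    Submodule.finiteDimensional_inf_left _ _
  -- each proper inclusion contributes to the rank of a late step of the filtration
  have hlow : ∀ j < L, ∀ m, (m + 1) ^ n ≤ Module.finrank K (G j (4 * n * m + k₀)) := by
    intro j hj m
    let x' : σ → Module.End K (V ⧸ N (j + 1)) := fun i =>
      (N (j + 1)).mapQ (N (j + 1)) (x i) (hNx i (j + 1))
    let d' : σ → Module.End K (V ⧸ N (j + 1)) := fun i =>
      (N (j + 1)).mapQ (N (j + 1)) (d i) (hNd i (j + 1))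
    have hxd : IsWeylAction x' d' := by
      refine ⟨fun i l => ?_, fun i l => ?_, fun i l => ?_⟩ <;>
        refine Submodule.linearMap_qext _ (LinearMap.ext fun u => ?_)
      · exact congrArg (N (j + 1)).mkQ (LinearMap.congr_fun (h.comm_x i l) u)
      · exact congrArg (N (j + 1)).mkQ (LinearMap.congr_fun (h.comm_d i l) u)
      · refine (congrArg (N (j + 1)).mkQ (LinearMap.congr_fun (h.d_mul_x i l) u)).trans ?_
        split_ifs <;> rfl
    refine hxd.pow_le_finrank (Q := G j) (v := (N (j + 1)).mkQ (v j)) ?_ ?_ ?_ ?_ ?_ m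
    · exact fun a b hab => Submodule.map_mono (inf_le_inf_right _ (hF hab))
    · rintro i k _ ⟨u, hu, rfl⟩
      exact ⟨x i u, ⟨hx i k u hu.1, hNx i j u hu.2⟩, rfl⟩
    · rintro i k _ ⟨u, hu, rfl⟩
      exact ⟨d i u, ⟨hd i k u hu.1, hNd i j u hu.2⟩, rfl⟩
    · exact ⟨v j, ⟨hF (Finset.le_sup (Finset.mem_range.2 hj)) (hκ j), hv j⟩, rfl⟩
    · rw [Submodule.mkQ_apply, Ne, Submodule.Quotient.mk_eq_zero]
      exact hcon j
  -- the contributions add up to at most the rank of that step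
  have hup : ∀ k l, ∑ j ∈ Finset.range l, Module.finrank K (G j k)
      + Module.finrank K (F k ⊓ N l : Submodule K V) ≤ Module.finrank K (F k) := by
    intro k l
    induction l with
    | zero => simpa using Submodule.finrank_mono (inf_le_left : F k ⊓ N 0 ≤ F k)
    | succ l ih =>
      refine le_trans (le_of_eq ?_) ih
      have h2 := LinearMap.finrank_range_add_finrank_ker
        ((N (l + 1)).mkQ.domRestrict (F k ⊓ N l : Submodule K V))
      rw [LinearMap.range_domRestrict, LinearMap.ker_domRestrict, Submodule.ker_mkQ] at h2
      have h3 : F k ⊓ N (l + 1) = ((N (l + 1)).submoduleOf (F k ⊓ N l)).map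
          (F k ⊓ N l).subtype := by
        rw [Submodule.submoduleOf, Submodule.map_comap_subtype, inf_assoc,
          inf_eq_right.2 (hN (Nat.le_succ l))]
      rw [Finset.sum_range_succ, add_assoc, ← h2, h3, Submodule.finrank_map_subtype_eq]
      rfl
  -- the two estimates are compared at the step `4 n k₀ + k₀`
  have h1 : L * (k₀ + 1) ^ n ≤ c * (4 * n * k₀ + k₀ + 1) ^ n := by
    calc L * (k₀ + 1) ^ n = ∑ j ∈ Finset.range L, (k₀ + 1) ^ n := by
          rw [Finset.sum_const, Finset.card_range, smul_eq_mul]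
      _ ≤ ∑ j ∈ Finset.range L, Module.finrank K (G j (4 * n * k₀ + k₀)) :=
          Finset.sum_le_sum fun j hj => hlow j (Finset.mem_range.1 hj) k₀
      _ ≤ Module.finrank K (F (4 * n * k₀ + k₀)) :=
          (Nat.le_add_right _ _).trans (hup _ L)
      _ ≤ _ := hc _
  have h2 : c * (4 * n * k₀ + k₀ + 1) ^ n ≤ c * (4 * n + 1) ^ n * (k₀ + 1) ^ n := by
    rw [mul_assoc c, ← mul_pow]
    gcongr
    nlinarith
  have h3 : 0 < (k₀ + 1) ^ n := by positivity
  have h4 := Nat.le_of_mul_le_mul_right (h1.trans h2) h3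
  omega

end Field

/-! ### Existence of the Bernstein-Sato polynomial -/

section BaseChange

open scoped TensorProduct

variable {R M : Type*} [CommRing R] [AddCommGroup M] [Module R M] (K : Type*) [CommRing K]
  [Algebra R K]

theorem baseChange_apply_mem {f : M →ₗ[R] M} {N N' : Submodule R M} (h : ∀ v ∈ N, f v ∈ N')
    {v : K ⊗[R] M} (hv : v ∈ N.baseChange K) : f.baseChange K v ∈ N'.baseChange K := by
  have hle : N.baseChange K ≤ (N'.baseChange K).comap (f.baseChange K) := by
    rw [Submodule.baseChange_eq_span, Submodule.span_le]
    rintro _ ⟨v, hv, rfl⟩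
    change f.baseChange K (1 ⊗ₜ v) ∈ N'.baseChange K
    rw [LinearMap.baseChange_tmul]
    exact Submodule.tmul_mem_baseChange_of_mem 1 (h v hv)
  exact hle hv

/-- Membership over the fraction field holds over the ring up to a common denominator. -/
theorem exists_smul_mem_of_tmul_mem_baseChange [IsFractionRing R K] {N : Submodule R M} {v : M}
    (h : (1 : K) ⊗ₜ[R] v ∈ N.baseChange K) : ∃ b ∈ nonZeroDivisors R, b • v ∈ N := by
  have h1 : (N.mkQ.baseChange K) ((1 : K) ⊗ₜ[R] v) = 0 := by
    have hle : N.baseChange K ≤ LinearMap.ker (N.mkQ.baseChange K) := by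
      rw [Submodule.baseChange_eq_span, Submodule.span_le]
      rintro _ ⟨v, hv, rfl⟩
      change N.mkQ.baseChange K (1 ⊗ₜ v) = 0
      rw [LinearMap.baseChange_tmul, Submodule.mkQ_apply, (Submodule.Quotient.mk_eq_zero N).2 hv,
        TensorProduct.tmul_zero]
    exact hle h
  rw [LinearMap.baseChange_tmul] at h1
  obtain ⟨b, hb⟩ := (IsLocalizedModule.eq_zero_iff (nonZeroDivisors R)
    (TensorProduct.mk R K (M ⧸ N) 1)).1 h1
  refine ⟨b, b.2, ?_⟩
  rw [← Submodule.Quotient.mk_eq_zero, Submodule.Quotient.mk_smul]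
  exact hb

end BaseChange

section PoleOrder

open MvPolynomial
open scoped TensorProduct

variable {σ : Type*}

/-- Multiplication by a variable, as an operator over `ℂ[s]`. -/
def mulVar (i : σ) : Module.End (Polynomial ℂ) (PowerModule (MvPolynomial σ ℂ) Unit) :=
  LinearMap.mulLeft _ (algebraMap (MvPolynomial σ ℂ) _ (X i))

/-- The action of `∂ i` on `Frac(A)[s] · g ^ s`, as an operator over `ℂ[s]`. -/
def partialOp (g : MvPolynomial σ ℂ) (i : σ) :
    Module.End (Polynomial ℂ) (PowerModule (MvPolynomial σ ℂ) Unit) where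
  toFun := connection (fun _ : Unit => g) (pderiv i)
  map_add' := map_add _
  map_smul' := connection_smul g (pderiv i)

theorem mulVar_apply (i : σ) (p : PowerModule (MvPolynomial σ ℂ) Unit) :
    mulVar i p = algebraMap (MvPolynomial σ ℂ) _ (X i) * p := rfl

theorem partialOp_apply (g : MvPolynomial σ ℂ) (i : σ)
    (p : PowerModule (MvPolynomial σ ℂ) Unit) :
    partialOp g i p = connection (fun _ : Unit => g) (pderiv i) p := rfl

theorem pderiv_comm (i j : σ) (p : MvPolynomial σ ℂ) :
    pderiv i (pderiv j p) = pderiv j (pderiv i p) := by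
  ext m
  simp only [coeff_pderiv, Finsupp.add_apply, add_right_comm m (Finsupp.single i 1)]
  by_cases h : i = j
  · subst h; ring
  · rw [Finsupp.single_eq_of_ne (Ne.symm h), Finsupp.single_eq_of_ne h]
    push_cast
    ring

/-- The quotient rule. -/
theorem extend_C_div {A ι : Type*} [CommRing A] [Algebra ℂ A] [IsDomain A] (δ : Derivation ℂ A A)
    (a : A) {b : A} (hb : b ≠ 0) :
    extend ι δ (C (algebraMap A (FractionRing A) a / algebraMap A (FractionRing A) b))
      = C ((algebraMap A (FractionRing A) (δ a) * algebraMap A (FractionRing A) b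
          - algebraMap A (FractionRing A) a * algebraMap A (FractionRing A) (δ b))
            / algebraMap A (FractionRing A) b ^ 2) := by
  have hb' : algebraMap A (FractionRing A) b ≠ 0 := fun h =>
    hb ((IsFractionRing.injective A (FractionRing A)) (by rw [map_zero]; exact h))
  have h1 : (C (algebraMap A (FractionRing A) a) : PowerModule A ι)
      = C (algebraMap A (FractionRing A) b)
        * C (algebraMap A (FractionRing A) a / algebraMap A (FractionRing A) b) := by
    rw [← map_mul, mul_div_cancel₀ _ hb']
  have h2 := congrArg (extend ι δ) h1
  rw [Derivation.leibniz, ← algebraMap_powerModule, ← algebraMap_powerModule, extend_algebraMap,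
    extend_algebraMap, algebraMap_powerModule, algebraMap_powerModule, algebraMap_powerModule,
    smul_eq_mul, smul_eq_mul] at h2
  have h3 : IsUnit (C (algebraMap A (FractionRing A) b) : PowerModule A ι) :=
    (IsUnit.mk0 _ hb').map C
  refine h3.mul_left_cancel ?_
  rw [eq_sub_of_add_eq h2.symm, ← map_mul, ← map_mul, ← map_sub]
  congr 1
  field_simp

/-- The mixed second derivatives of `log g` coincide, so that the partial derivatives commute on
`Frac(A)[s] · g ^ s`. -/
theorem partialOp_comm {g : MvPolynomial σ ℂ} (hg : g ≠ 0) (i j : σ)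
    (p : PowerModule (MvPolynomial σ ℂ) Unit) :
    partialOp g i (partialOp g j p) = partialOp g j (partialOp g i p) := by
  have h1 : ∀ p : PowerModule (MvPolynomial σ ℂ) Unit,
      extend Unit (pderiv i) (extend Unit (pderiv j) p)
        = extend Unit (pderiv j) (extend Unit (pderiv i) p) := by
    have h2 : ⁅extend Unit (pderiv i : Derivation ℂ (MvPolynomial σ ℂ) (MvPolynomial σ ℂ)),
        extend Unit (pderiv j : Derivation ℂ (MvPolynomial σ ℂ) (MvPolynomial σ ℂ))⁆
          = extend Unit (0 : Derivation ℂ (MvPolynomial σ ℂ) (MvPolynomial σ ℂ)) := by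
      refine ExtendsDerivation.unique (δ := 0) ⟨fun a => ?_, fun k => ?_⟩ (extend_spec _)
      · rw [Derivation.commutator_apply, extend_algebraMap, extend_algebraMap, extend_algebraMap,
          extend_algebraMap, pderiv_comm, sub_self, Derivation.zero_apply, map_zero]
      · rw [Derivation.commutator_apply, extend_X, extend_X, map_zero, map_zero, sub_self]
    have h3 : extend Unit (0 : Derivation ℂ (MvPolynomial σ ℂ) (MvPolynomial σ ℂ)) = 0 :=
      (extend_spec _).unique ⟨fun a => by simp, fun k => rfl⟩
    intro p
    have h4 := congrArg (fun D => D p) (h2.trans h3)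
    rw [Derivation.commutator_apply] at h4
    exact sub_eq_zero.1 h4
  have h2 : extend Unit (pderiv i) (logDerivative (fun _ : Unit => g) (pderiv j))
      = extend Unit (pderiv j) (logDerivative (fun _ : Unit => g) (pderiv i)) := by
    rw [logDerivative_unit, logDerivative_unit, Derivation.leibniz, Derivation.leibniz, extend_X,
      extend_X, smul_zero, smul_zero, extend_C_div _ _ hg, extend_C_div _ _ hg, pderiv_comm i j,
      mul_comm (algebraMap _ (FractionRing (MvPolynomial σ ℂ)) (pderiv j g))]
  simp only [partialOp_apply, connection_apply, map_add, Derivation.leibniz, h1, h2, smul_eq_mul]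
  ring

theorem isWeylAction_mulVar_partialOp [DecidableEq σ] {g : MvPolynomial σ ℂ} (hg : g ≠ 0) :
    IsWeylAction mulVar (partialOp g) := by
  refine ⟨fun i j => LinearMap.ext fun p => ?_, fun i j => LinearMap.ext fun p => ?_,
    fun i j => LinearMap.ext fun p => ?_⟩
  · rw [Module.End.mul_apply, Module.End.mul_apply, mulVar_apply, mulVar_apply, mulVar_apply,
      mulVar_apply, mul_left_comm]
  · exact partialOp_comm hg i j p
  · rw [Module.End.mul_apply, LinearMap.add_apply, Module.End.mul_apply, partialOp_apply,
      mulVar_apply, mulVar_apply, partialOp_apply, connection_apply, connection_apply,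
      Derivation.leibniz, extend_algebraMap, smul_eq_mul, smul_eq_mul, pderiv_X]
    split_ifs with h
    · subst h
      rw [Pi.single_eq_same, map_one, Module.End.one_apply]
      ring
    · rw [Pi.single_eq_of_ne (Ne.symm h), map_zero, LinearMap.zero_apply]
      ring

/-- The element `p / g ^ k` of `Frac(A)[s]`. -/
def poleFraction (g : MvPolynomial σ ℂ) (k : ℕ) (p : MvPolynomial σ ℂ) :
    PowerModule (MvPolynomial σ ℂ) Unit :=
  C (algebraMap _ (FractionRing (MvPolynomial σ ℂ)) p / algebraMap _ _ g ^ k)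

/-- The `ℂ[s]`-span of the fractions `p / g ^ k`, where `p` has degree at most `k e` in each of the
variables. These modules filter the localization `ℂ[x, s]_g`. -/
def poleSubmodule (g : MvPolynomial σ ℂ) (e k : ℕ) :
    Submodule (Polynomial ℂ) (PowerModule (MvPolynomial σ ℂ) Unit) :=
  Submodule.span _ (poleFraction g k '' {p | ∀ i, degreeOf i p ≤ k * e})

theorem poleFraction_mul {g : MvPolynomial σ ℂ} (hg : g ≠ 0) (k : ℕ) (p : MvPolynomial σ ℂ) :
    poleFraction g (k + 1) (p * g) = poleFraction g k p := by
  have hg' : algebraMap _ (FractionRing (MvPolynomial σ ℂ)) g ≠ 0 := fun h =>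
    hg ((IsFractionRing.injective _ (FractionRing (MvPolynomial σ ℂ))) (by rw [map_zero]; exact h))
  rw [poleFraction, poleFraction, map_mul, pow_succ, mul_div_mul_right _ _ hg']

theorem algebraMap_eq_poleFraction {g : MvPolynomial σ ℂ} (hg : g ≠ 0) (k : ℕ)
    (p : MvPolynomial σ ℂ) : algebraMap _ _ p = poleFraction g k (p * g ^ k) := by
  induction k with
  | zero => rw [poleFraction, pow_zero, pow_zero, div_one, mul_one, algebraMap_powerModule]
  | succ k ih => rw [pow_succ, ← mul_assoc, poleFraction_mul hg, ih]

theorem algebraMap_mul_poleFraction (g p q : MvPolynomial σ ℂ) (k : ℕ) :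
    algebraMap _ _ p * poleFraction g k q = poleFraction g k (p * q) := by
  rw [poleFraction, poleFraction, algebraMap_powerModule, ← map_mul, map_mul (algebraMap _ _),
    mul_div_assoc]

theorem degreeOf_pderiv_le (i j : σ) (p : MvPolynomial σ ℂ) :
    degreeOf i (pderiv j p) ≤ degreeOf i p := by
  classical
  rw [degreeOf_le_iff]
  intro m hm
  rw [mem_support_iff, coeff_pderiv] at hm
  have h1 := monomial_le_degreeOf i (mem_support_iff.2 (left_ne_zero_of_mul hm))
  exact (Nat.le_add_right _ _).trans h1

theorem partialOp_poleFraction {g : MvPolynomial σ ℂ} (hg : g ≠ 0) (i : σ) (k : ℕ)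
    (p : MvPolynomial σ ℂ) :
    partialOp g i (poleFraction g k p) = poleFraction g (k + 1) (pderiv i p * g) +
      (Polynomial.X - Polynomial.C (k : ℂ)) • poleFraction g (k + 1) (p * pderiv i g) := by
  have hg' : algebraMap _ (FractionRing (MvPolynomial σ ℂ)) g ≠ 0 := fun h =>
    hg ((IsFractionRing.injective _ (FractionRing (MvPolynomial σ ℂ))) (by rw [map_zero]; exact h))
  have h1 : ∀ k q, poleFraction g k q = algebraMap _ _ q *
      C (algebraMap _ (FractionRing (MvPolynomial σ ℂ)) g ^ (-(k : ℤ))) := by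
    intro k q
    rw [poleFraction, algebraMap_powerModule, ← map_mul, zpow_neg, zpow_natCast, div_eq_mul_inv]
  have h2 : ∀ q : MvPolynomial σ ℂ, poleFraction g (k + 1) (p * q) = C (algebraMap _
      (FractionRing (MvPolynomial σ ℂ)) q / algebraMap _ _ g) * poleFraction g k p := by
    intro q
    rw [poleFraction, poleFraction, ← map_mul, map_mul (algebraMap _ _), pow_succ,
      div_mul_div_comm, mul_comm (algebraMap _ _ q), mul_comm (_ ^ k)]
  rw [poleFraction_mul hg, h2, partialOp_apply, connection_apply, logDerivative_unit,
    exponent_smul_def, map_sub, Polynomial.aeval_X, Polynomial.aeval_C, h1, h1, Derivation.leibniz,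
    extend_algebraMap, extend_zpow _ hg, map_natCast, smul_eq_mul, smul_eq_mul, zsmul_eq_mul]
  push_cast
  ring

theorem mulVar_mem_poleSubmodule {g : MvPolynomial σ ℂ} (hg : g ≠ 0) {e : ℕ}
    (he : g.totalDegree + 1 ≤ e) (i : σ) (k : ℕ) {v : PowerModule (MvPolynomial σ ℂ) Unit}
    (hv : v ∈ poleSubmodule g e k) : mulVar i v ∈ poleSubmodule g e (k + 1) := by
  classical
  have hle : poleSubmodule g e k ≤ (poleSubmodule g e (k + 1)).comap (mulVar i) := by
    refine Submodule.span_le.2 ?_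
    rintro _ ⟨p, hp, rfl⟩
    refine Submodule.subset_span ⟨X i * p * g, fun j => ?_, ?_⟩
    · have h1 := degreeOf_mul_le j (X i * p) g
      have h2 := degreeOf_mul_le j (X i) p
      have h3 := degreeOf_le_totalDegree g j
      have h4 : degreeOf j (X i : MvPolynomial σ ℂ) ≤ 1 := by rw [degreeOf_X]; split_ifs <;> simp
      have h5 := hp j
      rw [add_mul]
      omega
    · rw [poleFraction_mul hg, mulVar_apply, algebraMap_mul_poleFraction]
  exact hle hv

theorem poleSubmodule_mono {g : MvPolynomial σ ℂ} (hg : g ≠ 0) {e : ℕ}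
    (he : g.totalDegree + 1 ≤ e) : Monotone (poleSubmodule g e) := by
  refine monotone_nat_of_le_succ fun k => Submodule.span_le.2 ?_
  rintro _ ⟨p, hp, rfl⟩
  refine Submodule.subset_span ⟨p * g, fun j => ?_, poleFraction_mul hg k p⟩
  have h1 := degreeOf_mul_le j p g
  have h3 := degreeOf_le_totalDegree g j
  have h5 := hp j
  rw [add_mul]
  omega

theorem partialOp_mem_poleSubmodule {g : MvPolynomial σ ℂ} (hg : g ≠ 0) {e : ℕ}
    (he : g.totalDegree + 1 ≤ e) (i : σ) (k : ℕ) {v : PowerModule (MvPolynomial σ ℂ) Unit}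
    (hv : v ∈ poleSubmodule g e k) : partialOp g i v ∈ poleSubmodule g e (k + 1) := by
  have hle : poleSubmodule g e k ≤ (poleSubmodule g e (k + 1)).comap (partialOp g i) := by
    refine Submodule.span_le.2 ?_
    rintro _ ⟨p, hp, rfl⟩
    refine (congrArg (· ∈ poleSubmodule g e (k + 1)) (partialOp_poleFraction hg i k p)).mpr
      (add_mem (Submodule.subset_span ⟨_, fun j => ?_, rfl⟩)
        (Submodule.smul_mem _ _ (Submodule.subset_span ⟨_, fun j => ?_, rfl⟩)))
    · have h1 := degreeOf_mul_le j (pderiv i p) g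
      have h2 := degreeOf_pderiv_le j i p
      have h3 := degreeOf_le_totalDegree g j
      have h5 := hp j
      rw [add_mul]
      omega
    · have h1 := degreeOf_mul_le j p (pderiv i g)
      have h2 := degreeOf_pderiv_le j i g
      have h3 := degreeOf_le_totalDegree g j
      have h5 := hp j
      rw [add_mul]
      omega
  exact hle hv

/-- The step `k` of the filtration is generated by `(k e + 1) ^ n` elements in the case of `n`
variables. -/
theorem poleSubmodule_eq_span_range [Fintype σ] (g : MvPolynomial σ ℂ) (e k : ℕ) :
    poleSubmodule g e k = Submodule.span (Polynomial ℂ)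
      (Set.range fun α : σ → Fin (k * e + 1) => poleFraction g k (∏ j, X j ^ (α j : ℕ))) := by
  classical
  refine le_antisymm (Submodule.span_le.2 ?_) (Submodule.span_le.2 ?_)
  · rintro _ ⟨p, hp, rfl⟩
    have h1 : poleFraction g k p
        = ∑ m ∈ p.support, poleFraction g k (monomial m (coeff m p)) := by
      have h2 : ∀ q, poleFraction g k q = algebraMap _ _ q * poleFraction g k 1 := fun q => by
        rw [algebraMap_mul_poleFraction, mul_one]
      rw [Finset.sum_congr rfl fun m _ => h2 _, ← Finset.sum_mul, ← map_sum,
        support_sum_monomial_coeff]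
      exact h2 p
    rw [SetLike.mem_coe, h1]
    refine sum_mem fun m hm => ?_
    have h2 : ∀ j, m j < k * e + 1 := fun j =>
      Nat.lt_succ_iff.2 ((monomial_le_degreeOf j hm).trans (hp j))
    rw [monomial_eq, Finsupp.prod_fintype _ _ (fun _ => pow_zero _), ← algebraMap_mul_poleFraction,
      ← MvPolynomial.algebraMap_eq, ← IsScalarTower.algebraMap_apply, ← Algebra.smul_def]
    exact Submodule.smul_of_tower_mem _ _ (Submodule.subset_span ⟨fun j => ⟨m j, h2 j⟩, rfl⟩)
  · rintro _ ⟨α, rfl⟩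
    refine Submodule.subset_span ⟨_, fun i => ?_, rfl⟩
    refine (degreeOf_prod_le i _ _).trans ?_
    rw [Finset.sum_eq_single i]
    · rw [degreeOf_X_self_pow]
      exact Nat.lt_succ_iff.1 (α i).2
    · intro j _ hj
      exact degreeOf_X_pow_of_ne _ hj.symm
    · exact fun h => absurd (Finset.mem_univ i) h

/-- `D[s] · g ^ (s + j + 1)` contains `b (s) g ^ (s + j)` for some `j` and some nonzero `b`. This is
the stabilization, over the field `ℂ(s)`, of the descending chain of the modules
`D(s) · g ^ (s + j)`. -/
theorem exists_smul_mem_powerSubmodule [Finite σ] {g : MvPolynomial σ ℂ} (hg : g ≠ 0) :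
    ∃ (j : ℕ) (b : Polynomial ℂ), b ≠ 0 ∧
      b • algebraMap _ (PowerModule (MvPolynomial σ ℂ) Unit) (g ^ j) ∈ powerSubmodule g (j + 1) := by
  classical
  have := Fintype.ofFinite σ
  let K := FractionRing (Polynomial ℂ)
  let e := g.totalDegree + 1
  have hF : ∀ k, ((poleSubmodule g e k).baseChange K) = Submodule.span K
      (Set.range fun α : σ → Fin (k * e + 1) =>
        (1 : K) ⊗ₜ[Polynomial ℂ] poleFraction g k (∏ j, X j ^ (α j : ℕ))) := by
    intro k
    rw [poleSubmodule_eq_span_range, Submodule.baseChange_span, ← Set.range_comp]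
    rfl
  have : ∀ k, FiniteDimensional K ((poleSubmodule g e k).baseChange K) := by
    intro k
    rw [hF]
    exact FiniteDimensional.span_of_finite K (Set.finite_range _)
  have hCZ : CharZero K := charZero_of_injective_algebraMap
    (IsFractionRing.injective (Polynomial ℂ) K)
  obtain ⟨j, hj⟩ := ((isWeylAction_mulVar_partialOp hg).baseChange K).exists_mem_of_antitone
    (F := fun k => (poleSubmodule g e k).baseChange K)
    (fun a b hab => Submodule.baseChange_mono K (poleSubmodule_mono hg le_rfl hab))
    (fun i k v hv => baseChange_apply_mem K
      (fun u hu => mulVar_mem_poleSubmodule hg le_rfl i k hu) hv)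
    (fun i k v hv => baseChange_apply_mem K
      (fun u hu => partialOp_mem_poleSubmodule hg le_rfl i k hu) hv)
    (e ^ Fintype.card σ)
    (fun k => by
      rw [hF, ← mul_pow]
      refine (finrank_range_le_card _).trans ?_
      rw [Fintype.card_fun, Fintype.card_fin]
      gcongr
      calc k * e + 1 ≤ k * e + e := Nat.add_le_add_left (Nat.le_add_left 1 g.totalDegree) _
        _ = e * (k + 1) := by ring)
    (N := fun j => (powerSubmodule g j).baseChange K)
    (antitone_nat_of_succ_le fun j => Submodule.baseChange_mono K (powerSubmodule_le
      (by
        rw [pow_succ', map_mul (algebraMap _ _)]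
        exact algebraMap_mul_mem_powerSubmodule g (algebraMap_pow_mem_powerSubmodule g j))
      (diffGen_mem_of_stable
        (fun i p hp => algebraMap_mul_mem_powerSubmodule _ hp)
        (fun i p hp => connection_mem_powerSubmodule _ hp))))
    (fun i j v hv => baseChange_apply_mem K
      (fun u hu => algebraMap_mul_mem_powerSubmodule _ hu) hv)
    (fun i j v hv => baseChange_apply_mem K
      (fun u hu => connection_mem_powerSubmodule _ hu) hv)
    (v := fun j => 1 ⊗ₜ algebraMap _ _ (g ^ j))
    (fun j => Submodule.tmul_mem_baseChange_of_mem 1 (algebraMap_pow_mem_powerSubmodule g j))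
    -- `g ^ j = g ^ (j + k) / g ^ k` satisfies the degree bound for `k = j deg g`
    (κ := fun j => j * g.totalDegree)
    (fun j => by
      refine Submodule.tmul_mem_baseChange_of_mem 1 ?_
      rw [algebraMap_eq_poleFraction hg (j * g.totalDegree), ← pow_add]
      refine Submodule.subset_span ⟨_, fun i => ?_, rfl⟩
      refine (degreeOf_pow_le i g _).trans
        ((Nat.mul_le_mul_left _ (degreeOf_le_totalDegree g i)).trans (le_of_eq ?_))
      simp only [e]
      ring)
  obtain ⟨b, hb, h⟩ := exists_smul_mem_of_tmul_mem_baseChange K hj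
  exact ⟨j, b, nonZeroDivisors.ne_zero hb, h⟩

/-- The substitution of `s - j` for `s` turns a functional equation that relates `g ^ (s + j)` and
`g ^ (s + j + 1)` into one that relates `g ^ s` and `g ^ (s + 1)`. -/
theorem elementEquation_comp_of_smul_mem {A : Type*} [CommRing A] [Algebra ℂ A] [IsDomain A] {g : A}
    (hg : g ≠ 0) {j : ℕ} {b : Polynomial ℂ}
    (h : b • algebraMap A (PowerModule A Unit) (g ^ j) ∈ powerSubmodule g (j + 1)) :
    ElementEquation g (b.comp (Polynomial.X - Polynomial.C (j : ℂ))) := by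
  rw [mem_powerSubmodule, ← Set.range_const (ι := Unit),
    mem_opClosure_diffGen_iff (f := fun _ : Unit => g) (fun _ => hg)
      (fun (k : ℕ) (_ : Unit) => (k : ℤ) - j) Set.univ
      (fun k => ⟨k () + j, trivial, by funext; push_cast; ring⟩)
      (x' := fun (_ : Unit) (k : ℕ) => g ^ (k + 1))
      (q := fun k : ℕ => algebraMap ℂ A
        ((b.comp (Polynomial.X - Polynomial.C (j : ℂ))).eval (k : ℂ)) * g ^ k)] at h
  · obtain ⟨H, hH, hq⟩ := h
    rw [elementEquation_iff hg, ← funext fun k => hq k trivial]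
    have hle : opClosure (functionGen fun (k : ℕ) (_ : Unit) => (k : ℤ) - j)
          (Set.range fun (_ : Unit) (k : ℕ) => g ^ (k + 1))
        ≤ opClosure (functionGen fun (k : ℕ) (_ : Unit) => (k : ℤ))
          (Set.range fun (_ : Unit) (k : ℕ) => g ^ (k + 1)) := by
      refine opClosure_le (subset_opClosure _ _) ?_
      rintro (a | i | δ) H hH
      · exact apply_mem_opClosure (.inl a) hH
      · refine (congrArg (· ∈ opClosure _ _) ?_).mp (sub_mem
          (apply_mem_opClosure (.inr (.inl i)) hH) (apply_mem_opClosure (.inl (j : A)) hH))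
        rw [functionGen_algebra, functionGen_exponent, functionGen_exponent]
        funext k
        simp [sub_mul]
      · exact apply_mem_opClosure (.inr (.inr δ)) hH
    exact hle hH
  · intro _ k
    rw [specialize_algebraMap, ← shiftedPower_unit, ← shiftedPower_add fun _ => hg,
      ← shiftedPower_unit]
    congr 1
    funext
    rw [Pi.add_apply]
    push_cast
    ring
  · intro k _
    rw [specialize_smul, specialize_algebraMap, smul_mul_assoc, ← shiftedPower_unit,
      ← shiftedPower_add fun _ => hg, map_mul, ← shiftedPower_unit, ← IsScalarTower.algebraMap_apply,
      ← Algebra.smul_def]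
    congr 1
    · simp
    · congr 1
      funext
      simp

/-- **Bernstein's theorem**: every nonzero polynomial satisfies a nontrivial functional equation. -/
theorem exists_elementEquation [Finite σ] {g : MvPolynomial σ ℂ} (hg : g ≠ 0) :
    ∃ b : Polynomial ℂ, b ≠ 0 ∧ ElementEquation g b := by
  obtain ⟨j, b, hb, h⟩ := exists_smul_mem_powerSubmodule hg
  refine ⟨_, ?_, elementEquation_comp_of_smul_mem hg h⟩
  rwa [sub_eq_add_neg, ← Polynomial.C_neg, Polynomial.comp_X_add_C_ne_zero_iff]

end PoleOrder

/-! ### The Bernstein-Sato polynomial of an ideal -/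

section Ideals

open MvPolynomial

variable {σ τ ι ι' : Type*} [Fintype σ] [Fintype τ] [Fintype ι] [Fintype ι']

theorem monic_X_add_one : (Polynomial.X + 1 : Polynomial ℂ).Monic := by
  simpa using Polynomial.monic_X_add_C (1 : ℂ)

theorem exists_monic_bernsteinIdeal_eq {g : MvPolynomial σ ℂ} (hg : g ≠ 0) :
    ∃ b : Polynomial ℂ, b.Monic ∧ bernsteinIdeal g = Ideal.span {b} := by
  obtain ⟨c, hc⟩ := IsPrincipalIdealRing.principal (bernsteinIdeal g)
  obtain ⟨d, hd, hdg⟩ := exists_elementEquation hg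
  have hc0 : c ≠ 0 := by
    rintro rfl
    rw [← mem_bernsteinIdeal, hc] at hdg
    exact hd (by simpa using hdg)
  refine ⟨normalize c, Polynomial.monic_normalize hc0, hc.trans ?_⟩
  exact Ideal.span_singleton_eq_span_singleton.2 (normalize_associated c).symm

theorem isBernsteinSatoOfElement_of_bernsteinIdeal_eq {A : Type*} [CommRing A] [Algebra ℂ A]
    [IsDomain A] {g : A} {b : Polynomial ℂ} (hb : b.Monic)
    (h : bernsteinIdeal g = Ideal.span {b}) : IsBernsteinSatoOfElement g b := by
  have h1 : ∀ c, ElementEquation g c ↔ b ∣ c := fun c => by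
    rw [← mem_bernsteinIdeal, h, Ideal.mem_span_singleton]
  exact ⟨hb, (h1 b).2 dvd_rfl, fun c hc hgc => Polynomial.natDegree_le_of_dvd ((h1 c).1 hgc) hc⟩

/-- The factor `s + 1` of the linear form is split off. -/
theorem isMinimalPolynomial_familyEquation [Nonempty ι] {f : ι → MvPolynomial σ ℂ}
    (hf : ∀ i, f i ≠ 0) {b : Polynomial ℂ} (hb : b.Monic)
    (h : bernsteinIdeal (linearForm f) = Ideal.span {(Polynomial.X + 1) * b}) :
    IsMinimalPolynomial (FamilyEquation f) b := by
  classical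
  have h1 : ∀ c, FamilyEquation f c ↔ b ∣ c := fun c => by
    rw [familyEquation_iff_elementEquation hf, ← mem_bernsteinIdeal, h, Ideal.mem_span_singleton,
      mul_dvd_mul_iff_left monic_X_add_one.ne_zero]
  exact ⟨hb, (h1 b).2 dvd_rfl, fun c hc hfc => Polynomial.natDegree_le_of_dvd ((h1 c).1 hfc) hc⟩

theorem exists_monic_bernsteinIdeal_linearForm_eq [Nonempty ι] {f : ι → MvPolynomial σ ℂ}
    (hf : ∀ i, f i ≠ 0) : ∃ b : Polynomial ℂ, b.Monic ∧
      bernsteinIdeal (linearForm f) = Ideal.span {(Polynomial.X + 1) * b} := by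
  classical
  obtain ⟨c, hc, h⟩ := exists_monic_bernsteinIdeal_eq (linearForm_ne_zero hf)
  have hmem : ElementEquation (linearForm f) c := by
    rw [← mem_bernsteinIdeal, h]
    exact Ideal.mem_span_singleton_self c
  obtain ⟨b, rfl⟩ := X_add_one_dvd_of_elementEquation hf hmem
  exact ⟨b, monic_X_add_one.of_mul_monic_left hc, h⟩

/-- Additional variables do not change the functional equation. -/
theorem bernsteinIdeal_outerProduct_one {f : MvPolynomial σ ℂ} (hf : f ≠ 0) :
    bernsteinIdeal (outerProduct f (1 : MvPolynomial τ ℂ)) = bernsteinIdeal f := by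
  obtain ⟨b, hb, h⟩ := exists_monic_bernsteinIdeal_eq hf
  rw [bernsteinIdeal_outerProduct hf one_ne_zero hb.ne_zero one_ne_zero h
    (bernsteinIdeal_one.trans Ideal.span_singleton_one.symm), mul_one, h]

theorem outerProduct_ne_zero {f : MvPolynomial σ ℂ} (hf : f ≠ 0) {g : MvPolynomial τ ℂ}
    (hg : g ≠ 0) : outerProduct f g ≠ 0 :=
  mul_ne_zero ((map_ne_zero_iff _ (rename_injective _ Sum.inl_injective)).2 hf)
    ((map_ne_zero_iff _ (rename_injective _ Sum.inr_injective)).2 hg)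

theorem bernsteinIdeal_linearForm_comp [Nonempty ι'] {f : ι' → MvPolynomial σ ℂ}
    (hf : ∀ i, f i ≠ 0) (e : ι ≃ ι') :
    bernsteinIdeal (linearForm (f ∘ e)) = bernsteinIdeal (linearForm f) := by
  classical
  have := e.nonempty
  rw [← bernsteinIdeal_algEquiv (renameEquiv ℂ (e.sumCongr (Equiv.refl σ)))
    (linearForm_ne_zero (f := f ∘ e) fun i => hf (e i))]
  congr 1
  simp only [linearForm, map_sum, map_mul, renameEquiv_apply, rename_X, rename_rename]
  exact Fintype.sum_equiv e _ _ fun i => rfl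

/-- The substitution `y i ↦ y i + ∑ k, a k i * z k`, in polynomials in the variables `y`, `x` and
`z`, which are reordered. -/
def shearHom (a : ι' → ι → MvPolynomial σ ℂ) :
    MvPolynomial ((ι ⊕ σ) ⊕ ι') ℂ →ₐ[ℂ] MvPolynomial ((ι ⊕ ι') ⊕ σ) ℂ :=
  aeval (Sum.elim (Sum.elim
    (fun i => X (.inl (.inl i)) + ∑ k, rename Sum.inr (a k i) * X (.inl (.inr k)))
    fun j => X (.inr j)) fun k => X (.inl (.inr k)))

/-- The substitution `y i ↦ y i - ∑ k, a k i * z k`, inverse to `shearHom a`. -/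
def unshearHom (a : ι' → ι → MvPolynomial σ ℂ) :
    MvPolynomial ((ι ⊕ ι') ⊕ σ) ℂ →ₐ[ℂ] MvPolynomial ((ι ⊕ σ) ⊕ ι') ℂ :=
  aeval (Sum.elim (Sum.elim
    (fun i => X (.inl (.inl i)) - ∑ k, rename (Sum.inl ∘ Sum.inr) (a k i) * X (.inr k))
    fun k => X (.inr k)) fun j => X (.inl (.inr j)))

section Shear

variable (a : ι' → ι → MvPolynomial σ ℂ)

theorem shearHom_X_left (i : ι) : shearHom a (X (.inl (.inl i)))
    = X (.inl (.inl i)) + ∑ k, rename Sum.inr (a k i) * X (.inl (.inr k)) :=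
  aeval_X _ _

theorem shearHom_X_middle (j : σ) : shearHom a (X (.inl (.inr j))) = X (.inr j) :=
  aeval_X _ _

theorem shearHom_X_right (k : ι') : shearHom a (X (.inr k)) = X (.inl (.inr k)) :=
  aeval_X _ _

theorem unshearHom_X_left (i : ι) : unshearHom a (X (.inl (.inl i)))
    = X (.inl (.inl i)) - ∑ k, rename (Sum.inl ∘ Sum.inr) (a k i) * X (.inr k) :=
  aeval_X _ _

theorem unshearHom_X_middle (k : ι') : unshearHom a (X (.inl (.inr k))) = X (.inr k) :=
  aeval_X _ _

theorem unshearHom_X_right (j : σ) : unshearHom a (X (.inr j)) = X (.inl (.inr j)) :=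
  aeval_X _ _

theorem shearHom_rename (p : MvPolynomial σ ℂ) :
    shearHom a (rename (Sum.inl ∘ Sum.inr) p) = rename Sum.inr p := by
  have h : (shearHom a).comp (rename (Sum.inl ∘ Sum.inr)) = rename Sum.inr :=
    algHom_ext fun j => by
      rw [AlgHom.comp_apply, rename_X, rename_X, Function.comp_apply, shearHom_X_middle]
  exact AlgHom.congr_fun h p

theorem unshearHom_rename (p : MvPolynomial σ ℂ) :
    unshearHom a (rename Sum.inr p) = rename (Sum.inl ∘ Sum.inr) p := by
  have h : (unshearHom a).comp (rename Sum.inr) = rename (Sum.inl ∘ Sum.inr) :=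
    algHom_ext fun j => by
      rw [AlgHom.comp_apply, rename_X, rename_X, Function.comp_apply, unshearHom_X_right]
  exact AlgHom.congr_fun h p

theorem shearHom_comp_unshearHom : (shearHom a).comp (unshearHom a) = AlgHom.id ℂ _ := by
  refine algHom_ext fun x => ?_
  rw [AlgHom.comp_apply, AlgHom.id_apply]
  rcases x with (i | k) | j
  · rw [unshearHom_X_left, map_sub, map_sum, shearHom_X_left, sub_eq_iff_eq_add]
    refine congrArg _ (Finset.sum_congr rfl fun k _ => ?_)
    rw [map_mul, shearHom_rename, shearHom_X_right]
  · rw [unshearHom_X_middle, shearHom_X_right]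
  · rw [unshearHom_X_right, shearHom_X_middle]

theorem unshearHom_comp_shearHom : (unshearHom a).comp (shearHom a) = AlgHom.id ℂ _ := by
  refine algHom_ext fun x => ?_
  rw [AlgHom.comp_apply, AlgHom.id_apply]
  rcases x with (i | j) | k
  · rw [shearHom_X_left, map_add, map_sum, unshearHom_X_left, ← eq_sub_iff_add_eq]
    refine congrArg _ (Finset.sum_congr rfl fun k _ => ?_)
    rw [map_mul, unshearHom_rename, unshearHom_X_middle]
  · rw [shearHom_X_middle, unshearHom_X_right]
  · rw [shearHom_X_right, unshearHom_X_middle]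

theorem shearHom_linearForm (f : ι → MvPolynomial σ ℂ) :
    shearHom a (rename Sum.inl (linearForm f))
      = linearForm (Sum.elim f fun k => ∑ i, a k i * f i) := by
  have h1 : ∀ i, shearHom a (rename Sum.inl (X (Sum.inl i) * rename Sum.inr (f i)))
      = X (.inl (.inl i)) * rename Sum.inr (f i)
        + ∑ k, X (.inl (.inr k)) * rename Sum.inr (a k i * f i) := by
    intro i
    rw [map_mul, map_mul, rename_X, rename_rename, shearHom_rename, shearHom_X_left, add_mul,
      Finset.sum_mul]
    refine congrArg _ (Finset.sum_congr rfl fun k _ => ?_)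
    rw [map_mul]
    ring
  rw [linearForm, linearForm, map_sum, map_sum, Fintype.sum_sum_type,
    Finset.sum_congr rfl fun i _ => h1 i, Finset.sum_add_distrib, Finset.sum_comm]
  refine congrArg _ (Finset.sum_congr rfl fun k _ => ?_)
  rw [← Finset.mul_sum, ← map_sum, Sum.elim_inr]

end Shear

/-- Adding to the family `f` elements of the ideal that it generates changes the linear form only
by a change of coordinates and additional variables. -/
theorem bernsteinIdeal_linearForm_sumElim [Nonempty ι] {f : ι → MvPolynomial σ ℂ}
    (hf : ∀ i, f i ≠ 0) {f' : ι' → MvPolynomial σ ℂ}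
    (hf' : ∀ i, f' i ∈ Ideal.span (Set.range f)) :
    bernsteinIdeal (linearForm (Sum.elim f f')) = bernsteinIdeal (linearForm f) := by
  classical
  choose a ha using fun i => (Ideal.mem_span_range_iff_exists_fun).1 (hf' i)
  have h0 := outerProduct_ne_zero (linearForm_ne_zero hf) (one_ne_zero (α := MvPolynomial ι' ℂ))
  have h1 := bernsteinIdeal_algEquiv (AlgEquiv.ofAlgHom (shearHom a) (unshearHom a)
    (shearHom_comp_unshearHom a) (unshearHom_comp_shearHom a)) h0
  rw [AlgEquiv.ofAlgHom_apply, bernsteinIdeal_outerProduct_one (linearForm_ne_zero hf),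
    outerProduct, map_one, mul_one, shearHom_linearForm] at h1
  rwa [← funext ha]

/-- The functional equation of a family depends only on the ideal that it generates: two families
are both compared with their union. -/
theorem bernsteinIdeal_linearForm_eq_of_span_eq [Nonempty ι] [Nonempty ι']
    {f : ι → MvPolynomial σ ℂ} (hf : ∀ i, f i ≠ 0) {f' : ι' → MvPolynomial σ ℂ}
    (hf' : ∀ i, f' i ≠ 0) (h : Ideal.span (Set.range f) = Ideal.span (Set.range f')) :
    bernsteinIdeal (linearForm f) = bernsteinIdeal (linearForm f') := by
  rw [← bernsteinIdeal_linearForm_sumElim hf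
      (f' := f') (fun i => h ▸ Ideal.subset_span (Set.mem_range_self i)),
    ← bernsteinIdeal_linearForm_sumElim hf'
      (f' := f) (fun i => h ▸ Ideal.subset_span (Set.mem_range_self i)),
    ← bernsteinIdeal_linearForm_comp (f := Sum.elim f' f)
      (by rintro (i | i); exacts [hf' i, hf i]) (Equiv.sumComm ι ι')]
  congr 2
  funext i
  rcases i with i | i <;> rfl

theorem isBernsteinSatoOfIdeal_of_bernsteinIdeal_eq [Nonempty ι] {f : ι → MvPolynomial σ ℂ}
    (hf : ∀ i, f i ≠ 0) {b : Polynomial ℂ} (hb : b.Monic)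
    (h : bernsteinIdeal (linearForm f) = Ideal.span {(Polynomial.X + 1) * b}) :
    IsBernsteinSatoOfIdeal (Ideal.span (Set.range f)) b := by
  intro r f' hf' hspan
  have : Nonempty (Fin r) := by
    by_contra hr
    rw [not_nonempty_iff] at hr
    rw [Set.range_eq_empty, Ideal.span_empty] at hspan
    have i := Classical.arbitrary ι
    have h1 : f i ∈ Ideal.span (Set.range f) := Ideal.subset_span (Set.mem_range_self i)
    rw [← hspan, Ideal.mem_bot] at h1
    exact hf i h1
  refine isMinimalPolynomial_familyEquation hf' hb ?_
  rw [bernsteinIdeal_linearForm_eq_of_span_eq hf' hf hspan, h]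

/-- The linear form with coefficients `f i * g` is the product of that of `f` and `g`, which involve
disjoint sets of variables. -/
theorem bernsteinIdeal_linearForm_outerProduct [Nonempty ι] {f : ι → MvPolynomial σ ℂ}
    (hf : ∀ i, f i ≠ 0) {g : MvPolynomial τ ℂ} (hg : g ≠ 0) :
    bernsteinIdeal (linearForm fun i => outerProduct (f i) g)
      = bernsteinIdeal (outerProduct (linearForm f) g) := by
  classical
  rw [← bernsteinIdeal_algEquiv (renameEquiv ℂ (Equiv.sumAssoc ι σ τ))
    (outerProduct_ne_zero (linearForm_ne_zero hf) hg)]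
  congr 1
  simp only [linearForm, outerProduct, map_sum, map_mul, renameEquiv_apply, rename_X,
    rename_rename, Finset.sum_mul]
  refine Finset.sum_congr rfl fun i _ => ?_
  rw [mul_assoc]
  rfl

theorem exists_ne_zero_generators {R : Type*} [CommRing R] [IsNoetherianRing R] (𝔞 : Ideal R) :
    ∃ (r : ℕ) (f : Fin r → R), (∀ i, f i ≠ 0) ∧ Ideal.span (Set.range f) = 𝔞 := by
  classical
  obtain ⟨S, hS⟩ := IsNoetherian.noetherian 𝔞
  refine ⟨(S.erase 0).card, fun i => ((S.erase 0).equivFin.symm i : R),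
    fun i => (Finset.mem_erase.1 ((S.erase 0).equivFin.symm i).2).1, ?_⟩
  have h1 : Set.range (fun i => ((S.erase 0).equivFin.symm i : R)) = (S : Set R) \ {0} := by
    rw [← Finset.coe_erase]
    refine ((S.erase 0).equivFin.symm.surjective.range_comp Subtype.val).trans ?_
    exact Subtype.range_coe
  rw [h1, Ideal.span, Submodule.span_sdiff_singleton_zero, hS]

end Ideals

end BernsteinSato

end

theorem mainTheorem3 (n m : ℕ) (𝔞 : Ideal (MvPolynomial (Fin n) ℂ)) (h𝔞 : 𝔞 ≠ ⊥)
    (g : MvPolynomial (Fin m) ℂ) (hg : g ≠ 0) :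
    ∃ b_𝔞 b_g b_𝔞g : Polynomial ℂ,
      BernsteinSato.IsBernsteinSatoOfIdeal 𝔞 b_𝔞 ∧
      BernsteinSato.IsBernsteinSatoOfElement g b_g ∧
      BernsteinSato.IsBernsteinSatoOfIdeal
        (𝔞.map (MvPolynomial.rename Sum.inl :
            MvPolynomial (Fin n) ℂ →ₐ[ℂ] MvPolynomial (Fin n ⊕ Fin m) ℂ) *
          Ideal.span {(MvPolynomial.rename Sum.inr g : MvPolynomial (Fin n ⊕ Fin m) ℂ)})
        b_𝔞g ∧
      b_𝔞g = b_𝔞 * b_g := by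
  classical
  open BernsteinSato in
  obtain ⟨r, f, hf, rfl⟩ := exists_ne_zero_generators 𝔞
  have : Nonempty (Fin r) := by
    by_contra hr
    rw [not_nonempty_iff] at hr
    exact h𝔞 (by rw [Set.range_eq_empty, Ideal.span_empty])
  obtain ⟨b, hb, hbf⟩ := exists_monic_bernsteinIdeal_linearForm_eq hf
  obtain ⟨c, hc, hcg⟩ := exists_monic_bernsteinIdeal_eq hg
  have hspan : Ideal.map (MvPolynomial.rename Sum.inl :
        MvPolynomial (Fin n) ℂ →ₐ[ℂ] MvPolynomial (Fin n ⊕ Fin m) ℂ) (Ideal.span (Set.range f)) *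
      Ideal.span {(MvPolynomial.rename Sum.inr g : MvPolynomial (Fin n ⊕ Fin m) ℂ)}
        = Ideal.span (Set.range fun i => outerProduct (f i) g) := by
    rw [Ideal.map_span, Ideal.span_mul_span', Set.mul_singleton, Set.image_image, ← Set.range_comp]
    rfl
  refine ⟨b, c, b * c, isBernsteinSatoOfIdeal_of_bernsteinIdeal_eq hf hb hbf,
    isBernsteinSatoOfElement_of_bernsteinIdeal_eq hc hcg, ?_, rfl⟩
  rw [hspan]
  refine isBernsteinSatoOfIdeal_of_bernsteinIdeal_eq
    (fun i => outerProduct_ne_zero (hf i) hg) (hb.mul hc) ?_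
  rw [bernsteinIdeal_linearForm_outerProduct hf hg, ← mul_assoc]
  exact bernsteinIdeal_outerProduct (linearForm_ne_zero hf) hg
    (monic_X_add_one.mul hb).ne_zero hc.ne_zero hbf hcg
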